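/- \textbf{Setting.} Let $\mathscr X$ be a Banach space, let $L$ be the generator of a strongly continuous semigroup on $\mathscr X$ (Assumption 1), let $t_0<T$, and let $u:[t_0,T]\to\mathscr X$ solve $u'(t)=f(u(t))=Lu(t)+N(u(t))$, $u(t_0)=u_0$ (with $u(t)\in D(L)$). Assume that $u$ and $N:\mathscr X\to\mathscr X$ are sufficiently smooth, $N$ in a strip $\{v:\operatorname{dist}(v,u([t_0,T]))<\delta\}$, $\delta>0$ (Assumption 2): for part (a) it suffices that $u$ is $C^4$ on $[t_0,T]$ and $N$ is $C^3$ in the strip; for parts (b), (c) that both are $C^5$. For $t\in[t_0,T]$ write $\tilde u=u(t)$, $\tilde u^{(k)}=u^{(k)}(t)$, $\tilde J=L+N'(\tilde u)$, $\tilde N(v)=N(v)-N'(\tilde u)v$, and $\partial^k\tilde N=\partial^k\tilde N(\tilde u)$. The operator $\tilde J$ generates a strongly continuous semigroup $e^{\tau\tilde J}$; for $k\ge 1$, $\tau\ge0$ put $\varphi_k(\tau\tilde J)=\int_0^1 e^{\tau(1-\theta)\tilde J}\frac{\theta^{k-1}}{(k-1)!}\,d\theta$. An $s$-stage EPIRK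 method is given by real coefficients $\alpha_{ij},\beta_j,p_{ijk}$ and $g_{ij}\ge 0$. Put $\psi_{ij}(z)=\sum_{k=1}^{K}p_{ijk}\varphi_k(z)$, $\mathbb P_{il}=\sum_{k=1}^{K}\frac{p_{i1k}}{(k+l-1)!}$ $(l=1,2,3)$, $$a_{ij}(z)=\sum_{k=j}^{i-1}(-1)^{k-j}\tbinom{k-1}{j-1}\alpha_{ik}\psi_{ik}(g_{ik}z),\qquad b_j(z)=\sum_{k=j}^{s}(-1)^{k-j}\tbinom{k-1}{j-1}\beta_k\psi_{s+1,k}(g_{s+1,k}z).$$ One step of size $h>0$ from the exact value $\tilde u$ is, for $i=2,\dots,s$, $$\widehat U_i=\tilde u+\alpha_{i1}\psi_{i1}(g_{i1}h\tilde J)hf(\tilde u)+h\sum_{j=2}^{i-1}a_{ij}(h\tilde J)\hat r_j,\qquad \hat r_j=\tilde N(\widehat U_j)-\tilde N(\tilde u),$$ $$\hat u=\tilde u+\beta_1\psi_{s+1,1}(g_{s+1,1}h\tilde J)hf(\tilde u)+h\sum_{i=2}^{s}b_i(h\tilde J)\hat r_i.$$ Let $V_i=\frac1h(\widehat U_i-\tilde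 u)$ and $\tilde e=\hat u-u(t+h)$. Below, $\mathcal O(h^m)$ denotes a term of norm at most $Ch^m$ for all $0<h\le h_0$, with $C$ and $h_0>0$ independent of $h$ and of $t\in[t_0,T]$ (with $t+h\le T$ in (b), (c)). \textbf{(a)} For $i=2,\dots,s$, $$V_i=\alpha_{i1}\mathbb P_{i1}\tilde u'+h\,\alpha_{i1}g_{i1}\mathbb P_{i2}\tilde u''+h^2\alpha_{i1}g_{i1}^2\mathbb P_{i3}\tilde u'''+h^2\,\Psi_i(h\tilde J)\,\partial^2\tilde N(\tilde u',\tilde u')+\mathcal O(h^3),$$ $$\Psi_i(z)=\frac1{2!}\sum_{j=2}^{i-1}\alpha_{j1}^2\mathbb P_{j1}^2a_{ij}(z)-\alpha_{i1}g_{i1}^2\sum_{k=1}^{K}p_{i1k}\varphi_{k+2}(g_{i1}z).$$ \textbf{(b)} With $b_i=b_i(h\tilde J)$, $\varphi_k=\varphi_k(h\tilde J)$ and $\sum=\sum_{i=2}^s$, the local error satisfies $$\begin{aligned}\tilde e={}&h\big(\beta_1\psi_{s+1,1}(g_{s+1,1}h\tilde J)-\varphi_1\big)f(\tilde u)+h^3\Big(\sum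 \tfrac{\alpha_{i1}^2\mathbb P_{i1}^2}{2!}b_i-\varphi_3\Big)\partial^2\tilde N(\tilde u',\tilde u')\\ &+h^4\Big(\sum \alpha_{i1}^2g_{i1}\mathbb P_{i1}\mathbb P_{i2}b_i-3\varphi_4\Big)\partial^2\tilde N(\tilde u',\tilde u'')+h^4\Big(\sum\tfrac{\alpha_{i1}^3\mathbb P_{i1}^3}{3!}b_i-\varphi_4\Big)\partial^3\tilde N(\tilde u',\tilde u',\tilde u')\\ &+h^5\Big(\sum \alpha_{i1}^2g_{i1}^2\mathbb P_{i1}\mathbb P_{i3}b_i-4\varphi_5\Big)\partial^2\tilde N(\tilde u',\tilde u''')+h^5\Big(\sum\tfrac{\alpha_{i1}^2g_{i1}^2\mathbb P_{i2}^2}{2!}b_i-3\varphi_5\Big)\partial^2\tilde N(\tilde u'',\tilde u'')\\ &+h^5\Big(\sum\tfrac{\alpha_{i1}^3g_{i1}\mathbb P_{i1}^2\mathbb P_{i2}}{2!}b_i-6\varphi_5\Big)\partial^3\tilde N(\tilde u',\tilde u',\tilde u'')+h^5\Big(\sum\tfrac{\alpha_{i1}^4\mathbb P_{i1}^4}{4!}b_i-\varphi_5\Big)\partial^4\tilde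 N(\tilde u',\tilde u',\tilde u',\tilde u')\\ &+h^5\sum\alpha_{i1}\mathbb P_{i1}\,b_i\,\partial^2\tilde N\big(\tilde u',\Psi_i(h\tilde J)\partial^2\tilde N(\tilde u',\tilde u')\big)+\mathcal O(h^6).\end{aligned}$$ \textbf{(c)} Consequently, if $\beta_1\psi_{s+1,1}(g_{s+1,1}Z)=\varphi_1(Z)$ for all real square matrices $Z$, then $\tilde e=\mathcal O(h^3)$. If in addition, for all real square matrices $Z,Q$ of equal size, (C1) holds, then $\tilde e=\mathcal O(h^4)$; if (C1)--(C3) hold, then $\tilde e=\mathcal O(h^5)$; and if (C1)--(C8) hold, then $\tilde e=\mathcal O(h^6)$, where (C1) $\sum b_i(Z)\alpha_{i1}^2\mathbb P_{i1}^2=2\varphi_3(Z)$; (C2) $\sum b_i(Z)\alpha_{i1}^2g_{i1}\mathbb P_{i1}\mathbb P_{i2}=3\varphi_4(Z)$; (C3) $\sum b_i(Z)\alpha_{i1}^3\mathbb P_{i1}^3=3!\,\varphi_4(Z)$; (C4) $\sum b_i(Z)\alpha_{i1}^2g_{i1}^2\mathbb P_{i1}\mathbb P_{i3}=4\varphi_5(Z)$;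 (C5) $\sum b_i(Z)\alpha_{i1}^2g_{i1}^2\mathbb P_{i2}^2=3!\,\varphi_5(Z)$; (C6) $\sum b_i(Z)\alpha_{i1}^3g_{i1}\mathbb P_{i1}^2\mathbb P_{i2}=12\varphi_5(Z)$; (C7) $\sum b_i(Z)\alpha_{i1}^4\mathbb P_{i1}^4=4!\,\varphi_5(Z)$; (C8) $\sum b_i(Z)\,\alpha_{i1}\mathbb P_{i1}\,Q\,\Psi_i(Z)=0$. -/

import Mathlib

open Set Filter Topology

noncomputable section

namespace StiffEPIRK

variable {X : Type*} [NormedAddCommGroup X] [NormedSpace ℝ X]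

/-! ### Strongly continuous semigroups and their generators -/

/-- `S` (restricted to `t ≥ 0`) is a strongly continuous semigroup of bounded operators. -/
structure IsC0Semigroup (S : ℝ → X →L[ℝ] X) : Prop where
  map_zero : S 0 = 1
  map_add : ∀ s t : ℝ, 0 ≤ s → 0 ≤ t → S (s + t) = S s * S t
  continuousOn : ∀ x : X, ContinuousOn (fun t => S t x) (Ici 0)

/-- The (in general unbounded) operator `A` is the infinitesimal generator of the strongly
continuous semigroup `S`: its graph consists of all `(x, y)` such that
`(S t x - x) / t → y` as `t ↓ 0`. -/
structure IsGenerator (A : X →ₗ.[ℝ] X) (S : ℝ → X →L[ℝ] X) : Prop where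
  semigroup : IsC0Semigroup S
  mem_graph_iff : ∀ x y : X, (x, y) ∈ A.graph ↔
    Tendsto (fun t : ℝ => t⁻¹ • (S t x - x)) (𝓝[>] 0) (𝓝 y)

open Classical in
/-- The semigroup `t ↦ e^{tA}` generated by `A` (and `0` if `A` generates no strongly continuous
semigroup). -/
def expSemigroup (A : X →ₗ.[ℝ] X) : ℝ → X →L[ℝ] X :=
  if hA : ∃ S, IsGenerator A S then hA.choose else 0

/-- The operator `φ_k(tA)`, where `S` is the semigroup generated by `A`:
`φ_0(tA) = e^{tA}` and, for `k ≥ 1`,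
`φ_k(tA) x = ∫_0^1 (θ^{k-1} / (k-1)!) e^{t(1-θ)A} x dθ`. -/
def phi (S : ℝ → X →L[ℝ] X) : ℕ → ℝ → X → X
  | 0, t, x => S t x
  | k + 1, t, x => ∫ θ in (0 : ℝ)..1, (θ ^ k / (k.factorial : ℝ)) • S (t * (1 - θ)) x

/-! ### The initial value problem `u' = f(u) = L u + N(u)` -/

open Classical in
/-- The right-hand side `f(v) = L v + N(v)`, for `v` in the domain of `L` (and `0` otherwise). -/
def rhs (L : X →ₗ.[ℝ] X) (N : X → X) (v : X) : X :=
  if hv : v ∈ L.domain then L ⟨v, hv⟩ + N v else 0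

/-- `u` solves `u' = L u + N(u)`, `u(t₀) = u₀`, on `[t₀, T]`. -/
structure IsSolution (L : X →ₗ.[ℝ] X) (N : X → X) (t₀ T : ℝ) (u₀ : X) (u : ℝ → X) : Prop where
  initial : u t₀ = u₀
  mem_domain : ∀ t ∈ Icc t₀ T, u t ∈ L.domain
  hasDeriv : ∀ t ∈ Icc t₀ T, HasDerivWithinAt u (rhs L N (u t)) (Icc t₀ T) t

/-- The strip of radius `δ` along the trajectory `u([t₀, T])`. -/
def strip (t₀ T : ℝ) (u : ℝ → X) (δ : ℝ) : Set X := Metric.thickening δ (u '' Icc t₀ T)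

/-- The Jacobian `J(v) = L + N'(v)`, with the domain of `L`. -/
def jacobian (L : X →ₗ.[ℝ] X) (N : X → X) (v : X) : X →ₗ.[ℝ] X :=
  (fderiv ℝ N v : X →ₗ[ℝ] X) +ᵥ L

/-- The nonlinearity `w ↦ N(w) - N'(v) w` left over after linearization at `v`. -/
def Ntilde (N : X → X) (v : X) : X → X := fun w => N w - fderiv ℝ N v w

/-! ### EPIRK methods -/

/-- The coefficients of an `s`-stage EPIRK method, where
`ψ_{ij}(z) = ∑_{k=1}^K p_{ijk} φ_k(z)`. The entries that are used are `α i j`, `g i j`, `p i j k`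
with `1 ≤ j < i`, and row `s + 1` of `g` and `p` belongs to the final update. -/
structure Method where
  s : ℕ
  K : ℕ
  α : ℕ → ℕ → ℝ
  β : ℕ → ℝ
  g : ℕ → ℕ → ℝ
  p : ℕ → ℕ → ℕ → ℝ
  g_nonneg : ∀ i j, 0 ≤ g i j

namespace Method

/-- `ℙ_{i,l} = ∑_{k=1}^K p_{i1k} / (k + l - 1)!` (used for `l = 1, 2, 3`). -/
def P (M : Method) (i l : ℕ) : ℝ :=
  ∑ k ∈ Finset.Icc 1 M.K, M.p i 1 k / ((k + l - 1).factorial : ℝ)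

/-- The operator `ψ_{ij}(g_{ij} h A)`, where `S` is the semigroup generated by `A`. -/
def psi (M : Method) (S : ℝ → X →L[ℝ] X) (h : ℝ) (i j : ℕ) (x : X) : X :=
  ∑ k ∈ Finset.Icc 1 M.K, M.p i j k • phi S k (M.g i j * h) x

/-- The operator `a_{ij}(hA)`, with
`a_{ij}(z) = ∑_{k=j}^{i-1} (-1)^{k-j} (k-1 choose j-1) α_{ik} ψ_{ik}(g_{ik} z)`. This collects the
contributions of `r(U_j)` to the forward differences
`Δ^{(k-1)} r = ∑_{j=2}^{k} (-1)^{k-j} (k-1 choose j-1) r(U_j)`. -/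
def a (M : Method) (S : ℝ → X →L[ℝ] X) (h : ℝ) (i j : ℕ) (x : X) : X :=
  ∑ k ∈ Finset.Ico j i,
    ((-1 : ℝ) ^ (k - j) * ((k - 1).choose (j - 1) : ℝ) * M.α i k) • M.psi S h i k x

/-- The operator `b_j(hA)`, with
`b_j(z) = ∑_{k=j}^{s} (-1)^{k-j} (k-1 choose j-1) β_k ψ_{s+1,k}(g_{s+1,k} z)`. -/
def b (M : Method) (S : ℝ → X →L[ℝ] X) (h : ℝ) (j : ℕ) (x : X) : X :=
  ∑ k ∈ Finset.Icc j M.s,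
    ((-1 : ℝ) ^ (k - j) * ((k - 1).choose (j - 1) : ℝ) * M.β k) • M.psi S h (M.s + 1) k x

/-- The operator `Ψ_i(hA)`, with
`Ψ_i(z) = (1/2) ∑_{j=2}^{i-1} α_{j1}² ℙ_{j1}² a_{ij}(z)
  - α_{i1} g_{i1}² ∑_{k=1}^K p_{i1k} φ_{k+2}(g_{i1} z)`. -/
def Psi (M : Method) (S : ℝ → X →L[ℝ] X) (h : ℝ) (i : ℕ) (x : X) : X :=
  (1 / 2 : ℝ) • ∑ j ∈ Finset.Ico 2 i, (M.α j 1 ^ 2 * M.P j 1 ^ 2) • M.a S h i j x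
    - (M.α i 1 * M.g i 1 ^ 2) •
      ∑ k ∈ Finset.Icc 1 M.K, M.p i 1 k • phi S (k + 2) (M.g i 1 * h) x

/-- The internal stages of one step of size `h` from `v`:
`U_i = v + α_{i1} ψ_{i1}(g_{i1} h A) h F + h ∑_{j=2}^{i-1} a_{ij}(hA) (R(U_j) - R(v))`,
where `S` is the semigroup generated by `A`. -/
def stage (M : Method) (S : ℝ → X →L[ℝ] X) (h : ℝ) (F : X) (R : X → X) (v : X) (i : ℕ) : X :=
  v + (M.α i 1 * h) • M.psi S h i 1 F
    + h • ∑ j ∈ (Finset.Ico 2 i).attach,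
        M.a S h i j.1 (R (M.stage S h F R v j.1) - R v)
termination_by i
decreasing_by exact (Finset.mem_Ico.mp j.2).2

section AlongSolution

variable (M : Method) (L : X →ₗ.[ℝ] X) (N : X → X) (u : ℝ → X) (t h : ℝ)

/-- The semigroup `τ ↦ e^{τ J̃}` with `J̃ = L + N'(u(t))`. -/
def expJ (L : X →ₗ.[ℝ] X) (N : X → X) (u : ℝ → X) (t : ℝ) : ℝ → X →L[ℝ] X :=
  expSemigroup (jacobian L N (u t))

/-- The stages `Û_i` of one step of size `h` that starts from the exact value `u(t)`. -/
def Uhat (i : ℕ) : X :=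
  M.stage (expJ L N u t) h (rhs L N (u t)) (Ntilde N (u t)) (u t) i

/-- `r̂_i = Ñ(Û_i) - Ñ(u(t))`. -/
def rhat (i : ℕ) : X :=
  Ntilde N (u t) (M.Uhat L N u t h i) - Ntilde N (u t) (u t)

/-- The normalized stage increments `V_i = (Û_i - u(t)) / h`. -/
def V (i : ℕ) : X := h⁻¹ • (M.Uhat L N u t h i - u t)

/-- The numerical solution after one step of size `h` that starts from the exact value `u(t)`. -/
def uhatNext : X :=
  u t + (M.β 1 * h) • M.psi (expJ L N u t) h (M.s + 1) 1 (rhs L N (u t))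
    + h • ∑ i ∈ Finset.Icc 2 M.s, M.b (expJ L N u t) h i (M.rhat L N u t h i)

/-- The local error `û(t + h) - u(t + h)`. -/
def localError : X := M.uhatNext L N u t h - u (t + h)

end AlongSolution

/-- The principal part of the local error, in terms of the semigroup `S` generated by `J̃`, the
value `F = f(ũ)`, the derivatives `u₁, u₂, u₃` of the solution and the derivatives
`D₂, D₃, D₄` of `Ñ` at `ũ`. -/
def localErrorPrincipal (M : Method) (S : ℝ → X →L[ℝ] X) (h : ℝ) (F u₁ u₂ u₃ : X)
    (D₂ : (Fin 2 → X) → X) (D₃ : (Fin 3 → X) → X) (D₄ : (Fin 4 → X) → X) : X :=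
  h • (M.β 1 • M.psi S h (M.s + 1) 1 F - phi S 1 h F)
  + h ^ 3 • (∑ i ∈ Finset.Icc 2 M.s,
        (M.α i 1 ^ 2 * M.P i 1 ^ 2 / 2) • M.b S h i (D₂ ![u₁, u₁])
      - phi S 3 h (D₂ ![u₁, u₁]))
  + h ^ 4 • (∑ i ∈ Finset.Icc 2 M.s,
        (M.α i 1 ^ 2 * M.g i 1 * M.P i 1 * M.P i 2) • M.b S h i (D₂ ![u₁, u₂])
      - (3 : ℝ) • phi S 4 h (D₂ ![u₁, u₂]))
  + h ^ 4 • (∑ i ∈ Finset.Icc 2 M.s,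
        (M.α i 1 ^ 3 * M.P i 1 ^ 3 / 6) • M.b S h i (D₃ ![u₁, u₁, u₁])
      - phi S 4 h (D₃ ![u₁, u₁, u₁]))
  + h ^ 5 • (∑ i ∈ Finset.Icc 2 M.s,
        (M.α i 1 ^ 2 * M.g i 1 ^ 2 * M.P i 1 * M.P i 3) • M.b S h i (D₂ ![u₁, u₃])
      - (4 : ℝ) • phi S 5 h (D₂ ![u₁, u₃]))
  + h ^ 5 • (∑ i ∈ Finset.Icc 2 M.s,
        (M.α i 1 ^ 2 * M.g i 1 ^ 2 * M.P i 2 ^ 2 / 2) • M.b S h i (D₂ ![u₂, u₂])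
      - (3 : ℝ) • phi S 5 h (D₂ ![u₂, u₂]))
  + h ^ 5 • (∑ i ∈ Finset.Icc 2 M.s,
        (M.α i 1 ^ 3 * M.g i 1 * M.P i 1 ^ 2 * M.P i 2 / 2) • M.b S h i (D₃ ![u₁, u₁, u₂])
      - (6 : ℝ) • phi S 5 h (D₃ ![u₁, u₁, u₂]))
  + h ^ 5 • (∑ i ∈ Finset.Icc 2 M.s,
        (M.α i 1 ^ 4 * M.P i 1 ^ 4 / 24) • M.b S h i (D₄ ![u₁, u₁, u₁, u₁])
      - phi S 5 h (D₄ ![u₁, u₁, u₁, u₁]))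
  + h ^ 5 • ∑ i ∈ Finset.Icc 2 M.s,
        (M.α i 1 * M.P i 1) • M.b S h i (D₂ ![u₁, M.Psi S h i (D₂ ![u₁, u₁])])

/-! ### The stiff order conditions, for arbitrary square matrices `Z` and `Q` -/

/-- The semigroup `t ↦ e^{tZ}` on `ℝ^m` of a square matrix `Z`. -/
def matExp {m : ℕ} (Z : Matrix (Fin m) (Fin m) ℝ) (t : ℝ) : (Fin m → ℝ) →L[ℝ] (Fin m → ℝ) :=
  LinearMap.toContinuousLinearMap (Matrix.toLin' (NormedSpace.exp (t • Z)))

/-- `∑_{i=2}^s c_i b_i(Z) = d φ_k(Z)` for all square matrices `Z`. -/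
def QuadratureCondition (M : Method) (c : ℕ → ℝ) (d : ℝ) (k : ℕ) : Prop :=
  ∀ (m : ℕ) (Z : Matrix (Fin m) (Fin m) ℝ) (x : Fin m → ℝ),
    ∑ i ∈ Finset.Icc 2 M.s, c i • M.b (matExp Z) 1 i x = d • phi (matExp Z) k 1 x

/-- `β_1 ψ_{s+1,1}(g_{s+1,1} Z) = φ_1(Z)`. -/
def C0 (M : Method) : Prop :=
  ∀ (m : ℕ) (Z : Matrix (Fin m) (Fin m) ℝ) (x : Fin m → ℝ),
    M.β 1 • M.psi (matExp Z) 1 (M.s + 1) 1 x = phi (matExp Z) 1 1 x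

def C1 (M : Method) : Prop :=
  M.QuadratureCondition (fun i => M.α i 1 ^ 2 * M.P i 1 ^ 2) 2 3

def C2 (M : Method) : Prop :=
  M.QuadratureCondition (fun i => M.α i 1 ^ 2 * M.g i 1 * M.P i 1 * M.P i 2) 3 4

def C3 (M : Method) : Prop :=
  M.QuadratureCondition (fun i => M.α i 1 ^ 3 * M.P i 1 ^ 3) 6 4

def C4 (M : Method) : Prop :=
  M.QuadratureCondition (fun i => M.α i 1 ^ 2 * M.g i 1 ^ 2 * M.P i 1 * M.P i 3) 4 5

def C5 (M : Method) : Prop :=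
  M.QuadratureCondition (fun i => M.α i 1 ^ 2 * M.g i 1 ^ 2 * M.P i 2 ^ 2) 6 5

def C6 (M : Method) : Prop :=
  M.QuadratureCondition (fun i => M.α i 1 ^ 3 * M.g i 1 * M.P i 1 ^ 2 * M.P i 2) 12 5

def C7 (M : Method) : Prop :=
  M.QuadratureCondition (fun i => M.α i 1 ^ 4 * M.P i 1 ^ 4) 24 5

/-- `∑_{i=2}^s α_{i1} ℙ_{i1} b_i(Z) Q Ψ_i(Z) = 0` for all square matrices `Z`, `Q`. -/
def C8 (M : Method) : Prop :=
  ∀ (m : ℕ) (Z Q : Matrix (Fin m) (Fin m) ℝ) (x : Fin m → ℝ),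
    ∑ i ∈ Finset.Icc 2 M.s,
      (M.α i 1 * M.P i 1) • M.b (matExp Z) 1 i (Q.mulVec (M.Psi (matExp Z) 1 i x)) = 0

/-- The method satisfies the stiff order conditions up to order `q` (for `2 ≤ q ≤ 5`). -/
def StiffOrder (M : Method) (q : ℕ) : Prop :=
  M.C0 ∧ (3 ≤ q → M.C1) ∧ (4 ≤ q → M.C2 ∧ M.C3) ∧
    (5 ≤ q → M.C4 ∧ M.C5 ∧ M.C6 ∧ M.C7 ∧ M.C8)

end Method

end StiffEPIRK

end

noncomputable section

set_option linter.unusedSectionVars false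

namespace StiffEPIRK

variable {X : Type*} [NormedAddCommGroup X] [NormedSpace ℝ X]

/-! ### Basic properties of strongly continuous semigroups -/

/-! The exact step and the numerical step are compared through the problem linearized at `ũ = u(t)`.
The increment `w(τ) = u(t+τ) - ũ` satisfies `w' = J̃ w + f(ũ) + (Ñ(u(t+τ)) - Ñ(ũ))`, so variation of
constants gives `u(t+h) - ũ = h φ₁ f(ũ) + ∫₀ʰ e^{(h-τ)J̃} (Ñ(u(t+τ)) - Ñ(ũ)) dτ`. The first
derivative of `Ñ` vanishes at `ũ`, hence the residual starts with `τ²`; expanding it in powers of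
`τ` turns the integral into `h^{k+1} φ_{k+1}` terms (`IsSolution.step_eq`,
`IsSolution.step_expansion`). The method applies `h ∑ b_i` to the same residual at its stages, so
one expansion (`residual_expansion`) serves both sides, and subtracting yields (b).

The difficulty is stiffness: no power of the unbounded `J̃` may enter a constant. Two facts replace
expansion in powers of `h J̃`. First, linear combinations of `φ_k(g h J̃)`, called symbols, are
bounded uniformly in `t` and `h`, because every `J̃` is a bounded perturbation of `L` by an operator
from a norm-bounded family (`IsGenerator.exists_vadd`, `exists_expJ_bound`). Second, differentiating
the equation and using that `L` is closed gives `J̃ũ' = ũ''`, `J̃ũ'' = ũ''' - ∂²Ñ(ũ',ũ')` and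
`J̃ũ'''` bounded (`IsSolution.jacobian_graph`). Three uses of `φ_k(z) = 1/k! + z φ_{k+1}(z)` on `ũ'`
then expand the stages (`Method.psi_expansion`, `Method.stage_expansion`). The defect `∂²Ñ(ũ',ũ')`
contributes one half of `Ψ_i`, the leading residuals of earlier stages the other half.

For (c), matrix identities must be carried over to semigroups. A symbol at `hJ̃` is the integral of
`e^{rhJ̃}` against a compactly supported measure on `[0,∞)`, and at a scalar `z` it is the transform
`∫ e^{rz}` of that measure. A vanishing transform annihilates all polynomials in `e^{-r}`, hence by
Bernstein approximation all continuous functions, in particular orbits (`sum_symOp_eq_zero`). For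
(C8) a nilpotent 2×2 matrix `Q` decouples the arguments of `b_i` and `Ψ_i`, and the transfer is made
once in each. -/

theorem phi_eq_integral_max {S : ℝ → X →L[ℝ] X} (k : ℕ) {τ : ℝ} (hτ : 0 ≤ τ) (x : X) :
    phi S (k + 1) τ x
      = ∫ θ in (0 : ℝ)..1, (θ ^ k / (k.factorial : ℝ)) • S (max (τ * (1 - θ)) 0) x := by
  refine intervalIntegral.integral_congr fun θ hθ => ?_
  rw [uIcc_of_le zero_le_one] at hθ
  rw [max_eq_left (mul_nonneg hτ (by linarith [hθ.2]))]

namespace IsC0Semigroup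

variable [CompleteSpace X] {S : ℝ → X →L[ℝ] X}

/-- Orbits are bounded on the compact interval, so uniform boundedness applies. -/
theorem exists_norm_le (hS : IsC0Semigroup S) (b : ℝ) : ∃ C, ∀ t ∈ Icc 0 b, ‖S t‖ ≤ C := by
  obtain ⟨C, hC⟩ := banach_steinhaus (g := fun t : Icc (0 : ℝ) b => S t) (fun x => by
    obtain ⟨C, hC⟩ := isCompact_Icc.exists_bound_of_continuousOn
      ((hS.continuousOn x).mono fun t (ht : t ∈ Icc (0 : ℝ) b) => ht.1)
    exact ⟨C, fun t => hC t t.2⟩)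
  exact ⟨C, fun t ht => hC ⟨t, ht⟩⟩

theorem exists_norm_le_exp (hS : IsC0Semigroup S) :
    ∃ C ω : ℝ, 1 ≤ C ∧ 0 ≤ ω ∧ ∀ t, 0 ≤ t → ‖S t‖ ≤ C * Real.exp (ω * t) := by
  obtain ⟨C₀, hC₀⟩ := hS.exists_norm_le 1
  set C := max C₀ 1 with hCdef
  have h1 : 1 ≤ C := le_max_right _ _
  have hC : ∀ t ∈ Icc (0 : ℝ) 1, ‖S t‖ ≤ C := fun t ht => (hC₀ t ht).trans (le_max_left _ _)
  have key : ∀ n : ℕ, ∀ r ∈ Icc (0 : ℝ) 1, ‖S (n + r)‖ ≤ C ^ n * C := by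
    intro n
    induction n with
    | zero => intro r hr; simpa using hC r hr
    | succ n ih =>
      intro r hr
      have : ((n + 1 : ℕ) : ℝ) + r = 1 + (n + r) := by push_cast; ring
      rw [this, hS.map_add _ _ zero_le_one (by have := hr.1; positivity)]
      calc ‖S 1 * S (n + r)‖ ≤ ‖S 1‖ * ‖S (n + r)‖ := norm_mul_le _ _
        _ ≤ C * (C ^ n * C) := by
          gcongr
          · exact hC 1 (by simp)
          · exact ih r hr
        _ = C ^ (n + 1) * C := by ring
  -- Split `t` into integer and fractional part: `‖S t‖ ≤ C^⌊t⌋ C`, and `C^⌊t⌋ ≤ e^{t log C}` since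
  -- `C ≥ 1`.
  refine ⟨C, Real.log C, h1, Real.log_nonneg h1, fun t ht => ?_⟩
  have hfl := Nat.floor_le ht
  have hlt := Nat.lt_floor_add_one t
  have := key ⌊t⌋₊ (t - ⌊t⌋₊) ⟨by linarith, by linarith⟩
  rw [add_sub_cancel] at this
  refine this.trans ?_
  rw [mul_comm]
  gcongr
  calc C ^ ⌊t⌋₊ = Real.exp (Real.log C * ⌊t⌋₊) := by
        rw [mul_comm, Real.exp_nat_mul, Real.exp_log (by linarith)]
    _ ≤ Real.exp (Real.log C * t) := by
        have := Real.log_nonneg h1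
        gcongr

/-- Strong continuity in time together with a locally uniform Lipschitz bound in space. Nothing is
known about `S` at negative times, so time is truncated at `0`; this makes orbits continuous on the
whole line. -/
theorem continuous_uncurry (hS : IsC0Semigroup S) :
    Continuous fun p : ℝ × X => S (max p.1 0) p.2 := by
  rw [continuous_iff_continuousAt]
  rintro ⟨t, x⟩
  obtain ⟨C, hC⟩ := hS.exists_norm_le (max (t + 1) 0)
  have h := continuousOn_prod_of_continuousOn_lipschitzOnWith'
    (fun p : ℝ × X => S (max p.1 0) p.2) C.toNNReal (s := Iio (t + 1)) (t := univ)
    (fun a ha => by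
      refine LipschitzWith.lipschitzOnWith ?_
      refine (S (max a 0)).lipschitz.weaken ?_
      rw [← NNReal.coe_le_coe, coe_nnnorm]
      exact (hC _ ⟨le_max_right _ _, max_le_max (le_of_lt ha) le_rfl⟩).trans
        (Real.le_coe_toNNReal C))
    (fun b _ => by
      refine Continuous.continuousOn ?_
      exact (hS.continuousOn b).comp_continuous (by fun_prop)
        (fun a => mem_Ici.2 (le_max_right _ _)))
  exact h.continuousAt (prod_mem_nhds (Iio_mem_nhds (by linarith)) univ_mem)

theorem continuous_apply (hS : IsC0Semigroup S) {Y : Type*} [TopologicalSpace Y] {a : Y → ℝ}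
    {w : Y → X} (ha : Continuous a) (hw : Continuous w) :
    Continuous fun y => S (max (a y) 0) (w y) :=
  hS.continuous_uncurry.comp (ha.prodMk hw)

theorem continuousOn_apply (hS : IsC0Semigroup S) {Y : Type*} [TopologicalSpace Y] {a : Y → ℝ}
    {w : Y → X} {s : Set Y} (ha : ContinuousOn a s) (hw : ContinuousOn w s)
    (h0 : ∀ y ∈ s, 0 ≤ a y) :
    ContinuousOn (fun y => S (a y) (w y)) s :=
  (hS.continuous_uncurry.comp_continuousOn (ha.prodMk hw)).congr
    (fun y hy => by simp [max_eq_left (h0 y hy)])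

theorem tendsto_apply (hS : IsC0Semigroup S) {Y : Type*} {l : Filter Y} {a : Y → ℝ} {w : Y → X}
    {a₀ : ℝ} {w₀ : X} (ha : Tendsto a l (𝓝 a₀)) (hw : Tendsto w l (𝓝 w₀))
    (h0 : ∀ᶠ y in l, 0 ≤ a y) (h0' : 0 ≤ a₀) :
    Tendsto (fun y => S (a y) (w y)) l (𝓝 (S a₀ w₀)) := by
  have h := (hS.continuous_uncurry.tendsto (a₀, w₀)).comp (ha.prodMk_nhds hw)
  simp only [max_eq_left h0'] at h
  refine h.congr' ?_
  filter_upwards [h0] with y hy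
  simp [max_eq_left hy]

theorem continuous_phi (hS : IsC0Semigroup S) (k : ℕ) :
    Continuous fun p : ℝ × X => phi S (k + 1) (max p.1 0) p.2 := by
  simp_rw [fun p : ℝ × X => phi_eq_integral_max (S := S) k (le_max_right p.1 0) p.2]
  refine intervalIntegral.continuous_parametric_intervalIntegral_of_continuous'
    (f := fun (p : ℝ × X) θ => (θ ^ k / (k.factorial : ℝ)) • S (max (max p.1 0 * (1 - θ)) 0) p.2)
    ?_ 0 1
  exact Continuous.smul (by fun_prop) (hS.continuous_apply (by fun_prop) (by fun_prop))

theorem phi_integrable (hS : IsC0Semigroup S) (k : ℕ) (τ : ℝ) (hτ : 0 ≤ τ) (x : X) :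
    IntervalIntegrable (fun θ => (θ ^ k / (k.factorial : ℝ)) • S (τ * (1 - θ)) x)
      MeasureTheory.volume 0 1 := by
  refine ContinuousOn.intervalIntegrable ?_
  rw [uIcc_of_le zero_le_one]
  refine ContinuousOn.smul (by fun_prop) (hS.continuousOn_apply (by fun_prop) (by fun_prop) ?_)
  exact fun θ hθ => mul_nonneg hτ (by linarith [hθ.2])

theorem phi_zero_time (hS : IsC0Semigroup S) (k : ℕ) (x : X) :
    phi S (k + 1) 0 x = (((k + 1).factorial : ℝ)⁻¹) • x := by
  simp only [phi, zero_mul, hS.map_zero, one_apply_eq_self]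
  rw [intervalIntegral.integral_smul_const]
  congr 1
  rw [intervalIntegral.integral_div, integral_pow]
  simp only [one_pow, ne_eq, Nat.add_eq_zero_iff, one_ne_zero, and_false, not_false_eq_true,
    zero_pow, sub_zero, Nat.factorial_succ, Nat.cast_mul]
  field_simp
  simp

end IsC0Semigroup
end StiffEPIRK

namespace StiffEPIRK

variable {X : Type*} [NormedAddCommGroup X] [NormedSpace ℝ X]

/-! ### Generators -/

theorem tendsto_sub_nhdsGT (τ : ℝ) : Tendsto (fun σ : ℝ => σ - τ) (𝓝[>] τ) (𝓝[>] 0) := by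
  refine tendsto_nhdsWithin_iff.2 ⟨?_, ?_⟩
  · have : Tendsto (fun σ : ℝ => σ - τ) (𝓝 τ) (𝓝 (τ - τ)) := tendsto_id.sub_const τ
    rw [sub_self] at this
    exact this.mono_left nhdsWithin_le_nhds
  · filter_upwards [self_mem_nhdsWithin] with σ hσ
    exact mem_Ioi.2 (sub_pos.2 (mem_Ioi.1 hσ))

/-- Substitute `τ = hθ`. This is how Taylor monomials under a Duhamel integral become `φ`-functions.
-/
theorem integral_pow_eq_phi (S : ℝ → X →L[ℝ] X) (k : ℕ) {h : ℝ} (hh : 0 ≤ h) (x : X) :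
    ∫ τ in (0 : ℝ)..h, S (h - τ) ((τ ^ k / (k.factorial : ℝ)) • x)
      = h ^ (k + 1) • phi S (k + 1) h x := by
  rcases hh.eq_or_lt with rfl | hpos
  · simp
  have e := intervalIntegral.smul_integral_comp_mul_left
    (E := X) (fun τ : ℝ => S (h - τ) ((τ ^ k / (k.factorial : ℝ)) • x)) h (a := 0) (b := 1)
  rw [mul_zero, mul_one] at e
  rw [← e, phi, pow_succ', mul_smul]
  congr 1
  rw [← intervalIntegral.integral_smul]
  refine intervalIntegral.integral_congr fun θ _ => ?_
  simp only [map_smul, smul_smul]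
  congr 1
  · ring
  · congr 2; ring

namespace IsGenerator

variable [CompleteSpace X] {A : X →ₗ.[ℝ] X} {S : ℝ → X →L[ℝ] X}

/-- The variation-of-constants formula for `w' = A w + F`. -/
theorem variation_of_constants (hA : IsGenerator A S) {h : ℝ} (hh : 0 ≤ h) {w F : ℝ → X}
    (hw : ContinuousOn w (Icc 0 h)) (hF : ContinuousOn F (Icc 0 h))
    (hd : ∀ τ ∈ Ioo 0 h, ∃ y, (w τ, y) ∈ A.graph ∧ HasDerivWithinAt w (y + F τ) (Ioi τ) τ) :
    w h = S h (w 0) + ∫ τ in (0 : ℝ)..h, S (h - τ) (F τ) := by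
  have hS := hA.semigroup
  have hsub : ∀ τ ∈ Icc (0 : ℝ) h, 0 ≤ h - τ := fun τ hτ => by linarith [hτ.2]
  have key := intervalIntegral.integral_eq_sub_of_hasDeriv_right_of_le
    (f := fun τ => S (h - τ) (w τ)) (f' := fun τ => S (h - τ) (F τ)) hh
    (hS.continuousOn_apply (by fun_prop) hw hsub) ?_ ?_
  · rw [key]
    simp [hS.map_zero]
  · intro τ hτ
    obtain ⟨y, hy, hdw⟩ := hd τ hτ
    rw [hasDerivWithinAt_iff_tendsto_slope' (by simp)] at hdw ⊢
    have h1 : Tendsto (fun σ => (σ - τ)⁻¹ • (S (σ - τ) (w τ) - w τ)) (𝓝[>] τ) (𝓝 y) :=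
      ((hA.mem_graph_iff _ _).1 hy).comp (tendsto_sub_nhdsGT τ)
    have h2 : Tendsto (fun σ => h - σ) (𝓝[>] τ) (𝓝 (h - τ)) :=
      ((continuous_const.sub continuous_id).tendsto τ).mono_left nhdsWithin_le_nhds
    have hev : ∀ᶠ σ in 𝓝[>] τ, σ ∈ Ioo τ h := Ioo_mem_nhdsGT hτ.2
    -- The right difference quotient of `S(h-τ) w(τ)` is `S(h-σ)` applied to the slope of `w` minus
    -- that of the orbit of `w τ`; the two limits `y + F τ` and `y` leave only `F τ`.
    have h3 := hS.tendsto_apply h2 (hdw.sub h1)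
      (by filter_upwards [hev] with σ hσ; linarith [hσ.2]) (by linarith [hτ.2])
    rw [add_sub_cancel_left] at h3
    refine h3.congr' ?_
    filter_upwards [hev] with σ hσ
    have e : S (h - τ) (w τ) = S (h - σ) (S (σ - τ) (w τ)) := by
      rw [show h - τ = (h - σ) + (σ - τ) by ring,
        hS.map_add _ _ (by linarith [hσ.2]) (by linarith [hσ.1])]
      rfl
    simp only [slope, vsub_eq_sub]
    rw [e, ← smul_sub, ← map_sub, map_smul]
    congr 2
    abel
  · refine ContinuousOn.intervalIntegrable ?_
    rw [uIcc_of_le hh]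
    exact hS.continuousOn_apply (by fun_prop) hF hsub

theorem apply_mem_graph (hA : IsGenerator A S) {x y : X} (hxy : (x, y) ∈ A.graph) {t : ℝ}
    (ht : 0 ≤ t) : (S t x, S t y) ∈ A.graph := by
  rw [hA.mem_graph_iff] at hxy ⊢
  refine (((S t).continuous.tendsto y).comp hxy).congr' ?_
  filter_upwards [self_mem_nhdsWithin] with r hr
  have hr : (0 : ℝ) ≤ r := le_of_lt hr
  have e : S t (S r x) = S r (S t x) := by
    have h1 := hA.semigroup.map_add t r ht hr
    rw [add_comm, hA.semigroup.map_add r t hr ht] at h1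
    exact (DFunLike.congr_fun h1 x).symm
  simp [e]

theorem hasDerivWithinAt_orbit (hA : IsGenerator A S) {x y : X} (hxy : (x, y) ∈ A.graph) {t : ℝ}
    (ht : 0 ≤ t) : HasDerivWithinAt (fun s => S s x) (S t y) (Ioi t) t := by
  rw [hasDerivWithinAt_iff_tendsto_slope' (by simp)]
  have h1 := (((S t).continuous.tendsto y).comp
    (((hA.mem_graph_iff _ _).1 hxy).comp (tendsto_sub_nhdsGT t)))
  refine h1.congr' ?_
  filter_upwards [self_mem_nhdsWithin] with r hr
  have hr : 0 ≤ r - t := sub_nonneg.2 (le_of_lt hr)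
  have e : S t (S (r - t) x) = S r x := by
    have := hA.semigroup.map_add t (r - t) ht hr
    rw [add_sub_cancel] at this
    rw [this]; rfl
  simp [slope, e]

/-- The recurrence `φ_k(hA) x = x / k! + h φ_{k+1}(hA) A x`, for `k ≥ 1`. -/
theorem phi_recurrence (hA : IsGenerator A S) {x y : X} (hxy : (x, y) ∈ A.graph) (k : ℕ) {h : ℝ}
    (hh : 0 ≤ h) :
    phi S (k + 1) h x = ((k + 1).factorial : ℝ)⁻¹ • x + h • phi S (k + 2) h y := by
  have hS := hA.semigroup
  rcases hh.eq_or_lt with rfl | hpos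
  · rw [hS.phi_zero_time]; simp
  -- The path `τ^{k+1}/(k+1)! x` starts at `0` and solves `w' = Aw + F` for this `F`. Its Duhamel
  -- formula is the recurrence multiplied by `h^{k+1}`, which is why `h = 0` is treated separately.
  have e1 := hA.variation_of_constants hh
    (w := fun τ => (τ ^ (k + 1) / ((k + 1).factorial : ℝ)) • x)
    (F := fun τ => (τ ^ k / (k.factorial : ℝ)) • x
      - (τ ^ (k + 1) / ((k + 1).factorial : ℝ)) • y) (by fun_prop) (by fun_prop) ?_
  · have i1 : ∀ (j : ℕ) (z : X), IntervalIntegrable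
        (fun τ => S (h - τ) ((τ ^ j / (j.factorial : ℝ)) • z)) MeasureTheory.volume 0 h := by
      intro j z
      refine ContinuousOn.intervalIntegrable ?_
      rw [uIcc_of_le hh]
      exact hS.continuousOn_apply (by fun_prop) (by fun_prop) fun τ hτ => by linarith [hτ.2]
    simp only [map_sub] at e1
    rw [intervalIntegral.integral_sub (i1 _ _) (i1 _ _), integral_pow_eq_phi S k hh,
      integral_pow_eq_phi S (k + 1) hh] at e1
    simp only [ne_eq, Nat.add_eq_zero_iff, one_ne_zero, and_false, not_false_eq_true, zero_pow,
      zero_div, zero_smul, map_zero, zero_add] at e1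
    have hne : h ^ (k + 1) ≠ 0 := by positivity
    have e2 : h ^ (k + 1) • phi S (k + 1) h x
        = h ^ (k + 1) • (((k + 1).factorial : ℝ)⁻¹ • x + h • phi S (k + 2) h y) := by
      rw [smul_add, smul_smul, smul_smul, ← pow_succ, ← div_eq_mul_inv, e1]
      abel
    exact smul_right_injective X hne e2
  · intro τ _
    refine ⟨(τ ^ (k + 1) / ((k + 1).factorial : ℝ)) • y, A.graph.smul_mem _ hxy, ?_⟩
    rw [add_sub_cancel]
    have : HasDerivAt (fun τ : ℝ => τ ^ (k + 1) / ((k + 1).factorial : ℝ))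
        (τ ^ k / (k.factorial : ℝ)) τ := by
      refine ((hasDerivAt_pow (k + 1) τ).div_const _).congr_deriv ?_
      rw [Nat.factorial_succ, Nat.add_sub_cancel]
      push_cast
      have : (k : ℝ) + 1 ≠ 0 := by positivity
      field_simp
    exact (this.smul_const x).hasDerivWithinAt

/-- The constant path `x` solves `w' = Aw - Ax`; this is the recurrence at `k = 0`. -/
theorem sub_eq_smul_phi (hA : IsGenerator A S) {x y : X} (hxy : (x, y) ∈ A.graph) {h : ℝ}
    (hh : 0 ≤ h) : S h x - x = h • phi S 1 h y := by
  have e := hA.variation_of_constants hh (w := fun _ => x) (F := fun _ => -y) (by fun_prop)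
    (by fun_prop) (fun τ _ => ⟨y, hxy, by
      rw [add_neg_cancel]; exact hasDerivWithinAt_const _ _ _⟩)
  have e2 := integral_pow_eq_phi S 0 hh y
  simp only [pow_zero, Nat.factorial_zero, Nat.cast_one, div_one, one_smul, zero_add, pow_one]
    at e2
  simp only [map_neg] at e
  rw [intervalIntegral.integral_neg, e2] at e
  nth_rewrite 2 [e]
  abel

/-- The generator of a strongly continuous semigroup is closed. -/
theorem mem_graph_of_tendsto (hA : IsGenerator A S) {ι : Type*} {l : Filter ι} [l.NeBot]
    {x y : ι → X} {x₀ y₀ : X} (hxy : ∀ᶠ i in l, (x i, y i) ∈ A.graph)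
    (hx : Tendsto x l (𝓝 x₀)) (hy : Tendsto y l (𝓝 y₀)) : (x₀, y₀) ∈ A.graph := by
  have hS := hA.semigroup
  -- In this integrated form only bounded operators occur, so it survives the limit; dividing by `h`
  -- and letting `h ↓ 0` recovers the generator.
  have key : ∀ h : ℝ, 0 ≤ h → S h x₀ - x₀ = h • phi S 1 h y₀ := by
    intro h hh
    have c := hS.continuous_phi 0
    have t1 : Tendsto (fun i => phi S 1 h (y i)) l (𝓝 (phi S 1 h y₀)) := by
      have := (c.tendsto (h, y₀)).comp (tendsto_const_nhds.prodMk_nhds hy)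
      simpa [Function.comp_def, max_eq_left hh] using this
    have t2 : Tendsto (fun i => S h (x i) - x i) l (𝓝 (S h x₀ - x₀)) :=
      (((S h).continuous.tendsto x₀).comp hx).sub hx
    refine tendsto_nhds_unique t2 ((t1.const_smul h).congr' ?_)
    filter_upwards [hxy] with i hi
    exact (hA.sub_eq_smul_phi hi hh).symm
  rw [hA.mem_graph_iff]
  have t3 : Tendsto (fun h : ℝ => phi S 1 (max h 0) y₀) (𝓝[>] 0) (𝓝 y₀) := by
    have := ((hS.continuous_phi 0).comp
      (continuous_id.prodMk (continuous_const (y := y₀)))).tendsto (0 : ℝ)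
    simp only [Function.comp_def, id, max_self, hS.phi_zero_time] at this
    simpa using this.mono_left nhdsWithin_le_nhds
  refine t3.congr' ?_
  filter_upwards [self_mem_nhdsWithin] with h hh
  have hh : 0 < h := hh
  rw [key h hh.le, max_eq_left hh.le, smul_smul, inv_mul_cancel₀ hh.ne', one_smul]

/-- The vector `ε φ₁(εA) x` is `∫₀^ε S(s)x ds`. Applying `S t - 1` shifts the interval, and only the
two end pieces of length `t` remain. -/
theorem phi_one_mem_graph (hA : IsGenerator A S) (x : X) {ε : ℝ} (hε : 0 < ε) :
    (ε • phi S 1 ε x, S ε x - x) ∈ A.graph := by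
  have hS := hA.semigroup
  set f : ℝ → X := fun s => S (max s 0) x with hf
  have hfc : Continuous f := hS.continuous_apply continuous_id continuous_const
  have hI : ∀ a b, IntervalIntegrable f MeasureTheory.volume a b :=
    fun a b => hfc.intervalIntegrable a b
  have e1 : ε • phi S 1 ε x = ∫ s in (0 : ℝ)..ε, f s := by
    have e2 := integral_pow_eq_phi S 0 hε.le x
    simp only [pow_zero, Nat.factorial_zero, Nat.cast_one, div_one, one_smul, zero_add, pow_one]
      at e2
    rw [← e2]
    have := intervalIntegral.integral_comp_sub_left f ε (a := 0) (b := ε)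
    rw [sub_self, sub_zero] at this
    rw [← this]
    refine intervalIntegral.integral_congr fun s hs => ?_
    rw [uIcc_of_le hε.le] at hs
    simp only [hf]
    rw [max_eq_left (by linarith [hs.2])]
  rw [hA.mem_graph_iff, e1]
  have d : ∀ a, Tendsto (fun t : ℝ => t⁻¹ • ∫ s in a..(a + t), f s) (𝓝[>] 0) (𝓝 (f a)) := by
    intro a
    have := (intervalIntegral.integral_hasDerivAt_right (hI a a)
      (hfc.stronglyMeasurableAtFilter _ _) hfc.continuousAt).hasDerivWithinAt (s := Ioi a)
    rw [hasDerivWithinAt_iff_tendsto_slope' (by simp)] at this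
    have h2 : Tendsto (fun t : ℝ => a + t) (𝓝[>] 0) (𝓝[>] a) := by
      refine tendsto_nhdsWithin_iff.2 ⟨?_, ?_⟩
      · have : Tendsto (fun t : ℝ => a + t) (𝓝 0) (𝓝 (a + 0)) := tendsto_id.const_add a
        rw [add_zero] at this
        exact this.mono_left nhdsWithin_le_nhds
      · filter_upwards [self_mem_nhdsWithin] with t ht
        have : (0 : ℝ) < t := ht
        simpa using this
    refine (this.comp h2).congr fun t => ?_
    simp [slope]
  have h3 := (d ε).sub (d 0)
  have hfε : f ε = S ε x := by simp [hf, max_eq_left hε.le]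
  have hf0 : f 0 = x := by simp [hf, hS.map_zero]
  rw [hfε, hf0] at h3
  refine h3.congr' ?_
  filter_upwards [self_mem_nhdsWithin] with t ht
  have ht : 0 < t := ht
  rw [← smul_sub]
  congr 1
  have e4 : S t (∫ s in (0 : ℝ)..ε, f s) = ∫ s in t..(ε + t), f s := by
    rw [← (S t).intervalIntegral_comp_comm (hI 0 ε)]
    have := intervalIntegral.integral_comp_add_right f t (a := 0) (b := ε)
    rw [zero_add] at this
    rw [← this]
    refine intervalIntegral.integral_congr fun s hs => ?_
    rw [uIcc_of_le hε.le] at hs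
    simp only [hf]
    rw [max_eq_left hs.1, max_eq_left (by linarith [hs.1]), add_comm s t,
      hS.map_add _ _ ht.le hs.1]
    rfl
  rw [e4, zero_add]
  have a1 := intervalIntegral.integral_add_adjacent_intervals (hI 0 ε) (hI ε (ε + t))
  have a2 := intervalIntegral.integral_add_adjacent_intervals (hI 0 t) (hI t (ε + t))
  rw [sub_eq_sub_iff_add_eq_add, add_comm, a1, add_comm (∫ s in t..(ε + t), f s), a2]

/-- The orbit means `φ₁(hA) x` lie in the domain and tend to `x`. -/
theorem dense_domain (hA : IsGenerator A S) : Dense {x : X | ∃ y, (x, y) ∈ A.graph} := by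
  intro x
  have hS := hA.semigroup
  have t3 : Tendsto (fun h : ℝ => phi S 1 (max h 0) x) (𝓝[>] 0) (𝓝 x) := by
    have := ((hS.continuous_phi 0).comp
      (continuous_id.prodMk (continuous_const (y := x)))).tendsto (0 : ℝ)
    simp only [Function.comp_def, id, max_self, hS.phi_zero_time] at this
    simpa using this.mono_left nhdsWithin_le_nhds
  refine mem_closure_of_tendsto t3 ?_
  filter_upwards [self_mem_nhdsWithin] with h hh
  have hh : 0 < h := hh
  refine ⟨h⁻¹ • (S h x - x), ?_⟩
  have := A.graph.smul_mem h⁻¹ (hA.phi_one_mem_graph x hh)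
  rw [max_eq_left hh.le]
  simpa [smul_smul, inv_mul_cancel₀ hh.ne'] using this

/-- A strongly continuous semigroup is determined by its generator. -/
theorem semigroup_unique {S' : ℝ → X →L[ℝ] X} (hA : IsGenerator A S) (hA' : IsGenerator A S')
    {t : ℝ} (ht : 0 ≤ t) : S t = S' t := by
  refine ContinuousLinearMap.coeFn_injective ?_
  refine (S t).continuous.ext_on hA.dense_domain (S' t).continuous ?_
  rintro x ⟨y, hxy⟩
  -- For `x` in the domain the orbit under `S'` solves `w' = Aw`, so variation of constants for `S`
  -- identifies it with the orbit under `S`.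
  have := hA.variation_of_constants ht (w := fun s => S' s x) (F := fun _ => 0)
    ((hA'.semigroup.continuousOn x).mono fun s hs => hs.1) continuousOn_const
    (fun τ hτ => ⟨S' τ y, hA'.apply_mem_graph hxy hτ.1.le, by
      simpa using hA'.hasDerivWithinAt_orbit hxy hτ.1.le⟩)
  simpa [hA'.semigroup.map_zero] using this.symm

end IsGenerator
end StiffEPIRK

namespace StiffEPIRK

variable {X : Type*} [NormedAddCommGroup X] [NormedSpace ℝ X]

/-! ### Bounded perturbations of generators -/

section Perturbation

theorem mem_graph_vadd_iff {A : X →ₗ.[ℝ] X} {B : X →L[ℝ] X} {x y : X} :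
    (x, y) ∈ ((B : X →ₗ[ℝ] X) +ᵥ A).graph ↔ (x, y - B x) ∈ A.graph := by
  simp only [LinearPMap.mem_graph_iff, LinearPMap.vadd_apply]
  constructor
  · rintro ⟨z, rfl, rfl⟩
    exact ⟨z, rfl, by simp⟩
  · rintro ⟨z, rfl, hz⟩
    exact ⟨z, rfl, by simp [hz]⟩

variable [CompleteSpace X] {A : X →ₗ.[ℝ] X} {S : ℝ → X →L[ℝ] X}

theorem IsC0Semigroup.intervalIntegrable_apply (hS : IsC0Semigroup S) {w : ℝ → X}
    (hw : Continuous w) {t : ℝ} (ht : 0 ≤ t) :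
    IntervalIntegrable (fun s => S (t - s) (w s)) MeasureTheory.volume 0 t := by
  refine ContinuousOn.intervalIntegrable ?_
  rw [uIcc_of_le ht]
  exact hS.continuousOn_apply (by fun_prop) hw.continuousOn fun s hs => by linarith [hs.2]

/-- A homogeneous Volterra equation has only the trivial solution. -/
theorem volterra_eq_zero (hS : IsC0Semigroup S) (B : X →L[ℝ] X) {v : ℝ → X} (hv : Continuous v)
    (h : ∀ t, 0 ≤ t → v t = ∫ s in (0 : ℝ)..t, S (t - s) (B (v s))) {t : ℝ} (ht : 0 ≤ t) :
    v t = 0 := by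
  obtain ⟨C, hC⟩ := hS.exists_norm_le t
  have hC0 : 0 ≤ C := (norm_nonneg _).trans (hC 0 ⟨le_rfl, ht⟩)
  -- Gronwall is applied to the integral of `‖v‖`, which is differentiable although `v` is only
  -- continuous.
  set I : ℝ → ℝ := fun r => ∫ s in (0 : ℝ)..r, ‖v s‖ with hI
  have hInn : ∀ r, 0 ≤ r → 0 ≤ I r := fun r hr =>
    intervalIntegral.integral_nonneg hr fun s _ => norm_nonneg _
  have hbd : ∀ r ∈ Icc 0 t, ‖v r‖ ≤ C * ‖B‖ * I r := by
    intro r hr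
    rw [h r hr.1, hI, ← intervalIntegral.integral_const_mul]
    refine intervalIntegral.norm_integral_le_of_norm_le hr.1 ?_
      ((hv.norm.const_mul (C * ‖B‖)).intervalIntegrable _ _)
    refine Eventually.of_forall fun s hs => ?_
    calc ‖S (r - s) (B (v s))‖ ≤ ‖S (r - s)‖ * (‖B‖ * ‖v s‖) :=
          (S (r - s)).le_opNorm_of_le (B.le_opNorm _)
      _ ≤ C * (‖B‖ * ‖v s‖) := by
          gcongr
          exact hC _ ⟨by linarith [hs.2], by linarith [hs.1, hr.2]⟩
      _ = C * ‖B‖ * ‖v s‖ := by ring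
  have hder : ∀ r, HasDerivAt I ‖v r‖ r := fun r =>
    intervalIntegral.integral_hasDerivAt_right (hv.norm.intervalIntegrable _ _)
      (hv.norm.stronglyMeasurableAtFilter _ _) hv.norm.continuousAt
  have := norm_le_gronwallBound_of_norm_deriv_right_le (f := I) (f' := fun r => ‖v r‖) (δ := 0)
    (K := C * ‖B‖) (ε := 0) (a := 0) (b := t)
    (fun r _ => (hder r).continuousAt.continuousWithinAt)
    (fun r _ => (hder r).hasDerivWithinAt) (by simp [hI])
    (fun r hr => by
      rw [norm_norm, add_zero, Real.norm_of_nonneg (hInn r hr.1)]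
      exact hbd r ⟨hr.1, hr.2.le⟩) t ⟨ht, le_rfl⟩
  rw [gronwallBound_ε0_δ0] at this
  have hI0 : I t = 0 := norm_le_zero_iff.1 this
  have := hbd t ⟨ht, le_rfl⟩
  rw [hI0, mul_zero] at this
  exact norm_le_zero_iff.1 this

/-- A family of bounded operators satisfying the Duhamel equation for the perturbation `B` of the
generator `A` is a strongly continuous semigroup with generator `B + A`. -/
theorem IsGenerator.vadd_of_duhamel (hA : IsGenerator A S) (B : X →L[ℝ] X) {W : ℝ → X →L[ℝ] X}
    (hWc : ∀ x, Continuous fun t => W t x)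
    (hW : ∀ t, 0 ≤ t → ∀ x, W t x = S t x + ∫ s in (0 : ℝ)..t, S (t - s) (B (W s x))) :
    IsGenerator ((B : X →ₗ[ℝ] X) +ᵥ A) W := by
  have hS := hA.semigroup
  have hW0 : W 0 = 1 := by ext x; simp [hW 0 le_rfl x, hS.map_zero]
  have hWadd : ∀ s t : ℝ, 0 ≤ s → 0 ≤ t → W (s + t) = W s * W t := by
    intro s t hs ht
    ext x
    -- The defect in the semigroup law solves the homogeneous Volterra equation in `r`, hence
    -- vanishes.
    have key : ∀ r, 0 ≤ r → W (r + t) x - W r (W t x)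
        = ∫ q in (0 : ℝ)..r, S (r - q) (B (W (q + t) x - W q (W t x))) := by
      intro r hr
      have c1 : Continuous fun q => B (W q x) := B.continuous.comp (hWc x)
      have c2 : Continuous fun q => B (W q (W t x)) := B.continuous.comp (hWc _)
      have c3 : Continuous fun q => B (W (q + t) x) :=
        B.continuous.comp ((hWc x).comp (by fun_prop : Continuous fun q : ℝ => q + t))
      simp only [map_sub]
      rw [intervalIntegral.integral_sub (hS.intervalIntegrable_apply c3 hr)
        (hS.intervalIntegrable_apply c2 hr), hW (r + t) (by positivity) x, hW r hr (W t x)]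
      have i0 := hS.intervalIntegrable_apply c1 (by positivity : 0 ≤ r + t)
      have sub1 : uIcc 0 t ⊆ uIcc 0 (r + t) := by
        rw [uIcc_of_le ht, uIcc_of_le (by positivity)]
        exact Icc_subset_Icc le_rfl (by linarith)
      have sub2 : uIcc t (r + t) ⊆ uIcc 0 (r + t) := by
        rw [uIcc_of_le (by linarith), uIcc_of_le (by positivity)]
        exact Icc_subset_Icc ht le_rfl
      rw [← intervalIntegral.integral_add_adjacent_intervals (i0.mono_set sub1)
        (i0.mono_set sub2)]
      have e1 : ∫ q in (0 : ℝ)..t, S (r + t - q) (B (W q x))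
          = S r (∫ q in (0 : ℝ)..t, S (t - q) (B (W q x))) := by
        rw [← (S r).intervalIntegral_comp_comm (hS.intervalIntegrable_apply c1 ht)]
        refine intervalIntegral.integral_congr fun q hq => ?_
        rw [uIcc_of_le ht] at hq
        rw [show r + t - q = r + (t - q) by ring, hS.map_add _ _ hr (by linarith [hq.2])]
        rfl
      have e2 : ∫ q in t..(r + t), S (r + t - q) (B (W q x))
          = ∫ q in (0 : ℝ)..r, S (r - q) (B (W (q + t) x)) := by
        have := intervalIntegral.integral_comp_add_right
          (fun q => S (r + t - q) (B (W q x))) t (a := 0) (b := r)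
        rw [zero_add] at this
        rw [← this]
        refine intervalIntegral.integral_congr fun q _ => ?_
        rw [add_sub_add_right_eq_sub]
      have e3 : S (r + t) x = S r (S t x) := by rw [hS.map_add _ _ hr ht]; rfl
      have e4 : S r (W t x) = S r (S t x)
          + S r (∫ q in (0 : ℝ)..t, S (t - q) (B (W q x))) := by
        rw [← map_add, ← hW t ht x]
      rw [e1, e2, e3, e4]
      abel
    have c : Continuous fun r => W (r + t) x - W r (W t x) :=
      ((hWc x).comp (by fun_prop : Continuous fun q : ℝ => q + t)).sub (hWc _)
    exact sub_eq_zero.1 (volterra_eq_zero hS B c key hs)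
  refine ⟨⟨hW0, hWadd, fun x => (hWc x).continuousOn⟩, fun x y => ?_⟩
  -- After rescaling, the quotient is a mean of the Duhamel integrand over `[0,t]`. The difference
  -- quotients of `W` and `S` therefore differ in the limit by exactly `B x`, whether or not either
  -- one converges.
  have hlim : Tendsto (fun t : ℝ => t⁻¹ • (W t x - S t x)) (𝓝[>] 0) (𝓝 (B x)) := by
    have c : Continuous fun t : ℝ => ∫ θ in (0 : ℝ)..1,
        S (max (t * (1 - θ)) 0) (B (W (t * θ) x)) := by
      refine intervalIntegral.continuous_parametric_intervalIntegral_of_continuous'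
        (f := fun (t : ℝ) θ => S (max (t * (1 - θ)) 0) (B (W (t * θ) x))) ?_ 0 1
      exact hS.continuous_apply (by fun_prop)
        (B.continuous.comp ((hWc x).comp (by fun_prop : Continuous fun p : ℝ × ℝ => p.1 * p.2)))
    have l := c.tendsto 0
    simp only [zero_mul, max_self, hS.map_zero, hW0, intervalIntegral.integral_const, sub_zero,
      one_smul, one_apply_eq_self] at l
    refine (l.mono_left nhdsWithin_le_nhds).congr' ?_
    filter_upwards [self_mem_nhdsWithin] with t ht
    have ht : 0 < t := ht
    rw [hW t ht.le x, add_sub_cancel_left]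
    have := intervalIntegral.smul_integral_comp_mul_left
      (fun s => S (t - s) (B (W s x))) t (a := 0) (b := 1)
    rw [mul_zero, mul_one] at this
    rw [← this, smul_smul, inv_mul_cancel₀ ht.ne', one_smul]
    refine intervalIntegral.integral_congr fun θ hθ => ?_
    rw [uIcc_of_le zero_le_one] at hθ
    rw [max_eq_left (mul_nonneg ht.le (by linarith [hθ.2])), mul_sub, mul_one]
  rw [mem_graph_vadd_iff, hA.mem_graph_iff]
  constructor
  · intro h
    have := h.add hlim
    rw [sub_add_cancel] at this
    refine this.congr fun t => ?_
    rw [← smul_add]; congr 1; abel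
  · intro h
    refine (h.sub hlim).congr fun t => ?_
    rw [← smul_sub]; congr 1; abel

theorem integral_exp_neg_le {c t : ℝ} (hc : 0 < c) :
    ∫ s in (0 : ℝ)..t, Real.exp (-c * (t - s)) ≤ c⁻¹ := by
  have h1 : ∀ s ∈ uIcc 0 t, HasDerivAt (fun s => c⁻¹ * Real.exp (-c * (t - s)))
      (Real.exp (-c * (t - s))) s := by
    intro s _
    have : HasDerivAt (fun s : ℝ => -c * (t - s)) c s := by
      simpa using ((hasDerivAt_id s).const_sub t).const_mul (-c)
    refine (this.exp.const_mul c⁻¹).congr_deriv ?_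
    field_simp
  rw [intervalIntegral.integral_eq_sub_of_hasDerivAt h1 (Continuous.intervalIntegrable
    (by fun_prop) _ _)]
  have : 0 ≤ c⁻¹ * Real.exp (-c * (t - 0)) := by positivity
  simp only [sub_self, mul_zero, Real.exp_zero, mul_one]
  linarith

open BoundedContinuousFunction in
/-- Existence of a solution family of the Duhamel equation, with an exponential bound. -/
theorem exists_duhamel_family (hS : IsC0Semigroup S) {C ω R : ℝ} (hC : 1 ≤ C) (hR : 0 ≤ R)
    (hb : ∀ t, 0 ≤ t → ‖S t‖ ≤ C * Real.exp (ω * t)) (B : X →L[ℝ] X) (hB : ‖B‖ ≤ R) :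
    ∃ W : ℝ → X →L[ℝ] X, (∀ x, Continuous fun t => W t x) ∧
      (∀ t, 0 ≤ t → ∀ x, W t x = S t x + ∫ s in (0 : ℝ)..t, S (t - s) (B (W s x))) ∧
      ∀ t, 0 ≤ t → ‖W t‖ ≤ 2 * C * Real.exp ((ω + 2 * C * (R + 1)) * t) := by
  -- In the weighted variable `e^{-(ω+c)t} W t x` the Duhamel operator has norm at most `CR/c ≤
  -- 1/2`. Using `R + 1` keeps `c` positive when `R = 0`.
  set c : ℝ := 2 * C * (R + 1) with hc
  have hcpos : 0 < c := by positivity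
  set ν : ℝ := ω + c with hν
  have hdecay : ∀ r, 0 ≤ r → ‖Real.exp (-ν * r) • S r‖ ≤ C * Real.exp (-c * r) := by
    intro r hr
    rw [norm_smul, Real.norm_of_nonneg (Real.exp_pos _).le]
    calc Real.exp (-ν * r) * ‖S r‖ ≤ Real.exp (-ν * r) * (C * Real.exp (ω * r)) := by
          gcongr; exact hb r hr
      _ = C * (Real.exp (-ν * r) * Real.exp (ω * r)) := by ring
      _ = C * Real.exp (-c * r) := by rw [← Real.exp_add]; congr 2; rw [hν]; ring
  have obound : ∀ (x : X) (t : ℝ),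
      ‖Real.exp (-ν * max t 0) • S (max t 0) x‖ ≤ C * ‖x‖ := by
    intro x t
    have h1 := hdecay (max t 0) (le_max_right _ _)
    have h2 : C * Real.exp (-c * max t 0) ≤ C * 1 := by
      gcongr
      rw [Real.exp_le_one_iff]
      have := le_max_right t 0
      nlinarith
    calc ‖Real.exp (-ν * max t 0) • S (max t 0) x‖
        ≤ ‖Real.exp (-ν * max t 0) • S (max t 0)‖ * ‖x‖ :=
          (Real.exp (-ν * max t 0) • S (max t 0)).le_opNorm x
      _ ≤ C * ‖x‖ := by gcongr; linarith
  let orbit : X →L[ℝ] (ℝ →ᵇ X) := LinearMap.mkContinuous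
    { toFun := fun x => BoundedContinuousFunction.ofNormedAddCommGroup
        (fun t => Real.exp (-ν * max t 0) • S (max t 0) x)
        (Continuous.smul (by fun_prop) (hS.continuous_apply continuous_id continuous_const))
        (C * ‖x‖) (obound x)
      map_add' := fun x y => by ext t; simp
      map_smul' := fun a x => by ext t; simp [smul_comm a] } C
    (fun x => BoundedContinuousFunction.norm_ofNormedAddCommGroup_le _ (by positivity) (obound x))
  have orbit_apply : ∀ x t, orbit x t = Real.exp (-ν * max t 0) • S (max t 0) x :=
    fun x t => rfl
  have kint : ∀ (v : ℝ →ᵇ X) (t : ℝ), Continuous fun s =>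
      Real.exp (-ν * (max t 0 - s)) • S (max (max t 0 - s) 0) (B (v s)) := fun v t =>
    Continuous.smul (by fun_prop)
      (hS.continuous_apply (by fun_prop) (B.continuous.comp v.continuous))
  have kbound : ∀ (v : ℝ →ᵇ X) (t : ℝ), ‖∫ s in (0 : ℝ)..max t 0,
      Real.exp (-ν * (max t 0 - s)) • S (max (max t 0 - s) 0) (B (v s))‖ ≤ 1 / 2 * ‖v‖ := by
    intro v t
    have h0 : 0 ≤ max t 0 := le_max_right _ _
    calc _ ≤ ∫ s in (0 : ℝ)..max t 0, (C * R * ‖v‖) * Real.exp (-c * (max t 0 - s)) := by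
          refine intervalIntegral.norm_integral_le_of_norm_le h0 ?_
            (Continuous.intervalIntegrable (by fun_prop) _ _)
          refine Eventually.of_forall fun s hs => ?_
          have hs' : 0 ≤ max t 0 - s := by linarith [hs.2]
          rw [max_eq_left hs']
          calc _ ≤ ‖Real.exp (-ν * (max t 0 - s)) • S (max t 0 - s)‖ * (‖B‖ * ‖v s‖) :=
                (Real.exp (-ν * (max t 0 - s)) • S (max t 0 - s)).le_opNorm_of_le
                  (B.le_opNorm _)
            _ ≤ C * Real.exp (-c * (max t 0 - s)) * (R * ‖v‖) := by
                gcongr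
                · exact hdecay _ hs'
                · exact v.norm_coe_le_norm s
            _ = _ := by ring
      _ ≤ (C * R * ‖v‖) * c⁻¹ := by
          rw [intervalIntegral.integral_const_mul]
          gcongr
          exact integral_exp_neg_le hcpos
      _ = (C * R * c⁻¹) * ‖v‖ := by ring
      _ ≤ 1 / 2 * ‖v‖ := by
          gcongr
          rw [← div_eq_mul_inv, div_le_iff₀ hcpos, hc]
          nlinarith
  let K : (ℝ →ᵇ X) →L[ℝ] (ℝ →ᵇ X) := LinearMap.mkContinuous
    { toFun := fun v => BoundedContinuousFunction.ofNormedAddCommGroup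
        (fun t => ∫ s in (0 : ℝ)..max t 0,
          Real.exp (-ν * (max t 0 - s)) • S (max (max t 0 - s) 0) (B (v s)))
        (intervalIntegral.continuous_parametric_intervalIntegral_of_continuous
          (f := fun (t : ℝ) s =>
            Real.exp (-ν * (max t 0 - s)) • S (max (max t 0 - s) 0) (B (v s)))
          (Continuous.smul (by fun_prop) (hS.continuous_apply (by fun_prop)
            (B.continuous.comp (v.continuous.comp continuous_snd)))) (by fun_prop))
        (1 / 2 * ‖v‖) (kbound v)
      map_add' := fun v w => by
        ext t
        simp only [BoundedContinuousFunction.coe_ofNormedAddCommGroup,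
          BoundedContinuousFunction.coe_add, Pi.add_apply, map_add, smul_add]
        exact intervalIntegral.integral_add ((kint v t).intervalIntegrable _ _)
          ((kint w t).intervalIntegrable _ _)
      map_smul' := fun a v => by
        ext t
        simp only [BoundedContinuousFunction.coe_ofNormedAddCommGroup,
          BoundedContinuousFunction.coe_smul, map_smul, RingHom.id_apply, smul_comm _ a]
        exact intervalIntegral.integral_smul _ _ } (1 / 2)
    (fun v => BoundedContinuousFunction.norm_ofNormedAddCommGroup_le _ (by positivity) (kbound v))
  have K_apply : ∀ v t, K v t = ∫ s in (0 : ℝ)..max t 0,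
      Real.exp (-ν * (max t 0 - s)) • S (max (max t 0 - s) 0) (B (v s)) := fun v t => rfl
  have hK : ‖K‖ ≤ 1 / 2 := LinearMap.mkContinuous_norm_le _ (by norm_num) _
  -- The Neumann series inverts `1 - K` on bounded continuous functions; functions are frozen at
  -- their value at `0` for negative times.
  let U := Units.oneSub K (by linarith)
  let Z : X →L[ℝ] (ℝ →ᵇ X) := (↑U⁻¹ : (ℝ →ᵇ X) →L[ℝ] (ℝ →ᵇ X)).comp orbit
  have hZ : ∀ x, Z x = orbit x + K (Z x) := by
    intro x
    have h1 : (U : (ℝ →ᵇ X) →L[ℝ] (ℝ →ᵇ X)) * ↑U⁻¹ = 1 := U.mul_inv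
    have h2 := DFunLike.congr_fun h1 (orbit x)
    have h3 : Z x - K (Z x) = orbit x := h2
    rw [← h3]; abel
  have hZn : ∀ x, ‖Z x‖ ≤ 2 * C * ‖x‖ := by
    intro x
    have h1 : ‖Z x‖ ≤ ‖orbit x‖ + ‖K (Z x)‖ := by
      conv_lhs => rw [hZ x]
      exact norm_add_le _ _
    have h2 : ‖orbit x‖ ≤ C * ‖x‖ :=
      (orbit.le_opNorm x).trans
        (by gcongr; exact LinearMap.mkContinuous_norm_le _ (by positivity) _)
    have h3 : ‖K (Z x)‖ ≤ 1 / 2 * ‖Z x‖ := (K.le_opNorm _).trans (by gcongr)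
    linarith
  refine ⟨fun t => Real.exp (ν * t) • (BoundedContinuousFunction.evalCLM ℝ t).comp Z,
    fun x => ?_, fun t ht x => ?_, fun t ht => ?_⟩
  · exact Continuous.smul (by fun_prop) (Z x).continuous
  · have h1 : Z x t = orbit x t + K (Z x) t := by
      conv_lhs => rw [hZ x]
      rfl
    simp only [FunLike.coe_smul, Pi.smul_apply, ContinuousLinearMap.coe_comp,
      Function.comp_apply, BoundedContinuousFunction.evalCLM_apply]
    rw [h1, orbit_apply, K_apply, max_eq_left ht, smul_add, smul_smul, ← Real.exp_add]
    congr 1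
    · simp
    · rw [← intervalIntegral.integral_smul]
      refine intervalIntegral.integral_congr fun s hs => ?_
      rw [uIcc_of_le ht] at hs
      rw [max_eq_left (by linarith [hs.2] : 0 ≤ t - s), smul_smul, ← Real.exp_add, map_smul,
        map_smul]
      congr 2
      ring
  · refine ContinuousLinearMap.opNorm_le_bound _ (by positivity) fun x => ?_
    simp only [FunLike.coe_smul, Pi.smul_apply, ContinuousLinearMap.coe_comp,
      Function.comp_apply, BoundedContinuousFunction.evalCLM_apply]
    rw [norm_smul, Real.norm_of_nonneg (Real.exp_pos _).le]
    calc Real.exp (ν * t) * ‖Z x t‖ ≤ Real.exp (ν * t) * (2 * C * ‖x‖) := by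
          gcongr
          exact ((Z x).norm_coe_le_norm t).trans (hZn x)
      _ = _ := by ring

/-- A perturbation of a generator by a bounded operator is a generator, and its semigroup has an
exponential bound that depends only on the norm of the perturbation. -/
theorem IsGenerator.exists_vadd (hA : IsGenerator A S) (R : ℝ) :
    ∃ C ω : ℝ, 0 ≤ ω ∧ ∀ B : X →L[ℝ] X, ‖B‖ ≤ R →
      ∃ W, IsGenerator ((B : X →ₗ[ℝ] X) +ᵥ A) W ∧ ∀ t, 0 ≤ t → ‖W t‖ ≤ C * Real.exp (ω * t) := by
  obtain ⟨C, ω, hC, hω, hb⟩ := hA.semigroup.exists_norm_le_exp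
  have hR : 0 ≤ max R 0 := le_max_right _ _
  refine ⟨2 * C, ω + 2 * C * (max R 0 + 1), by positivity, fun B hB => ?_⟩
  obtain ⟨W, h1, h2, h3⟩ := exists_duhamel_family hA.semigroup hC hR hb B
    (hB.trans (le_max_left _ _))
  exact ⟨W, hA.vadd_of_duhamel B h1 h2, h3⟩

end Perturbation

end StiffEPIRK

namespace StiffEPIRK

variable {X : Type*} [NormedAddCommGroup X] [NormedSpace ℝ X]

/-! ### Linear combinations of the functions `z ↦ φ_k(g z)` -/

/-- A formal linear combination of the functions `z ↦ φ_{k+1}(g z)`, with `g ≥ 0`. -/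
abbrev Symbol : Type := (ℕ × NNReal) →₀ ℝ

/-- The operator obtained by evaluating a symbol at `hA`, where `S` is the semigroup generated by
`A`. -/
def symOp (S : ℝ → X →L[ℝ] X) (h : ℝ) : Symbol →ₗ[ℝ] (X → X) :=
  Finsupp.linearCombination ℝ fun q : ℕ × NNReal => phi S (q.1 + 1) (q.2 * h)

theorem symOp_single (S : ℝ → X →L[ℝ] X) (h : ℝ) (q : ℕ × NNReal) (c : ℝ) :
    symOp S h (Finsupp.single q c) = c • phi S (q.1 + 1) (q.2 * h) := by
  simp [symOp]

/-- The symbol of `z ↦ φ_{k+1}(z)`. -/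
def phiSym (k : ℕ) : Symbol := Finsupp.single (k, 1) 1

theorem symOp_phiSym (S : ℝ → X →L[ℝ] X) (h : ℝ) (k : ℕ) (x : X) :
    symOp S h (phiSym k) x = phi S (k + 1) h x := by
  simp [phiSym, symOp_single]

theorem pow_div_factorial_le_one {θ : ℝ} (h0 : 0 ≤ θ) (h1 : θ ≤ 1) (k : ℕ) :
    ‖θ ^ k / (k.factorial : ℝ)‖ ≤ 1 := by
  rw [Real.norm_of_nonneg (by positivity)]
  refine div_le_one_of_le₀ ?_ (by positivity)
  exact (pow_le_one₀ h0 h1).trans (by exact_mod_cast Nat.factorial_pos k)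

theorem norm_phi_le {S : ℝ → X →L[ℝ] X} {τ C : ℝ} (hτ : 0 ≤ τ) (hC : ∀ t ∈ Icc 0 τ, ‖S t‖ ≤ C)
    (k : ℕ) (x : X) : ‖phi S (k + 1) τ x‖ ≤ C * ‖x‖ := by
  have := intervalIntegral.norm_integral_le_of_norm_le_const (a := 0) (b := 1) (C := C * ‖x‖)
    (f := fun θ : ℝ => (θ ^ k / (k.factorial : ℝ)) • S (τ * (1 - θ)) x) ?_
  · simpa [phi] using this
  · intro θ hθ
    rw [uIoc_of_le zero_le_one] at hθ
    have h1 : 0 ≤ 1 - θ := by linarith [hθ.2]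
    rw [norm_smul]
    calc _ ≤ 1 * (C * ‖x‖) := by
          gcongr
          · exact pow_div_factorial_le_one hθ.1.le hθ.2 k
          · refine (S _).le_of_opNorm_le (hC _ ⟨by positivity, ?_⟩) x
            nlinarith [hθ.1]
      _ = _ := one_mul _

/-- Uniform bounds for symbols, over all semigroups with a given exponential bound. -/
theorem exists_norm_symOp_le (σ : Symbol) {C ω : ℝ} (hω : 0 ≤ ω) :
    ∃ D, 0 ≤ D ∧ ∀ S : ℝ → X →L[ℝ] X, (∀ t, 0 ≤ t → ‖S t‖ ≤ C * Real.exp (ω * t)) →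
      ∀ h ∈ Icc (0 : ℝ) 1, ∀ x, ‖symOp S h σ x‖ ≤ D * ‖x‖ := by
  induction σ using Finsupp.induction_linear with
  | zero => exact ⟨0, le_rfl, fun S _ h _ x => by simp⟩
  | add σ τ hσ hτ =>
    obtain ⟨D₁, h₁, H₁⟩ := hσ
    obtain ⟨D₂, h₂, H₂⟩ := hτ
    refine ⟨D₁ + D₂, by positivity, fun S hS h hh x => ?_⟩
    rw [map_add, Pi.add_apply, add_mul]
    exact (norm_add_le _ _).trans (add_le_add (H₁ S hS h hh x) (H₂ S hS h hh x))
  | single q c =>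
    refine ⟨|c| * (|C| * Real.exp (ω * q.2)), by positivity, fun S hS h hh x => ?_⟩
    have hq : 0 ≤ (q.2 : ℝ) := q.2.2
    rw [symOp_single, Pi.smul_apply, norm_smul, Real.norm_eq_abs, mul_assoc]
    gcongr
    refine norm_phi_le (mul_nonneg hq hh.1) (fun t ht => (hS t ht.1).trans ?_) _ _
    gcongr
    · exact le_abs_self C
    · exact ht.2.trans (mul_le_of_le_one_right hq hh.2)

/-- Symbols are evaluated as plain functions defined by integrals. Their linearity rests on
integrability of the orbits, hence on nonnegative time. -/
theorem exists_clm_symOp [CompleteSpace X] {S : ℝ → X →L[ℝ] X} (hS : IsC0Semigroup S) {h : ℝ}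
    (hh : 0 ≤ h) (σ : Symbol) : ∃ G : X →L[ℝ] X, ∀ x, G x = symOp S h σ x := by
  induction σ using Finsupp.induction_linear with
  | zero => exact ⟨0, fun x => by simp⟩
  | add σ τ hσ hτ =>
    obtain ⟨G₁, h₁⟩ := hσ
    obtain ⟨G₂, h₂⟩ := hτ
    exact ⟨G₁ + G₂, fun x => by simp [h₁, h₂]⟩
  | single q c =>
    have hτ : 0 ≤ (q.2 : ℝ) * h := mul_nonneg q.2.2 hh
    obtain ⟨C, hC⟩ := hS.exists_norm_le (q.2 * h)
    refine ⟨c • LinearMap.mkContinuous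
      { toFun := phi S (q.1 + 1) (q.2 * h)
        map_add' := fun x y => ?_
        map_smul' := fun a x => ?_ } C (norm_phi_le hτ hC q.1), fun x => ?_⟩
    · simp only [phi, map_add, smul_add]
      exact intervalIntegral.integral_add (hS.phi_integrable _ _ hτ x)
        (hS.phi_integrable _ _ hτ y)
    · simp only [phi, map_smul, smul_comm _ a, RingHom.id_apply]
      exact intervalIntegral.integral_smul _ _
    · rw [symOp_single]; rfl

section Linearity

variable [CompleteSpace X] {S : ℝ → X →L[ℝ] X} {h : ℝ}

theorem symOp_map_add (hS : IsC0Semigroup S) (hh : 0 ≤ h) (σ : Symbol) (x y : X) :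
    symOp S h σ (x + y) = symOp S h σ x + symOp S h σ y := by
  obtain ⟨G, hG⟩ := exists_clm_symOp hS hh σ
  simp [← hG]

theorem symOp_map_sub (hS : IsC0Semigroup S) (hh : 0 ≤ h) (σ : Symbol) (x y : X) :
    symOp S h σ (x - y) = symOp S h σ x - symOp S h σ y := by
  obtain ⟨G, hG⟩ := exists_clm_symOp hS hh σ
  simp [← hG]

theorem symOp_map_smul (hS : IsC0Semigroup S) (hh : 0 ≤ h) (σ : Symbol) (c : ℝ) (x : X) :
    symOp S h σ (c • x) = c • symOp S h σ x := by
  obtain ⟨G, hG⟩ := exists_clm_symOp hS hh σ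
  simp [← hG]

end Linearity

/-! ### The coefficients of the method as symbols. -/

namespace Method

variable (M : Method)

/-- The symbol of `ψ_{ij}(g_{ij} z)`. -/
def psiSym (i j : ℕ) : Symbol :=
  ∑ k ∈ Finset.Icc 1 M.K, M.p i j k • Finsupp.single (k - 1, ⟨M.g i j, M.g_nonneg i j⟩) 1

/-- The symbol of `a_{ij}(z)`. -/
def aSym (i j : ℕ) : Symbol :=
  ∑ k ∈ Finset.Ico j i,
    ((-1 : ℝ) ^ (k - j) * ((k - 1).choose (j - 1) : ℝ) * M.α i k) • M.psiSym i k

/-- The symbol of `b_j(z)`. -/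
def bSym (j : ℕ) : Symbol :=
  ∑ k ∈ Finset.Icc j M.s,
    ((-1 : ℝ) ^ (k - j) * ((k - 1).choose (j - 1) : ℝ) * M.β k) • M.psiSym (M.s + 1) k

/-- The symbol of `Ψ_i(z)`. -/
def PsiSym (i : ℕ) : Symbol :=
  (1 / 2 : ℝ) • ∑ j ∈ Finset.Ico 2 i, (M.α j 1 ^ 2 * M.P j 1 ^ 2) • M.aSym i j
    - (M.α i 1 * M.g i 1 ^ 2) •
      ∑ k ∈ Finset.Icc 1 M.K,
        M.p i 1 k • Finsupp.single (k + 1, ⟨M.g i 1, M.g_nonneg i 1⟩) 1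

variable (S : ℝ → X →L[ℝ] X) (h : ℝ)

theorem symOp_psiSym (i j : ℕ) (x : X) : symOp S h (M.psiSym i j) x = M.psi S h i j x := by
  simp only [psiSym, psi, map_sum, map_smul, symOp_single, Finset.sum_apply, Pi.smul_apply,
    one_smul]
  refine Finset.sum_congr rfl fun k hk => ?_
  rw [Nat.sub_add_cancel (Finset.mem_Icc.1 hk).1]
  rfl

theorem symOp_aSym (i j : ℕ) (x : X) : symOp S h (M.aSym i j) x = M.a S h i j x := by
  simp only [aSym, a, map_sum, map_smul, Finset.sum_apply, Pi.smul_apply, symOp_psiSym]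

theorem symOp_bSym (j : ℕ) (x : X) : symOp S h (M.bSym j) x = M.b S h j x := by
  simp only [bSym, b, map_sum, map_smul, Finset.sum_apply, Pi.smul_apply, symOp_psiSym]

theorem symOp_PsiSym (i : ℕ) (x : X) : symOp S h (M.PsiSym i) x = M.Psi S h i x := by
  simp only [PsiSym, Psi, map_sub, map_sum, map_smul, Finset.sum_apply, Pi.smul_apply,
    Pi.sub_apply, symOp_aSym, symOp_single, one_smul]
  rfl

end Method

/-! ### Transfer of scalar identities to semigroups -/

section Transfer

variable {E : Type*} [NormedAddCommGroup E] [NormedSpace ℝ E]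

/-- The integral of a function against the compactly supported measure on `[0, ∞)` whose Laplace
transform is the function described by a symbol. -/
def symInt (f : ℝ → E) : Symbol →ₗ[ℝ] E :=
  Finsupp.linearCombination ℝ fun q : ℕ × NNReal =>
    ∫ θ in (0 : ℝ)..1, (θ ^ q.1 / (q.1.factorial : ℝ)) • f (q.2 * (1 - θ))

theorem symInt_single (f : ℝ → E) (q : ℕ × NNReal) (c : ℝ) :
    symInt f (Finsupp.single q c)
      = c • ∫ θ in (0 : ℝ)..1, (θ ^ q.1 / (q.1.factorial : ℝ)) • f (q.2 * (1 - θ)) := by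
  simp [symInt]

/-- The measure of a symbol is carried by the intervals `[0, g]` over its support. -/
theorem symInt_congr {f f' : ℝ → E} {σ : Symbol}
    (h : ∀ q ∈ σ.support, ∀ r ∈ Icc (0 : ℝ) q.2, f r = f' r) : symInt f σ = symInt f' σ := by
  simp only [symInt, Finsupp.linearCombination_apply]
  refine Finsupp.sum_congr fun q hq => ?_
  congr 1
  refine intervalIntegral.integral_congr fun θ hθ => ?_
  rw [uIcc_of_le zero_le_one] at hθ
  have hq2 : 0 ≤ (q.2 : ℝ) := q.2.2
  have h1 : 0 ≤ 1 - θ := by linarith [hθ.2]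
  rw [h q hq _ ⟨by positivity, by nlinarith [hθ.1]⟩]

theorem symInt_sum_smul [CompleteSpace E] {ι : Type*} (s : Finset ι) {c : ι → ℝ → ℝ}
    (hc : ∀ i ∈ s, Continuous (c i))
    (v : ι → E) (σ : Symbol) :
    symInt (fun r => ∑ i ∈ s, c i r • v i) σ = ∑ i ∈ s, symInt (c i) σ • v i := by
  induction σ using Finsupp.induction_linear with
  | zero => simp
  | add σ τ hσ hτ => simp [hσ, hτ, add_smul, Finset.sum_add_distrib]
  | single q a =>
    simp only [symInt_single, Finset.smul_sum]
    rw [intervalIntegral.integral_finsetSum]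
    · rw [Finset.smul_sum]
      refine Finset.sum_congr rfl fun i hi => ?_
      simp only [smul_eq_mul, mul_smul]
      rw [← intervalIntegral.integral_smul_const]
      simp only [mul_smul]
    · intro i hi
      have := hc i hi
      exact Continuous.intervalIntegrable (by fun_prop) _ _

theorem continuous_symInt_comp [CompleteSpace E] {y : ℝ → unitInterval} (hy : Continuous y)
    (σ : Symbol) : Continuous fun F : C(unitInterval, E) => symInt (fun r => F (y r)) σ := by
  induction σ using Finsupp.induction_linear with
  | zero => simpa using continuous_const
  | add σ τ hσ hτ => simp only [map_add]; exact hσ.add hτ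
  | single q a =>
    simp only [symInt_single]
    refine Continuous.const_smul ?_ a
    refine intervalIntegral.continuous_parametric_intervalIntegral_of_continuous'
      (f := fun (F : C(unitInterval, E)) θ =>
        (θ ^ q.1 / (q.1.factorial : ℝ)) • F (y (q.2 * (1 - θ)))) ?_ 0 1
    simp only [Function.uncurry_def]
    fun_prop

/-- The hypothesis says that the vector measure `∑ μ_i x_i` has zero transform. At `z = -m` it
annihilates `e^{-mr}`, so it annihilates polynomials in `y = e^{-r}`, and these are dense by
Bernstein approximation. -/
theorem sum_symInt_eq_zero [CompleteSpace X] {ι : Type*} (s : Finset ι) (σ : ι → Symbol)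
    (x : ι → X)
    (h : ∀ z : ℝ, ∑ i ∈ s, symInt (fun r => Real.exp (r * z)) (σ i) • x i = 0)
    (W : ℝ → X →L[ℝ] X) (hW : ∀ x, Continuous fun r => W r x) :
    ∑ i ∈ s, symInt (fun r => W r (x i)) (σ i) = 0 := by
  classical
  have hpoly : ∀ p : Polynomial ℝ,
      ∑ i ∈ s, symInt (fun r => p.eval (Real.exp (-r))) (σ i) • x i = 0 := by
    intro p
    have e : ∀ i ∈ s, symInt (fun r => p.eval (Real.exp (-r))) (σ i) • x i
        = ∑ m ∈ Finset.range (p.natDegree + 1),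
          p.coeff m • symInt (fun r => Real.exp (r * (-m : ℝ))) (σ i) • x i := by
      intro i _
      have := symInt_sum_smul (Finset.range (p.natDegree + 1))
        (c := fun (m : ℕ) r => Real.exp (r * (-m : ℝ))) (fun m _ => by fun_prop)
        (fun m => p.coeff m) (σ i)
      rw [show (fun r => p.eval (Real.exp (-r))) = fun r => ∑ m ∈ Finset.range (p.natDegree + 1),
          Real.exp (r * (-m : ℝ)) • p.coeff m from ?_, this, Finset.sum_smul]
      · refine Finset.sum_congr rfl fun m _ => ?_
        rw [smul_eq_mul, mul_comm, mul_smul]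
      · funext r
        rw [Polynomial.eval_eq_sum_range]
        refine Finset.sum_congr rfl fun m _ => ?_
        rw [← Real.exp_nat_mul, smul_eq_mul, mul_comm]
        congr 2
        ring
    rw [Finset.sum_congr rfl e, Finset.sum_comm]
    refine Finset.sum_eq_zero fun m _ => ?_
    rw [← Finset.smul_sum, h, smul_zero]
  -- All the measures live on `[0, G]`.
  obtain ⟨G, hG⟩ := (s.biUnion fun i => (σ i).support.image Prod.snd).exists_le
  have hG' : ∀ i ∈ s, ∀ q ∈ (σ i).support, q.2 ≤ G := fun i hi q hq =>
    hG _ (Finset.mem_biUnion.2 ⟨i, hi, Finset.mem_image_of_mem _ hq⟩)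
  let y : ℝ → unitInterval := fun r => projIcc 0 1 zero_le_one (Real.exp (-r))
  have hyc : Continuous y := continuous_projIcc.comp (by fun_prop)
  have hy : ∀ r, 0 ≤ r → ((y r : unitInterval) : ℝ) = Real.exp (-r) := by
    intro r hr
    have : Real.exp (-r) ∈ Icc (0 : ℝ) 1 :=
      ⟨(Real.exp_pos _).le, Real.exp_le_one_iff.2 (by linarith)⟩
    simp only [y]
    rw [projIcc_of_mem _ this]
  -- The inverse of `r ↦ e^{-r}` on `[0, G]`; the cutoff at `e^{-G}` keeps the logarithm continuous
  -- down to `0`.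
  let ρ : unitInterval → ℝ := fun w => -Real.log (max (w : ℝ) (Real.exp (-G)))
  have hρc : Continuous ρ := by
    refine Continuous.neg (Continuous.log (by fun_prop) fun w => ?_)
    exact (lt_max_of_lt_right (Real.exp_pos _)).ne'
  have hρ : ∀ r : ℝ, 0 ≤ r → r ≤ G → ρ (y r) = r := by
    intro r h0 h1
    simp only [ρ]
    rw [hy r h0, max_eq_left (Real.exp_le_exp.2 (by linarith)), Real.log_exp, neg_neg]
  let F : ι → C(unitInterval, X) := fun i => ⟨fun w => W (ρ w) (x i), (hW _).comp hρc⟩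
  have lim : Tendsto (fun n => ∑ i ∈ s,
      symInt (fun r => bernsteinApproximation n (F i) (y r)) (σ i)) atTop
      (𝓝 (∑ i ∈ s, symInt (fun r => F i (y r)) (σ i))) := by
    refine tendsto_finsetSum _ fun i _ => ?_
    exact ((continuous_symInt_comp hyc (σ i)).tendsto _).comp
      (bernsteinApproximation_uniform (F i))
  have e1 : ∑ i ∈ s, symInt (fun r => F i (y r)) (σ i)
      = ∑ i ∈ s, symInt (fun r => W r (x i)) (σ i) := by
    refine Finset.sum_congr rfl fun i hi => symInt_congr fun q hq r hr => ?_
    simp only [F, ContinuousMap.coe_mk]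
    rw [hρ r hr.1 (hr.2.trans (NNReal.coe_le_coe.2 (hG' i hi q hq)))]
  have e2 : ∀ n, ∑ i ∈ s,
      symInt (fun r => bernsteinApproximation n (F i) (y r)) (σ i) = 0 := by
    intro n
    have e3 : ∀ i ∈ s, symInt (fun r => bernsteinApproximation n (F i) (y r)) (σ i)
        = ∑ k : Fin (n + 1), W (ρ (bernstein.z k))
          (symInt (fun r => (bernsteinPolynomial ℝ n k).eval (Real.exp (-r))) (σ i) • x i) := by
      intro i _
      simp only [bernsteinApproximation.apply]
      rw [symInt_sum_smul Finset.univ (c := fun (k : Fin (n + 1)) r => bernstein n k (y r))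
        (fun k _ => by fun_prop)]
      refine Finset.sum_congr rfl fun k _ => ?_
      rw [map_smul]
      congr 1
      refine symInt_congr fun q _ r hr => ?_
      rw [← hy r hr.1]
      rfl
    rw [Finset.sum_congr rfl e3, Finset.sum_comm]
    refine Finset.sum_eq_zero fun k _ => ?_
    -- At a fixed Bernstein node the same operator `W (ρ z_k)` acts on every summand, so it can be
    -- pulled out of the sum over `i`.
    rw [← map_sum, hpoly, map_zero]
  simp only [e2] at lim
  rw [← e1]
  exact tendsto_nhds_unique lim tendsto_const_nhds |>.symm ▸ rfl

/-- The scalar semigroup `t ↦ e^{tz}`. -/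
def scalarExp (z t : ℝ) : ℝ →L[ℝ] ℝ := Real.exp (t * z) • 1

theorem symOp_scalarExp (z : ℝ) (σ : Symbol) :
    symOp (scalarExp z) 1 σ 1 = symInt (fun r => Real.exp (r * z)) σ := by
  induction σ using Finsupp.induction_linear with
  | zero => simp
  | add σ τ hσ hτ => simp [hσ, hτ]
  | single q a =>
    simp [symInt_single, symOp_single, phi, scalarExp]

theorem symOp_eq_symInt {S : ℝ → X →L[ℝ] X} {h : ℝ} (hh : 0 ≤ h) (σ : Symbol) (x : X) :
    symOp S h σ x = symInt (fun r => S (max (r * h) 0) x) σ := by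
  induction σ using Finsupp.induction_linear with
  | zero => simp
  | add σ τ hσ hτ => simp [hσ, hτ]
  | single q a =>
    have hq : 0 ≤ (q.2 : ℝ) * h := mul_nonneg q.2.2 hh
    rw [symInt_single, symOp_single, Pi.smul_apply, phi_eq_integral_max _ hq]
    congr 1
    refine intervalIntegral.integral_congr fun θ _ => ?_
    simp only [mul_right_comm]

/-- An identity between scalar combinations of the functions `z ↦ φ_k(g z)` persists when `z` is
replaced by the generator of a strongly continuous semigroup. -/
theorem sum_symOp_eq_zero [CompleteSpace X] {S : ℝ → X →L[ℝ] X} (hS : IsC0Semigroup S) {h : ℝ}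
    (hh : 0 ≤ h) {ι : Type*} (s : Finset ι) (σ : ι → Symbol) (x : ι → X)
    (hz : ∀ z : ℝ, ∑ i ∈ s, symOp (scalarExp z) 1 (σ i) 1 • x i = 0) :
    ∑ i ∈ s, symOp S h (σ i) (x i) = 0 := by
  simp only [symOp_scalarExp] at hz
  simp only [symOp_eq_symInt hh]
  exact sum_symInt_eq_zero s σ x hz (fun r => S (max (r * h) 0))
    (fun x => hS.continuous_apply (by fun_prop) (by fun_prop))

end Transfer

/-! ### Diagonal matrices as test cases. -/

theorem matExp_diagonal_apply {m : ℕ} (d : Fin m → ℝ) (t : ℝ) (x : Fin m → ℝ) (i : Fin m) :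
    Method.matExp (Matrix.diagonal d) t x i = Real.exp (t * d i) * x i := by
  simp only [Method.matExp, LinearMap.coe_toContinuousLinearMap', Matrix.toLin'_apply]
  rw [← Matrix.diagonal_smul, Matrix.exp_diagonal, Matrix.mulVec_diagonal, Pi.coe_exp,
    Real.exp_eq_exp_ℝ]
  simp

/-- Evaluated at a diagonal matrix, a symbol acts entrywise by its scalar values. This extracts
scalar identities from the matrix order conditions. -/
theorem symOp_matExp_diagonal {m : ℕ} (d : Fin m → ℝ) (h : ℝ) (σ : Symbol) (x : Fin m → ℝ)
    (i : Fin m) :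
    symOp (Method.matExp (Matrix.diagonal d)) h σ x i
      = symOp (scalarExp (d i)) h σ 1 * x i := by
  induction σ using Finsupp.induction_linear with
  | zero => simp
  | add σ τ hσ hτ => simp [hσ, hτ, add_mul]
  | single q a =>
    simp only [symOp_single, Pi.smul_apply, smul_eq_mul, mul_assoc]
    congr 1
    have hc : Continuous fun θ : ℝ => (θ ^ q.1 / (q.1.factorial : ℝ)) •
        Method.matExp (Matrix.diagonal d) (q.2 * h * (1 - θ)) x := by
      refine continuous_pi fun j => ?_
      simp only [Pi.smul_apply, matExp_diagonal_apply]
      fun_prop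
    have := (ContinuousLinearMap.proj (R := ℝ) (φ := fun _ : Fin m => ℝ)
      i).intervalIntegral_comp_comm
      (hc.intervalIntegrable (μ := MeasureTheory.volume) 0 1)
    simp only [ContinuousLinearMap.proj_apply, Pi.smul_apply, matExp_diagonal_apply] at this
    simp only [phi]
    rw [← this, ← intervalIntegral.integral_mul_const]
    refine intervalIntegral.integral_congr fun θ _ => ?_
    simp [scalarExp, mul_assoc]

end StiffEPIRK

namespace StiffEPIRK

variable {X : Type*} [NormedAddCommGroup X] [NormedSpace ℝ X]

/-! ### The order conditions for semigroups -/

namespace Method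

variable [CompleteSpace X] {M : Method} {S : ℝ → X →L[ℝ] X} {h : ℝ}

/-- The 1×1 matrices already give the scalar identity, and that is all the transfer needs; the
singleton index expresses that one combined symbol vanishes. -/
theorem QuadratureCondition.apply {c : ℕ → ℝ} {d : ℝ} {k : ℕ}
    (H : M.QuadratureCondition c d (k + 1)) (hS : IsC0Semigroup S) (hh : 0 ≤ h) (x : X) :
    ∑ i ∈ Finset.Icc 2 M.s, c i • M.b S h i x = d • phi S (k + 1) h x := by
  have key := sum_symOp_eq_zero hS hh {()}
    (fun _ => ∑ i ∈ Finset.Icc 2 M.s, c i • M.bSym i - d • phiSym k) (fun _ => x) (fun z => by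
      have := congrFun (H 1 (Matrix.diagonal fun _ => z) (fun _ => 1)) 0
      simp only [← symOp_bSym, ← symOp_phiSym, Finset.sum_apply, Pi.smul_apply,
        symOp_matExp_diagonal, mul_one] at this
      simp only [Finset.sum_singleton, map_sub, map_sum, map_smul, Pi.sub_apply, Finset.sum_apply,
        Pi.smul_apply, this, sub_self, zero_smul])
  simp only [Finset.sum_singleton, map_sub, map_sum, map_smul, Pi.sub_apply, Finset.sum_apply,
    Pi.smul_apply, symOp_bSym, symOp_phiSym] at key
  exact sub_eq_zero.1 key

theorem C0.apply (H : M.C0) (hS : IsC0Semigroup S) (hh : 0 ≤ h) (x : X) :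
    M.β 1 • M.psi S h (M.s + 1) 1 x = phi S 1 h x := by
  have key := sum_symOp_eq_zero hS hh {()}
    (fun _ => M.β 1 • M.psiSym (M.s + 1) 1 - phiSym 0) (fun _ => x) (fun z => by
      have := congrFun (H 1 (Matrix.diagonal fun _ => z) (fun _ => 1)) 0
      simp only [← symOp_psiSym] at this
      rw [← symOp_phiSym _ 1 0] at this
      simp only [Pi.smul_apply, symOp_matExp_diagonal, mul_one] at this
      simp only [Finset.sum_singleton, map_sub, map_smul, Pi.sub_apply,
        Pi.smul_apply, this, sub_self, zero_smul])
  simp only [Finset.sum_singleton, map_sub, map_smul, Pi.sub_apply,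
    Pi.smul_apply, symOp_psiSym, symOp_phiSym] at key
  exact sub_eq_zero.1 key

/-- Take `Z = diag(z, w)` and `Q = E₁₂`. In the first component `Ψ_i` is evaluated at `w` and `b_i`
at `z`, so the two arguments become independent. -/
theorem C8.scalar (H : M.C8) (z w : ℝ) :
    ∑ i ∈ Finset.Icc 2 M.s, (M.α i 1 * M.P i 1) *
      (symOp (scalarExp z) 1 (M.bSym i) 1 * symOp (scalarExp w) 1 (M.PsiSym i) 1) = 0 := by
  have := congrFun (H 2 (Matrix.diagonal ![z, w]) !![0, 1; 0, 0] (fun _ => 1)) 0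
  simp only [← symOp_bSym, ← symOp_PsiSym, Finset.sum_apply, Pi.smul_apply,
    symOp_matExp_diagonal] at this
  simpa [Matrix.mulVec, dotProduct, Fin.sum_univ_two, symOp_matExp_diagonal] using this

theorem C8.apply (H : M.C8) (hS : IsC0Semigroup S) (hh : 0 ≤ h) (Q : X →L[ℝ] X) (x : X) :
    ∑ i ∈ Finset.Icc 2 M.s, (M.α i 1 * M.P i 1) • M.b S h i (Q (M.Psi S h i x)) = 0 := by
  have h1 : ∀ z : ℝ, ∑ i ∈ Finset.Icc 2 M.s,
      symOp (scalarExp z) 1 (M.bSym i) 1 • ((M.α i 1 * M.P i 1) • Q (M.Psi S h i x)) = 0 := by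
    intro z
    -- First transfer: with `z` fixed, the numbers `b_i(z)` are constants and `w` is replaced by
    -- `hA`.
    have h2 := sum_symOp_eq_zero hS hh (Finset.Icc 2 M.s) M.PsiSym
      (fun i => ((M.α i 1 * M.P i 1) * symOp (scalarExp z) 1 (M.bSym i) 1) • x) (fun w => by
        have := H.scalar z w
        rw [← zero_smul ℝ x, ← this, Finset.sum_smul]
        refine Finset.sum_congr rfl fun i _ => ?_
        rw [smul_smul]
        congr 1
        ring)
    have h3 := congrArg Q h2
    rw [map_sum, map_zero] at h3
    rw [← h3]
    refine Finset.sum_congr rfl fun i _ => ?_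
    rw [symOp_map_smul hS hh, symOp_PsiSym, map_smul, smul_smul, mul_comm]
  -- Second transfer, now in `z`, after `Q` has been applied.
  have h4 := sum_symOp_eq_zero hS hh (Finset.Icc 2 M.s) M.bSym _ h1
  simpa only [symOp_map_smul hS hh, symOp_bSym] using h4

end Method

end StiffEPIRK

namespace StiffEPIRK

variable {X : Type*} [NormedAddCommGroup X] [NormedSpace ℝ X]

/-! ### Taylor expansion of the nonlinearity, uniformly along a compact set -/

/-- Closed neighbourhoods of `K` need not be compact. The bound comes instead from the open set
where `‖f‖ < C + 1`: it contains `K`, hence a closed thickening of `K`. -/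
theorem exists_bound_near_compact {Y : Type*} [NormedAddCommGroup Y] {K U : Set X}
    (hK : IsCompact K) (hU : IsOpen U) (hKU : K ⊆ U) {f : X → Y} (hf : ContinuousOn f U) :
    ∃ ε > 0, ∃ C, ∀ v ∈ K, ∀ w, ‖w‖ ≤ ε → v + w ∈ U ∧ ‖f (v + w)‖ ≤ C := by
  obtain ⟨C, hC⟩ := hK.exists_bound_of_continuousOn (hf.mono hKU)
  have hopen : IsOpen (U ∩ (fun x => ‖f x‖) ⁻¹' Iio (C + 1)) :=
    hf.norm.isOpen_inter_preimage hU isOpen_Iio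
  obtain ⟨ε, hε, hsub⟩ := hK.exists_cthickening_subset_open hopen
    (fun x hx => ⟨hKU hx, lt_of_le_of_lt (hC x hx) (lt_add_one C)⟩)
  refine ⟨ε, hε, C + 1, fun v hv w hw => ?_⟩
  have : v + w ∈ Metric.cthickening ε K :=
    Metric.mem_cthickening_of_dist_le _ v _ _ hv (by simpa using hw)
  exact ⟨(hsub this).1, le_of_lt (hsub this).2⟩

/-- Integral form of the remainder: increments of norm at most `ε` keep the whole segment where the
top derivative is bounded. -/
theorem exists_taylor_bound [CompleteSpace X] {K U : Set X} (hK : IsCompact K) (hU : IsOpen U)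
    (hKU : K ⊆ U) {N : X → X} {n : ℕ} (hN : ContDiffOn ℝ (n + 1) N U) :
    ∃ ε > 0, ∃ C, ∀ v ∈ K, ∀ w, ‖w‖ ≤ ε →
      ‖N (v + w) - ∑ k ∈ Finset.range (n + 1),
        (k.factorial : ℝ)⁻¹ • iteratedFDeriv ℝ k N v (fun _ => w)‖ ≤ C * ‖w‖ ^ (n + 1) := by
  have hat : ∀ x ∈ U, ContDiffAt ℝ (n + 1) N x := fun x hx => hN.contDiffAt (hU.mem_nhds hx)
  have hcont : ContinuousOn (iteratedFDeriv ℝ (n + 1) N) U := fun x hx =>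
    (((hat x hx).iteratedFDeriv_right (i := n + 1) (m := 0)
      (by simp)).continuousAt).continuousWithinAt
  obtain ⟨ε, hε, C, hC⟩ := exists_bound_near_compact hK hU hKU hcont
  refine ⟨ε, hε, C, fun v hv w hw => ?_⟩
  have hseg : ∀ t ∈ Icc (0 : ℝ) 1, ‖t • w‖ ≤ ε := fun t ht => by
    rw [norm_smul, Real.norm_of_nonneg ht.1]
    exact (mul_le_of_le_one_left (norm_nonneg _) ht.2).trans hw
  rw [map_add_eq_sum_add_integral_iteratedFDeriv (n := n) (f := N) (x := v) (y := w)
    (fun t ht => hat _ (hC v hv _ (hseg t ht)).1), add_sub_cancel_left, norm_smul]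
  have hC0 : 0 ≤ C := (norm_nonneg _).trans (hC v hv 0 (by simpa using hε.le)).2
  have hI : ‖∫ t in (0 : ℝ)..1, (1 - t) ^ n • iteratedFDeriv ℝ (n + 1) N (v + t • w) fun _ => w‖
      ≤ C * ‖w‖ ^ (n + 1) * |1 - 0| := by
    refine intervalIntegral.norm_integral_le_of_norm_le_const fun t ht => ?_
    rw [uIoc_of_le zero_le_one] at ht
    have h1 : 0 ≤ 1 - t := by linarith [ht.2]
    rw [norm_smul, Real.norm_of_nonneg (by positivity)]
    calc (1 - t) ^ n * ‖iteratedFDeriv ℝ (n + 1) N (v + t • w) fun _ => w‖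
        ≤ 1 * (C * ‖w‖ ^ (n + 1)) := by
          gcongr
          · exact pow_le_one₀ h1 (by linarith [ht.1])
          · refine (ContinuousMultilinearMap.le_of_opNorm_le
              (hC v hv _ (hseg t ⟨ht.1.le, ht.2⟩)).2 _).trans ?_
            simp
      _ = _ := one_mul _
  have hf1 : ‖((n.factorial : ℝ))⁻¹‖ ≤ 1 := by
    rw [Real.norm_of_nonneg (by positivity)]
    exact inv_le_one_of_one_le₀ (by exact_mod_cast Nat.factorial_pos n)
  calc _ ≤ 1 * (C * ‖w‖ ^ (n + 1) * |1 - 0|) := by gcongr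
    _ = _ := by simp

theorem Ntilde_sub_eq (N : X → X) (v w : X) :
    Ntilde N v (v + w) - Ntilde N v v = N (v + w) - N v - fderiv ℝ N v w := by
  simp only [Ntilde, map_add]
  abel

theorem iteratedFDeriv_clm_eq_zero {Y : Type*} [NormedAddCommGroup Y] [NormedSpace ℝ Y]
    (G : X →L[ℝ] Y) (k : ℕ) (x : X) : iteratedFDeriv ℝ (k + 2) G x = 0 := by
  ext m
  rw [iteratedFDeriv_succ_apply_right]
  have : fderiv ℝ (⇑G) = fun _ => G := by ext y; simp
  rw [this, iteratedFDeriv_const_of_ne (by simp)]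
  simp

/-- The two maps differ by a continuous linear map, whose derivatives of order at least two vanish.
-/
theorem iteratedFDeriv_Ntilde {N : X → X} {v : X} {k : ℕ} (hN : ContDiffAt ℝ (k + 2 : ℕ) N v) :
    iteratedFDeriv ℝ (k + 2) (Ntilde N v) v = iteratedFDeriv ℝ (k + 2) N v := by
  have := iteratedFDeriv_sub_apply (i := k + 2) (g := ⇑(fderiv ℝ N v)) hN
    (fderiv ℝ N v).contDiff.contDiffAt
  rw [iteratedFDeriv_clm_eq_zero, sub_zero] at this
  exact this

theorem iteratedFDeriv_two_swap {Y : Type*} [NormedAddCommGroup Y] [NormedSpace ℝ Y] {f : X → Y}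
    {v : X} (hf : ContDiffAt ℝ 2 f v) (a b : X) :
    iteratedFDeriv ℝ 2 f v ![a, b] = iteratedFDeriv ℝ 2 f v ![b, a] :=
  IsSymmSndFDerivAt.iteratedFDeriv_cons (hf := hf.isSymmSndFDerivAt (by simp))

/-- The third derivative is the second derivative of `fderiv ℝ f`, which is symmetric. -/
theorem iteratedFDeriv_three_swap_left {f : X → X} {v : X} (hf : ContDiffAt ℝ 3 f v)
    (a b c : X) :
    iteratedFDeriv ℝ 3 f v ![a, b, c] = iteratedFDeriv ℝ 3 f v ![b, a, c] := by
  have e : ∀ a b : X, iteratedFDeriv ℝ 3 f v ![a, b, c]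
      = iteratedFDeriv ℝ 2 (fderiv ℝ f) v ![a, b] c := by
    intro a b
    rw [iteratedFDeriv_succ_apply_right]
    congr 2
    ext i
    fin_cases i <;> rfl
  have h2 : ContDiffAt ℝ 2 (fderiv ℝ f) v := hf.fderiv_right (by norm_num)
  rw [e, e, iteratedFDeriv_two_swap h2]

/-- Differentiate the symmetry of the second derivative, which holds on a neighbourhood of `v`, in
the direction `a`. -/
theorem iteratedFDeriv_three_swap_right {f : X → X} {v : X} (hf : ContDiffAt ℝ 3 f v)
    (a b c : X) :
    iteratedFDeriv ℝ 3 f v ![a, b, c] = iteratedFDeriv ℝ 3 f v ![a, c, b] := by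
  have hd : DifferentiableAt ℝ (iteratedFDeriv ℝ 2 f) v :=
    hf.differentiableAt_iteratedFDeriv (by norm_cast)
  have e : ∀ b c : X, iteratedFDeriv ℝ 3 f v ![a, b, c]
      = fderiv ℝ (fun y => iteratedFDeriv ℝ 2 f y ![b, c]) v a := by
    intro b c
    rw [hd.iteratedFDeriv_succ_apply_left']
    rfl
  rw [e, e]
  have hev : (fun y => iteratedFDeriv ℝ 2 f y ![b, c])
      =ᶠ[𝓝 v] fun y => iteratedFDeriv ℝ 2 f y ![c, b] := by
    filter_upwards [(hf.of_le (by norm_num : (2 : WithTop ℕ∞) ≤ 3)).eventually (by simp)]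
      with y hy
    exact iteratedFDeriv_two_swap hy b c
  rw [hev.fderiv_eq]

end StiffEPIRK

namespace StiffEPIRK

variable {X : Type*} [NormedAddCommGroup X] [NormedSpace ℝ X]

/-! ### Derivatives of the solution -/

theorem hasDerivWithinAt_iteratedDerivWithin {s : Set ℝ} (hs : UniqueDiffOn ℝ s) {f : ℝ → X}
    {n : WithTop ℕ∞} {k : ℕ} (hf : ContDiffOn ℝ n f s) (hk : (k : WithTop ℕ∞) < n) {t : ℝ}
    (ht : t ∈ s) :
    HasDerivWithinAt (iteratedDerivWithin k f s) (iteratedDerivWithin (k + 1) f s t) s t := by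
  rw [iteratedDerivWithin_succ]
  exact (hf.differentiableOn_iteratedDerivWithin hk hs t ht).hasDerivWithinAt

/-- Differentiating `A w = v` for a closed operator `A`. -/
theorem IsGenerator.deriv_mem_graph [CompleteSpace X] {A : X →ₗ.[ℝ] X} {S : ℝ → X →L[ℝ] X}
    (hA : IsGenerator A S) {s : Set ℝ} (hs : UniqueDiffOn ℝ s) {w v : ℝ → X}
    (hwv : ∀ t ∈ s, (w t, v t) ∈ A.graph) {t : ℝ} (ht : t ∈ s) {w' v' : X}
    (hw : HasDerivWithinAt w w' s t) (hv : HasDerivWithinAt v v' s t) : (w', v') ∈ A.graph := by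
  rw [hasDerivWithinAt_iff_tendsto_slope] at hw hv
  have : (𝓝[s \ {t}] t).NeBot :=
    accPt_principal_iff_nhdsWithin.1 (uniqueDiffWithinAt_iff_accPt.1 (hs t ht))
  refine hA.mem_graph_of_tendsto ?_ hw hv
  filter_upwards [self_mem_nhdsWithin] with r hr
  have := A.graph.smul_mem (r - t)⁻¹ (A.graph.sub_mem (hwv r hr.1) (hwv t ht))
  simpa [slope] using this

theorem IsGenerator.iteratedDerivWithin_mem_graph [CompleteSpace X] {A : X →ₗ.[ℝ] X}
    {S : ℝ → X →L[ℝ] X} (hA : IsGenerator A S) {s : Set ℝ} (hs : UniqueDiffOn ℝ s) {w v : ℝ → X}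
    (hwv : ∀ t ∈ s, (w t, v t) ∈ A.graph) {n : ℕ} (hw : ContDiffOn ℝ n w s)
    (hv : ContDiffOn ℝ n v s) {k : ℕ} (hk : k ≤ n) :
    ∀ t ∈ s, (iteratedDerivWithin k w s t, iteratedDerivWithin k v s t) ∈ A.graph := by
  induction k with
  | zero => simpa using hwv
  | succ k ih =>
    intro t ht
    have hk' : (k : WithTop ℕ∞) < n := by exact_mod_cast hk
    exact hA.deriv_mem_graph hs (ih (by omega)) ht
      (hasDerivWithinAt_iteratedDerivWithin hs hw hk' ht)
      (hasDerivWithinAt_iteratedDerivWithin hs hv hk' ht)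

theorem subset_strip {t₀ T δ : ℝ} (hδ : 0 < δ) (u : ℝ → X) : u '' Icc t₀ T ⊆ strip t₀ T u δ :=
  Metric.self_subset_thickening hδ _

theorem isOpen_strip (t₀ T δ : ℝ) (u : ℝ → X) : IsOpen (strip t₀ T u δ) :=
  Metric.isOpen_thickening

section Solution

variable {L : X →ₗ.[ℝ] X} {N : X → X} {t₀ T : ℝ} {u₀ : X} {u : ℝ → X} {δ : ℝ}

theorem IsSolution.rhs_eq (hu : IsSolution L N t₀ T u₀ u) (hT : t₀ < T) {t : ℝ}
    (ht : t ∈ Icc t₀ T) : rhs L N (u t) = iteratedDerivWithin 1 u (Icc t₀ T) t := by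
  rw [iteratedDerivWithin_one]
  exact ((hu.hasDeriv t ht).derivWithin (uniqueDiffOn_Icc hT t ht)).symm

theorem IsSolution.mem_graph (hu : IsSolution L N t₀ T u₀ u) {t : ℝ} (ht : t ∈ Icc t₀ T) :
    (u t, rhs L N (u t) - N (u t)) ∈ L.graph := by
  rw [LinearPMap.mem_graph_iff]
  refine ⟨⟨u t, hu.mem_domain t ht⟩, rfl, ?_⟩
  simp [rhs, hu.mem_domain t ht]

theorem contDiffAt_of_strip {n : WithTop ℕ∞} (hδ : 0 < δ)
    (hN : ContDiffOn ℝ n N (strip t₀ T u δ)) {t : ℝ} (ht : t ∈ Icc t₀ T) :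
    ContDiffAt ℝ n N (u t) :=
  hN.contDiffAt ((isOpen_strip t₀ T δ u).mem_nhds (subset_strip hδ u (mem_image_of_mem u ht)))

/-- The action of the Jacobian on the derivatives of the solution. -/
theorem IsSolution.jacobian_graph [CompleteSpace X] {S : ℝ → X →L[ℝ] X} (hL : IsGenerator L S)
    (hu : IsSolution L N t₀ T u₀ u) (hT : t₀ < T) (hus : ContDiffOn ℝ 4 u (Icc t₀ T))
    (hδ : 0 < δ) (hN : ContDiffOn ℝ 3 N (strip t₀ T u δ)) :
    ∃ u₄ : ℝ → X, (∃ C, ∀ t ∈ Icc t₀ T, ‖u₄ t‖ ≤ C) ∧ ∀ t ∈ Icc t₀ T,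
      (iteratedDerivWithin 1 u (Icc t₀ T) t, iteratedDerivWithin 2 u (Icc t₀ T) t)
        ∈ (jacobian L N (u t)).graph ∧
      (iteratedDerivWithin 2 u (Icc t₀ T) t, iteratedDerivWithin 3 u (Icc t₀ T) t
        - iteratedFDeriv ℝ 2 N (u t) ![iteratedDerivWithin 1 u (Icc t₀ T) t,
            iteratedDerivWithin 1 u (Icc t₀ T) t]) ∈ (jacobian L N (u t)).graph ∧
      (iteratedDerivWithin 3 u (Icc t₀ T) t, u₄ t) ∈ (jacobian L N (u t)).graph := by
  set I := Icc t₀ T with hI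
  have hs : UniqueDiffOn ℝ I := uniqueDiffOn_Icc hT
  -- By the equation `v = Lu`, and `v` is three times continuously differentiable. Closedness of `L`
  -- gives `L u^{(k)} = v^{(k)}` for `k ≤ 3`.
  set v : ℝ → X := fun t => derivWithin u I t - N (u t) with hv
  have hmaps : MapsTo u I (strip t₀ T u δ) := fun t ht =>
    subset_strip hδ u (mem_image_of_mem u ht)
  have hu3 : ContDiffOn ℝ 3 u I := hus.of_le (by norm_num)
  have hvs : ContDiffOn ℝ 3 v I :=
    (hus.derivWithin hs (by norm_num)).sub (hN.comp hu3 hmaps)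
  have hgr : ∀ t ∈ I, (u t, v t) ∈ L.graph := by
    intro t ht
    have := hu.mem_graph ht
    rwa [hu.rhs_eq hT ht, iteratedDerivWithin_one] at this
  have hgk : ∀ k ≤ 3, ∀ t ∈ I,
      (iteratedDerivWithin k u I t, iteratedDerivWithin k v I t) ∈ L.graph := fun k hk =>
    hL.iteratedDerivWithin_mem_graph (n := 3) hs hgr hu3 hvs hk
  have hd : ∀ k < 4, ∀ t ∈ I,
      HasDerivWithinAt (iteratedDerivWithin k u I) (iteratedDerivWithin (k + 1) u I t) I t :=
    fun k hk t ht => hasDerivWithinAt_iteratedDerivWithin hs hus (by exact_mod_cast hk) ht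
  have hNat : ∀ t ∈ I, ContDiffAt ℝ 3 N (u t) := fun t ht => contDiffAt_of_strip hδ hN ht
  have hd0 : ∀ t ∈ I, HasDerivWithinAt u (iteratedDerivWithin 1 u I t) I t := by
    intro t ht
    simpa using hd 0 (by norm_num) t ht
  have hv1 : ∀ t ∈ I, iteratedDerivWithin 1 v I t
      = iteratedDerivWithin 2 u I t - fderiv ℝ N (u t) (iteratedDerivWithin 1 u I t) := by
    intro t ht
    rw [iteratedDerivWithin_one (f := v)]
    refine HasDerivWithinAt.derivWithin ?_ (hs t ht)
    have h1 := hd 1 (by norm_num) t ht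
    rw [iteratedDerivWithin_one] at h1 ⊢
    have h0 := hd0 t ht
    rw [iteratedDerivWithin_one] at h0
    refine h1.sub ?_
    exact (((hNat t ht).differentiableAt (by norm_num)).hasFDerivAt).comp_hasDerivWithinAt t h0
  have hv2 : ∀ t ∈ I, iteratedDerivWithin 2 v I t
      = iteratedDerivWithin 3 u I t - iteratedFDeriv ℝ 2 N (u t)
          ![iteratedDerivWithin 1 u I t, iteratedDerivWithin 1 u I t]
        - fderiv ℝ N (u t) (iteratedDerivWithin 2 u I t) := by
    intro t ht
    rw [iteratedDerivWithin_succ (f := v), derivWithin_congr hv1 (hv1 t ht)]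
    refine HasDerivWithinAt.derivWithin ?_ (hs t ht)
    have h1 : HasDerivWithinAt (fun t => fderiv ℝ N (u t))
        (fderiv ℝ (fderiv ℝ N) (u t) (iteratedDerivWithin 1 u I t)) I t :=
      ((((hNat t ht).fderiv_right (m := 2) (by norm_num)).differentiableAt
        (by norm_num)).hasFDerivAt).comp_hasDerivWithinAt t (hd0 t ht)
    refine ((hd 2 (by norm_num) t ht).sub (h1.clm_apply (hd 1 (by norm_num) t ht))).congr_deriv ?_
    rw [iteratedFDeriv_two_apply]
    simp only [Matrix.cons_val_zero, Matrix.cons_val_one]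
    abel
  -- This is `L u''' + N'(u) u'''`. It enters only remainders, so boundedness suffices.
  refine ⟨fun t => iteratedDerivWithin 3 v I t
    + fderiv ℝ N (u t) (iteratedDerivWithin 3 u I t), ?_, fun t ht => ⟨?_, ?_, ?_⟩⟩
  · refine isCompact_Icc.exists_bound_of_continuousOn (ContinuousOn.add ?_ ?_)
    · exact hvs.continuousOn_iteratedDerivWithin (by norm_num) hs
    · refine ContinuousOn.clm_apply (fun t ht => ?_)
        (hus.continuousOn_iteratedDerivWithin (by norm_num) hs)
      have := ((hNat t ht).fderiv_right (m := 2) (by norm_num)).continuousAt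
      exact this.comp_continuousWithinAt (hus.continuousOn t ht)
  · refine mem_graph_vadd_iff.2 ?_
    rw [← hv1 t ht]
    exact hgk 1 (by norm_num) t ht
  · refine mem_graph_vadd_iff.2 ?_
    rw [← hv2 t ht]
    exact hgk 2 (by norm_num) t ht
  · refine mem_graph_vadd_iff.2 ?_
    rw [add_sub_cancel_right]
    exact hgk 3 (by norm_num) t ht

end Solution

/-- Mean value inequality with the crude constant `C τⁿ`; losing the factor `1/(n+1)` is harmless.
-/
theorem norm_le_pow_of_deriv_le {g g' : ℝ → X} {τ C : ℝ} {n : ℕ} (hτ : 0 ≤ τ) (hC : 0 ≤ C)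
    (hg : ∀ s ∈ Icc 0 τ, HasDerivWithinAt g (g' s) (Icc 0 τ) s) (hg0 : g 0 = 0)
    (hb : ∀ s ∈ Icc 0 τ, ‖g' s‖ ≤ C * s ^ n) : ‖g τ‖ ≤ C * τ ^ (n + 1) := by
  have := Convex.norm_image_sub_le_of_norm_hasDerivWithin_le (C := C * τ ^ n) hg
    (fun s hs => (hb s hs).trans (by have := hs.1; have := hs.2; gcongr)) (convex_Icc 0 τ)
    (left_mem_Icc.2 hτ) (right_mem_Icc.2 hτ)
  rw [hg0, sub_zero, sub_zero, Real.norm_of_nonneg hτ, mul_assoc, ← pow_succ] at this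
  exact this

/-- Third-order Taylor expansion on an interval, with a uniform remainder. -/
theorem exists_taylor_three_bound {t₀ T : ℝ} (hT : t₀ < T) {u : ℝ → X}
    (hus : ContDiffOn ℝ 4 u (Icc t₀ T)) :
    ∃ C, ∀ t ∈ Icc t₀ T, ∀ τ, 0 ≤ τ → t + τ ≤ T →
      ‖u (t + τ) - u t - (τ • iteratedDerivWithin 1 u (Icc t₀ T) t
        + (τ ^ 2 / 2) • iteratedDerivWithin 2 u (Icc t₀ T) t
        + (τ ^ 3 / 6) • iteratedDerivWithin 3 u (Icc t₀ T) t)‖ ≤ C * τ ^ 4 := by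
  set I := Icc t₀ T with hI
  have hs : UniqueDiffOn ℝ I := uniqueDiffOn_Icc hT
  obtain ⟨C, hC⟩ := isCompact_Icc.exists_bound_of_continuousOn
    (hus.continuousOn_iteratedDerivWithin (m := 4) le_rfl hs)
  have hC0 : 0 ≤ C := (norm_nonneg _).trans (hC t₀ (left_mem_Icc.2 hT.le))
  refine ⟨C, fun t ht => ?_⟩
  have hmem : ∀ τ, 0 ≤ τ → t + τ ≤ T → t + τ ∈ I := fun τ h0 h1 => ⟨by linarith [ht.1], h1⟩
  have hd : ∀ k < 4, ∀ τ, t + τ ≤ T → ∀ s ∈ Icc 0 τ,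
      HasDerivWithinAt (fun s => iteratedDerivWithin k u I (t + s))
        (iteratedDerivWithin (k + 1) u I (t + s)) (Icc 0 τ) s := by
    intro k hk τ hτ s hs'
    have h1 := hasDerivWithinAt_iteratedDerivWithin hs hus (k := k) (by exact_mod_cast hk)
      (hmem s hs'.1 (by linarith [hs'.2]))
    have h2 : HasDerivWithinAt (fun s : ℝ => t + s) 1 (Icc 0 τ) s :=
      ((hasDerivAt_id s).const_add t).hasDerivWithinAt
    have h3 := h1.scomp s h2 (fun r hr => hmem r hr.1 (by linarith [hr.2]))
    rw [one_smul] at h3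
    exact h3
  have hpow : ∀ (k : ℕ) (s : ℝ) (S : Set ℝ),
      HasDerivWithinAt (fun s : ℝ => s ^ (k + 1)) ((k + 1 : ℝ) * s ^ k) S s := fun k s S => by
    simpa using (hasDerivAt_pow (k + 1) s).hasDerivWithinAt
  set u₁ := iteratedDerivWithin 1 u I t
  set u₂ := iteratedDerivWithin 2 u I t
  set u₃ := iteratedDerivWithin 3 u I t
  -- The remainder bound is integrated downwards from the third derivative: each remainder is the
  -- derivative of the next.
  have b3 : ∀ τ, 0 ≤ τ → t + τ ≤ T → ‖iteratedDerivWithin 3 u I (t + τ) - u₃‖ ≤ C * τ ^ 1 := by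
    intro τ h0 h1
    refine norm_le_pow_of_deriv_le (g := fun s => iteratedDerivWithin 3 u I (t + s) - u₃) h0 hC0
      (fun s hs' => (hd 3 (by norm_num) τ h1 s hs').sub_const _) (by simp [u₃]) fun s hs' => ?_
    simpa using hC _ (hmem s hs'.1 (by linarith [hs'.2]))
  have b2 : ∀ τ, 0 ≤ τ → t + τ ≤ T →
      ‖iteratedDerivWithin 2 u I (t + τ) - u₂ - τ • u₃‖ ≤ C * τ ^ 2 := by
    intro τ h0 h1
    refine norm_le_pow_of_deriv_le
      (g := fun s => iteratedDerivWithin 2 u I (t + s) - u₂ - s • u₃) h0 hC0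
      (fun s hs' => ((hd 2 (by norm_num) τ h1 s hs').sub_const _).sub
        ((hasDerivWithinAt_id s _).smul_const u₃)) (by simp [u₂]) fun s hs' => ?_
    rw [one_smul]
    exact b3 s hs'.1 (by linarith [hs'.2])
  have b1 : ∀ τ, 0 ≤ τ → t + τ ≤ T →
      ‖iteratedDerivWithin 1 u I (t + τ) - u₁ - (τ • u₂ + (τ ^ 2 / 2) • u₃)‖ ≤ C * τ ^ 3 := by
    intro τ h0 h1
    refine norm_le_pow_of_deriv_le
      (g := fun s => iteratedDerivWithin 1 u I (t + s) - u₁ - (s • u₂ + (s ^ 2 / 2) • u₃)) h0 hC0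
      (fun s hs' => ((hd 1 (by norm_num) τ h1 s hs').sub_const _).sub
        (((hasDerivWithinAt_id s _).smul_const u₂).add
          (((hpow 1 s _).div_const 2).smul_const u₃))) (by simp [u₁]) fun s hs' => ?_
    convert b2 s hs'.1 (by linarith [hs'.2]) using 2
    norm_num
    module
  intro τ h0 h1
  refine norm_le_pow_of_deriv_le
    (g := fun s => u (t + s) - u t - (s • u₁ + (s ^ 2 / 2) • u₂ + (s ^ 3 / 6) • u₃)) h0 hC0
    (fun s hs' => (HasDerivWithinAt.sub_const _ (by
      simpa using hd 0 (by norm_num) τ h1 s hs')).sub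
      ((((hasDerivWithinAt_id s _).smul_const u₁).add
        (((hpow 1 s _).div_const 2).smul_const u₂)).add
          (((hpow 2 s _).div_const 6).smul_const u₃))) (by simp) fun s hs' => ?_
  convert b1 s hs'.1 (by linarith [hs'.2]) using 2
  norm_num
  module

end StiffEPIRK

namespace StiffEPIRK

variable {X : Type*} [NormedAddCommGroup X] [NormedSpace ℝ X]

/-! ### Asymptotic expansion of multilinear maps -/

section Multilinear

/-- Phrased by agreement off one slot, so that it applies to explicit vectors without
`Function.update`. -/
theorem map_add_of_eq_off {n : ℕ} (D : X [×n]→L[ℝ] X) (i : Fin n) {m m₁ m₂ : Fin n → X}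
    (hi : m i = m₁ i + m₂ i) (h₁ : ∀ j, j ≠ i → m j = m₁ j) (h₂ : ∀ j, j ≠ i → m j = m₂ j) :
    D m = D m₁ + D m₂ := by
  have e := D.map_update_add m i (m₁ i) (m₂ i)
  have aux : ∀ m' : Fin n → X, (∀ j, j ≠ i → m j = m' j) → Function.update m i (m' i) = m' := by
    intro m' hm'
    ext j
    by_cases hj : j = i
    · subst hj; simp
    · simp [hj, hm' j hj]
  rwa [aux m₁ h₁, aux m₂ h₂, ← hi, Function.update_eq_self] at e

theorem map_smul_of_eq_off {n : ℕ} (D : X [×n]→L[ℝ] X) (i : Fin n) {m m₁ : Fin n → X} {c : ℝ}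
    (hi : m i = c • m₁ i) (h₁ : ∀ j, j ≠ i → m j = m₁ j) : D m = c • D m₁ := by
  have e := D.map_update_smul m i c (m₁ i)
  have aux : Function.update m i (m₁ i) = m₁ := by
    ext j
    by_cases hj : j = i
    · subst hj; simp
    · simp [hj, h₁ j hj]
  rwa [aux, ← hi, Function.update_eq_self] at e

theorem map_two_add_left (D : X [×2]→L[ℝ] X) (a a' b : X) :
    D ![a + a', b] = D ![a, b] + D ![a', b] := by
  refine map_add_of_eq_off D 0 rfl ?_ ?_ <;> intro j <;> fin_cases j <;> simp

theorem map_two_add_right (D : X [×2]→L[ℝ] X) (a b b' : X) :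
    D ![a, b + b'] = D ![a, b] + D ![a, b'] := by
  refine map_add_of_eq_off D 1 rfl ?_ ?_ <;> intro j <;> fin_cases j <;> simp

theorem map_two_smul_left (D : X [×2]→L[ℝ] X) (c : ℝ) (a b : X) :
    D ![c • a, b] = c • D ![a, b] := by
  refine map_smul_of_eq_off D 0 rfl fun j => ?_
  fin_cases j <;> simp

theorem map_two_smul_right (D : X [×2]→L[ℝ] X) (c : ℝ) (a b : X) :
    D ![a, c • b] = c • D ![a, b] := by
  refine map_smul_of_eq_off D 1 rfl fun j => ?_
  fin_cases j <;> simp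

theorem map_three_add_fst (D : X [×3]→L[ℝ] X) (a a' b c : X) :
    D ![a + a', b, c] = D ![a, b, c] + D ![a', b, c] := by
  refine map_add_of_eq_off D 0 rfl ?_ ?_ <;> intro j <;> fin_cases j <;> simp

theorem map_three_add_snd (D : X [×3]→L[ℝ] X) (a b b' c : X) :
    D ![a, b + b', c] = D ![a, b, c] + D ![a, b', c] := by
  refine map_add_of_eq_off D 1 rfl ?_ ?_ <;> intro j <;> fin_cases j <;> simp

theorem map_three_add_trd (D : X [×3]→L[ℝ] X) (a b c c' : X) :
    D ![a, b, c + c'] = D ![a, b, c] + D ![a, b, c'] := by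
  refine map_add_of_eq_off D 2 rfl ?_ ?_ <;> intro j <;> fin_cases j <;> simp

theorem map_three_smul_fst (D : X [×3]→L[ℝ] X) (r : ℝ) (a b c : X) :
    D ![r • a, b, c] = r • D ![a, b, c] := by
  refine map_smul_of_eq_off D 0 rfl fun j => ?_
  fin_cases j <;> simp

theorem map_three_smul_snd (D : X [×3]→L[ℝ] X) (r : ℝ) (a b c : X) :
    D ![a, r • b, c] = r • D ![a, b, c] := by
  refine map_smul_of_eq_off D 1 rfl fun j => ?_
  fin_cases j <;> simp

theorem map_three_smul_trd (D : X [×3]→L[ℝ] X) (r : ℝ) (a b c : X) :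
    D ![a, b, r • c] = r • D ![a, b, c] := by
  refine map_smul_of_eq_off D 2 rfl fun j => ?_
  fin_cases j <;> simp

/-- Telescoping one slot at a time: four error terms with `e` in a distinguished slot, instead of
fifteen mixed ones. -/
theorem map_four_add_diag (D : X [×4]→L[ℝ] X) (y e : X) :
    D ![y + e, y + e, y + e, y + e] = D ![y, y, y, y] + (D ![e, y + e, y + e, y + e]
      + D ![y, e, y + e, y + e] + D ![y, y, e, y + e] + D ![y, y, y, e]) := by
  have h1 : ∀ a b c d d', D ![a, b, c, d + d'] = D ![a, b, c, d] + D ![a, b, c, d'] :=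
    fun a b c d d' => by
      refine map_add_of_eq_off D 3 rfl ?_ ?_ <;> intro j <;> fin_cases j <;> simp
  have h2 : ∀ a b c c' d, D ![a, b, c + c', d] = D ![a, b, c, d] + D ![a, b, c', d] :=
    fun a b c c' d => by
      refine map_add_of_eq_off D 2 rfl ?_ ?_ <;> intro j <;> fin_cases j <;> simp
  have h3 : ∀ a b b' c d, D ![a, b + b', c, d] = D ![a, b, c, d] + D ![a, b', c, d] :=
    fun a b b' c d => by
      refine map_add_of_eq_off D 1 rfl ?_ ?_ <;> intro j <;> fin_cases j <;> simp
  have h4 : ∀ a a' b c d, D ![a + a', b, c, d] = D ![a, b, c, d] + D ![a', b, c, d] :=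
    fun a a' b c d => by
      refine map_add_of_eq_off D 0 rfl ?_ ?_ <;> intro j <;> fin_cases j <;> simp
  simp only [h1, h2, h3, h4]
  abel

theorem map_four_smul_diag (D : X [×4]→L[ℝ] X) (r : ℝ) (y : X) :
    D ![r • y, r • y, r • y, r • y] = r ^ 4 • D ![y, y, y, y] := by
  have := D.map_smul_univ (fun _ => r) ![y, y, y, y]
  simp only [Finset.prod_const, Finset.card_univ, Fintype.card_fin] at this
  rw [← this]
  congr 1
  ext i
  fin_cases i <;> rfl

end Multilinear

/-! ### Expansions of forms on the diagonal in powers of the step. -/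

section Expansion

open Asymptotics

variable {α : Type*} {l : Filter α} {h : α → ℝ}

theorem isBigO_pow_pow (hh : h =O[l] fun _ => (1 : ℝ)) {m n : ℕ} (hmn : n ≤ m) :
    (fun a => h a ^ m) =O[l] fun a => h a ^ n := by
  obtain ⟨k, rfl⟩ := Nat.exists_eq_add_of_le hmn
  have : (fun a => h a ^ k) =O[l] fun _ => (1 : ℝ) := by simpa using hh.pow k
  simpa [pow_add] using (isBigO_refl (fun a => h a ^ n) l).mul this

theorem IsBigO.mono_pow {f : α → X} (hh : h =O[l] fun _ => (1 : ℝ)) {m n : ℕ} (hmn : n ≤ m)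
    (hf : f =O[l] fun a => h a ^ m) : f =O[l] fun a => h a ^ n :=
  hf.trans (isBigO_pow_pow hh hmn)

theorem isBigO_pow_smul {f : α → X} {n : ℕ} (m : ℕ) (hf : f =O[l] fun a => h a ^ n) :
    (fun a => h a ^ m • f a) =O[l] fun a => h a ^ (m + n) := by
  simpa [pow_add] using (isBigO_refl (fun a => h a ^ m) l).smul hf

theorem isBigO_multilinear {n : ℕ} {D : α → X [×n]→L[ℝ] X} (hD : D =O[l] fun _ => (1 : ℝ))
    {v : α → Fin n → X} (m : Fin n → ℕ) (hv : ∀ i, (fun a => v a i) =O[l] fun a => h a ^ m i) :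
    (fun a => D a (v a)) =O[l] fun a => h a ^ (∑ i, m i) := by
  have h1 : (fun a => D a (v a)) =O[l] fun a => ‖D a‖ * ∏ i, ‖v a i‖ :=
    IsBigO.of_bound 1 (Eventually.of_forall fun a => by
      rw [one_mul, Real.norm_of_nonneg (by positivity)]
      exact (D a).le_opNorm (v a))
  have h2 : ∀ s : Finset (Fin n),
      (fun a => ∏ i ∈ s, ‖v a i‖) =O[l] fun a => ∏ i ∈ s, h a ^ m i := by
    classical
    intro s
    induction s using Finset.induction_on with
    | empty => simpa using isBigO_refl (fun _ : α => (1 : ℝ)) l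
    | insert i s hi ih =>
      simp only [Finset.prod_insert hi]
      exact (hv i).norm_left.mul ih
  refine h1.trans ((hD.norm_left.mul (h2 Finset.univ)).congr_right fun a => ?_)
  rw [one_mul, Finset.prod_pow_eq_pow_sum]

theorem isBigO_of_sub (hh : h =O[l] fun _ => (1 : ℝ))
    {f g : α → X} {m n k : ℕ} (hf : (fun a => f a - g a) =O[l] fun a => h a ^ m)
    (hg : g =O[l] fun a => h a ^ n) (hm : k ≤ m) (hn : k ≤ n) : f =O[l] fun a => h a ^ k := by
  simpa using (IsBigO.mono_pow hh hm hf).add (IsBigO.mono_pow hh hn hg)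

/-- Write `w = p + e` with `p` the polynomial part and `e` of order `h⁴`. In `D(e,w) + D(p,e)` the
other slot gains a factor `h`. Symmetry of `D` is not assumed, so mixed terms appear in both orders.
-/
theorem quadratic_expansion (hh : h =O[l] fun _ => (1 : ℝ))
    {D : α → X [×2]→L[ℝ] X} (hD : D =O[l] fun _ => (1 : ℝ))
    {w x₁ x₂ x₃ : α → X} (h₁ : x₁ =O[l] fun _ => (1 : ℝ)) (h₂ : x₂ =O[l] fun _ => (1 : ℝ))
    (h₃ : x₃ =O[l] fun _ => (1 : ℝ))
    (hw : (fun a => w a - (h a • x₁ a + h a ^ 2 • x₂ a + h a ^ 3 • x₃ a))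
      =O[l] fun a => h a ^ 4) :
    (fun a => D a ![w a, w a] - (h a ^ 2 • D a ![x₁ a, x₁ a]
      + h a ^ 3 • (D a ![x₁ a, x₂ a] + D a ![x₂ a, x₁ a])
      + h a ^ 4 • (D a ![x₁ a, x₃ a] + D a ![x₃ a, x₁ a] + D a ![x₂ a, x₂ a])))
      =O[l] fun a => h a ^ 5 := by
  set p : α → X := fun a => h a • x₁ a + h a ^ 2 • x₂ a + h a ^ 3 • x₃ a with hp
  set e : α → X := fun a => w a - p a with he
  have z : ∀ {x : α → X}, x =O[l] (fun _ => (1 : ℝ)) → x =O[l] fun a => h a ^ 0 := by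
    intro x hx; simpa using hx
  have hpO : p =O[l] fun a => h a ^ 1 := by
    have a1 := isBigO_pow_smul 1 (z h₁)
    have a2 := IsBigO.mono_pow hh (by norm_num : 1 ≤ 2) (isBigO_pow_smul 2 (z h₂))
    have a3 := IsBigO.mono_pow hh (by norm_num : 1 ≤ 3) (isBigO_pow_smul 3 (z h₃))
    simpa [hp] using (a1.add a2).add a3
  have hwO : w =O[l] fun a => h a ^ 1 := isBigO_of_sub hh hw hpO (by norm_num) le_rfl
  have t1 : (fun a => D a ![e a, w a]) =O[l] fun a => h a ^ 5 :=
    isBigO_multilinear hD ![4, 1] (by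
      rw [Fin.forall_fin_two]; exact ⟨hw, hwO⟩)
  have t2 : (fun a => D a ![p a, e a]) =O[l] fun a => h a ^ 5 :=
    isBigO_multilinear hD ![1, 4] (by
      rw [Fin.forall_fin_two]; exact ⟨hpO, hw⟩)
  have d : ∀ {x y : α → X}, x =O[l] (fun _ => (1 : ℝ)) → y =O[l] (fun _ => (1 : ℝ)) →
      (fun a => D a ![x a, y a]) =O[l] fun a => h a ^ 0 := fun {x y} hx hy =>
    isBigO_multilinear hD ![0, 0] (by
      rw [Fin.forall_fin_two]; exact ⟨z hx, z hy⟩)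
  have t3 : (fun a => h a ^ 5 • (D a ![x₂ a, x₃ a] + D a ![x₃ a, x₂ a]))
      =O[l] fun a => h a ^ 5 := isBigO_pow_smul 5 ((d h₂ h₃).add (d h₃ h₂))
  have t4 : (fun a => h a ^ 6 • D a ![x₃ a, x₃ a]) =O[l] fun a => h a ^ 5 :=
    IsBigO.mono_pow hh (by norm_num) (isBigO_pow_smul 6 (d h₃ h₃))
  refine (((t1.add t2).add t3).add t4).congr_left fun a => ?_
  have ew : w a = p a + e a := by simp [he]
  have e1 : D a ![w a, w a] = D a ![e a, w a] + (D a ![p a, e a] + D a ![p a, p a]) := by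
    nth_rewrite 1 [ew]
    rw [map_two_add_left]
    nth_rewrite 1 [ew]
    rw [map_two_add_right]
    abel
  rw [e1]
  have e2 : D a ![p a, p a] = h a ^ 2 • D a ![x₁ a, x₁ a]
      + h a ^ 3 • (D a ![x₁ a, x₂ a] + D a ![x₂ a, x₁ a])
      + h a ^ 4 • (D a ![x₁ a, x₃ a] + D a ![x₃ a, x₁ a] + D a ![x₂ a, x₂ a])
      + h a ^ 5 • (D a ![x₂ a, x₃ a] + D a ![x₃ a, x₂ a]) + h a ^ 6 • D a ![x₃ a, x₃ a] := by
    simp only [hp, map_two_add_left, map_two_add_right, map_two_smul_left, map_two_smul_right]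
    module
  rw [e2]
  abel

/-- Two terms of `w` suffice, since the other two slots already supply `h²`. -/
theorem cubic_expansion (hh : h =O[l] fun _ => (1 : ℝ))
    {D : α → X [×3]→L[ℝ] X} (hD : D =O[l] fun _ => (1 : ℝ))
    {w x₁ x₂ : α → X} (h₁ : x₁ =O[l] fun _ => (1 : ℝ)) (h₂ : x₂ =O[l] fun _ => (1 : ℝ))
    (hw : (fun a => w a - (h a • x₁ a + h a ^ 2 • x₂ a)) =O[l] fun a => h a ^ 3) :
    (fun a => D a ![w a, w a, w a] - (h a ^ 3 • D a ![x₁ a, x₁ a, x₁ a]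
      + h a ^ 4 • (D a ![x₁ a, x₁ a, x₂ a] + D a ![x₁ a, x₂ a, x₁ a]
        + D a ![x₂ a, x₁ a, x₁ a]))) =O[l] fun a => h a ^ 5 := by
  set p : α → X := fun a => h a • x₁ a + h a ^ 2 • x₂ a with hp
  set e : α → X := fun a => w a - p a with he
  have z : ∀ {x : α → X}, x =O[l] (fun _ => (1 : ℝ)) → x =O[l] fun a => h a ^ 0 := by
    intro x hx; simpa using hx
  have hpO : p =O[l] fun a => h a ^ 1 := by
    have a1 := isBigO_pow_smul 1 (z h₁)
    have a2 := IsBigO.mono_pow hh (by norm_num : 1 ≤ 2) (isBigO_pow_smul 2 (z h₂))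
    simpa [hp] using a1.add a2
  have hwO : w =O[l] fun a => h a ^ 1 := isBigO_of_sub hh hw hpO (by norm_num) le_rfl
  have f3 : ∀ {P : Fin 3 → Prop}, P 0 → P 1 → P 2 → ∀ i, P i := by
    intro P a b c i; fin_cases i <;> assumption
  have t1 : (fun a => D a ![e a, w a, w a]) =O[l] fun a => h a ^ 5 :=
    isBigO_multilinear hD ![3, 1, 1] (f3 hw hwO hwO)
  have t2 : (fun a => D a ![p a, e a, w a]) =O[l] fun a => h a ^ 5 :=
    isBigO_multilinear hD ![1, 3, 1] (f3 hpO hw hwO)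
  have t3 : (fun a => D a ![p a, p a, e a]) =O[l] fun a => h a ^ 5 :=
    isBigO_multilinear hD ![1, 1, 3] (f3 hpO hpO hw)
  have d : ∀ {x y v : α → X}, x =O[l] (fun _ => (1 : ℝ)) → y =O[l] (fun _ => (1 : ℝ)) →
      v =O[l] (fun _ => (1 : ℝ)) → (fun a => D a ![x a, y a, v a]) =O[l] fun a => h a ^ 0 :=
    fun {x y v} hx hy hv => isBigO_multilinear hD ![0, 0, 0] (f3 (z hx) (z hy) (z hv))
  have t4 : (fun a => h a ^ 5 • (D a ![x₁ a, x₂ a, x₂ a] + D a ![x₂ a, x₁ a, x₂ a]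
      + D a ![x₂ a, x₂ a, x₁ a])) =O[l] fun a => h a ^ 5 :=
    isBigO_pow_smul 5 (((d h₁ h₂ h₂).add (d h₂ h₁ h₂)).add (d h₂ h₂ h₁))
  have t5 : (fun a => h a ^ 6 • D a ![x₂ a, x₂ a, x₂ a]) =O[l] fun a => h a ^ 5 :=
    IsBigO.mono_pow hh (by norm_num) (isBigO_pow_smul 6 (d h₂ h₂ h₂))
  refine ((((t1.add t2).add t3).add t4).add t5).congr_left fun a => ?_
  have ew : w a = p a + e a := by simp [he]
  have e1 : D a ![w a, w a, w a] = D a ![e a, w a, w a] + (D a ![p a, e a, w a]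
      + (D a ![p a, p a, e a] + D a ![p a, p a, p a])) := by
    rw [ew]
    simp only [map_three_add_fst, map_three_add_snd, map_three_add_trd]
    abel
  rw [e1]
  have e2 : D a ![p a, p a, p a] = h a ^ 3 • D a ![x₁ a, x₁ a, x₁ a]
      + h a ^ 4 • (D a ![x₁ a, x₁ a, x₂ a] + D a ![x₁ a, x₂ a, x₁ a] + D a ![x₂ a, x₁ a, x₁ a])
      + h a ^ 5 • (D a ![x₁ a, x₂ a, x₂ a] + D a ![x₂ a, x₁ a, x₂ a] + D a ![x₂ a, x₂ a, x₁ a])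
      + h a ^ 6 • D a ![x₂ a, x₂ a, x₂ a] := by
    simp only [hp, map_three_add_fst, map_three_add_snd, map_three_add_trd, map_three_smul_fst,
      map_three_smul_snd, map_three_smul_trd]
    module
  rw [e2]
  abel

theorem quartic_expansion (hh : h =O[l] fun _ => (1 : ℝ))
    {D : α → X [×4]→L[ℝ] X} (hD : D =O[l] fun _ => (1 : ℝ))
    {w x₁ : α → X} (h₁ : x₁ =O[l] fun _ => (1 : ℝ))
    (hw : (fun a => w a - h a • x₁ a) =O[l] fun a => h a ^ 2) :
    (fun a => D a ![w a, w a, w a, w a] - h a ^ 4 • D a ![x₁ a, x₁ a, x₁ a, x₁ a])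
      =O[l] fun a => h a ^ 5 := by
  set p : α → X := fun a => h a • x₁ a with hp
  set e : α → X := fun a => w a - p a with he
  have hpO : p =O[l] fun a => h a ^ 1 := by
    simpa [hp] using isBigO_pow_smul (n := 0) 1 (by simpa using h₁)
  have hwO : w =O[l] fun a => h a ^ 1 := isBigO_of_sub hh hw hpO (by norm_num) le_rfl
  have f4 : ∀ {P : Fin 4 → Prop}, P 0 → P 1 → P 2 → P 3 → ∀ i, P i := by
    intro P a b c d i; fin_cases i <;> assumption
  have t1 : (fun a => D a ![e a, w a, w a, w a]) =O[l] fun a => h a ^ 5 :=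
    isBigO_multilinear hD ![2, 1, 1, 1] (f4 hw hwO hwO hwO)
  have t2 : (fun a => D a ![p a, e a, w a, w a]) =O[l] fun a => h a ^ 5 :=
    isBigO_multilinear hD ![1, 2, 1, 1] (f4 hpO hw hwO hwO)
  have t3 : (fun a => D a ![p a, p a, e a, w a]) =O[l] fun a => h a ^ 5 :=
    isBigO_multilinear hD ![1, 1, 2, 1] (f4 hpO hpO hw hwO)
  have t4 : (fun a => D a ![p a, p a, p a, e a]) =O[l] fun a => h a ^ 5 :=
    isBigO_multilinear hD ![1, 1, 1, 2] (f4 hpO hpO hpO hw)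
  refine (((t1.add t2).add t3).add t4).congr_left fun a => ?_
  have ew : w a = p a + e a := by simp [he]
  have e1 := map_four_add_diag (D a) (p a) (e a)
  rw [← ew, map_four_smul_diag] at e1
  rw [e1]
  abel

end Expansion

end StiffEPIRK

namespace StiffEPIRK

variable {X : Type*} [NormedAddCommGroup X] [NormedSpace ℝ X]

/-! ### Expansion of the internal stages -/

theorem phi_map_sub [CompleteSpace X] {S : ℝ → X →L[ℝ] X} (hS : IsC0Semigroup S) {τ : ℝ}
    (hτ : 0 ≤ τ) (k : ℕ) (x y : X) :
    phi S (k + 1) τ (x - y) = phi S (k + 1) τ x - phi S (k + 1) τ y := by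
  simpa only [symOp_phiSym] using symOp_map_sub hS hτ (phiSym k) x y

/-- The symbol of the remainder in the expansion of `ψ_{i1}(g_{i1} z)`. -/
def Method.psiRemSym (M : Method) (i : ℕ) : Symbol :=
  ∑ k ∈ Finset.Icc 1 M.K,
    (M.g i 1 ^ 3 * M.p i 1 k) • Finsupp.single (k + 2, ⟨M.g i 1, M.g_nonneg i 1⟩) 1

theorem Method.symOp_psiRemSym (M : Method) (S : ℝ → X →L[ℝ] X) (h : ℝ) (i : ℕ) (x : X) :
    symOp S h (M.psiRemSym i) x
      = ∑ k ∈ Finset.Icc 1 M.K, (M.g i 1 ^ 3 * M.p i 1 k) • phi S (k + 3) (M.g i 1 * h) x := by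
  simp only [psiRemSym, map_sum, map_smul, Finset.sum_apply, Pi.smul_apply, symOp_single, one_smul]
  rfl

/-- The `φ`-recurrence is used three times along `u₁, u₂, u₃`. The vector `d` is the defect in `A u₂
= u₃`; it stays under `φ_{k+2}`, since nothing is assumed about `A d`. -/
theorem Method.psi_expansion [CompleteSpace X] (M : Method) {A : X →ₗ.[ℝ] X}
    {S : ℝ → X →L[ℝ] X} (hA : IsGenerator A S) {h : ℝ} (hh : 0 ≤ h) {u₁ u₂ u₃ u₄ d : X}
    (h₁ : (u₁, u₂) ∈ A.graph) (h₂ : (u₂, u₃ - d) ∈ A.graph) (h₃ : (u₃, u₄) ∈ A.graph) (i : ℕ) :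
    M.psi S h i 1 u₁ = M.P i 1 • u₁ + (h * (M.g i 1 * M.P i 2)) • u₂
      + (h ^ 2 * (M.g i 1 ^ 2 * M.P i 3)) • u₃
      - (h ^ 2 * M.g i 1 ^ 2) • ∑ k ∈ Finset.Icc 1 M.K, M.p i 1 k • phi S (k + 2) (M.g i 1 * h) d
      + h ^ 3 • symOp S h (M.psiRemSym i) u₄ := by
  have hτ : 0 ≤ M.g i 1 * h := mul_nonneg (M.g_nonneg i 1) hh
  rw [M.symOp_psiRemSym]
  simp only [Method.psi, Method.P, Finset.sum_smul, Finset.mul_sum, Finset.smul_sum]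
  rw [← Finset.sum_add_distrib, ← Finset.sum_add_distrib, ← Finset.sum_sub_distrib,
    ← Finset.sum_add_distrib]
  refine Finset.sum_congr rfl fun k hk => ?_
  obtain ⟨k, rfl⟩ := Nat.exists_eq_add_of_le' (Finset.mem_Icc.1 hk).1
  have e₁ := hA.phi_recurrence h₁ k hτ
  have e₂ := hA.phi_recurrence h₂ (k + 1) hτ
  have e₃ := hA.phi_recurrence h₃ (k + 2) hτ
  rw [phi_map_sub hA.semigroup hτ] at e₂
  simp only [add_assoc, Nat.reduceAdd] at e₁ e₂ e₃ ⊢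
  simp only [show k + 2 - 1 = k + 1 by omega, show k + 3 - 1 = k + 2 by omega,
    show k + 4 - 1 = k + 3 by omega]
  rw [e₁, e₂, e₃]
  simp only [div_eq_mul_inv]
  module

/-! ### Asymptotics uniform over a family of semigroups. -/

section Asymptotic

open Asymptotics

variable {α : Type*} {l : Filter α} {h : α → ℝ} {S : α → ℝ → X →L[ℝ] X}

/-- A family of strongly continuous semigroups with a common exponential bound, together with
step sizes in `(0, 1]`. -/
structure UniformFamily (l : Filter α) (h : α → ℝ) (S : α → ℝ → X →L[ℝ] X) : Prop where
  pos : ∀ᶠ a in l, 0 < h a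
  le_one : ∀ᶠ a in l, h a ≤ 1
  semigroup : ∀ᶠ a in l, IsC0Semigroup (S a)
  bound : ∃ C ω : ℝ, 0 ≤ ω ∧ ∀ᶠ a in l, ∀ t, 0 ≤ t → ‖S a t‖ ≤ C * Real.exp (ω * t)

theorem UniformFamily.step_isBigO (H : UniformFamily l h S) : h =O[l] fun _ => (1 : ℝ) := by
  refine IsBigO.of_bound 1 ?_
  filter_upwards [H.pos, H.le_one] with a h0 h1
  rw [Real.norm_of_nonneg h0.le]
  simpa using h1

/-- The constant depends on the semigroups only through their common exponential bound, so
evaluating a symbol costs no order. -/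
theorem UniformFamily.symOp_isBigO (H : UniformFamily l h S) (σ : Symbol) {f : α → X} {g : α → ℝ}
    (hf : f =O[l] g) : (fun a => symOp (S a) (h a) σ (f a)) =O[l] g := by
  obtain ⟨C, ω, hω, hb⟩ := H.bound
  obtain ⟨D, _, hD⟩ := exists_norm_symOp_le (X := X) σ (C := C) hω
  refine IsBigO.trans (IsBigO.of_bound D ?_) hf
  filter_upwards [H.pos, H.le_one, hb] with a h0 h1 h2
  exact hD (S a) h2 (h a) ⟨h0.le, h1⟩ (f a)

variable [CompleteSpace X]

/-- Strong induction on the stage. Earlier residuals enter with a factor `h`, so only their `h²`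
term is needed; it yields the first half of `Ψ_i`, and the defect in `Method.psi_expansion` yields
the second. -/
theorem Method.stage_expansion (M : Method) (H : UniformFamily l h S) {A : α → X →ₗ.[ℝ] X}
    (hA : ∀ᶠ a in l, IsGenerator (A a) (S a)) {u₁ u₂ u₃ u₄ v : α → X} {R : α → X → X}
    {D : α → X [×2]→L[ℝ] X} (hu₁ : u₁ =O[l] fun _ => (1 : ℝ)) (hu₂ : u₂ =O[l] fun _ => (1 : ℝ))
    (hu₃ : u₃ =O[l] fun _ => (1 : ℝ)) (hu₄ : u₄ =O[l] fun _ => (1 : ℝ))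
    (hD : D =O[l] fun _ => (1 : ℝ)) (h₁ : ∀ᶠ a in l, (u₁ a, u₂ a) ∈ (A a).graph)
    (h₂ : ∀ᶠ a in l, (u₂ a, u₃ a - D a ![u₁ a, u₁ a]) ∈ (A a).graph)
    (h₃ : ∀ᶠ a in l, (u₃ a, u₄ a) ∈ (A a).graph)
    (hR : ∀ w : α → X, w =O[l] (fun a => h a ^ 1) →
      (fun a => R a (v a + w a) - R a (v a) - (1 / 2 : ℝ) • D a ![w a, w a])
        =O[l] fun a => h a ^ 3) (i : ℕ) :
    (fun a => M.stage (S a) (h a) (u₁ a) (R a) (v a) i - v a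
      - (h a • ((M.α i 1 * M.P i 1) • u₁ a)
        + h a ^ 2 • ((M.α i 1 * M.g i 1 * M.P i 2) • u₂ a)
        + h a ^ 3 • ((M.α i 1 * M.g i 1 ^ 2 * M.P i 3) • u₃ a
          + M.Psi (S a) (h a) i (D a ![u₁ a, u₁ a])))) =O[l] fun a => h a ^ 4 := by
  have hh := H.step_isBigO
  have z : ∀ {x : α → X}, x =O[l] (fun _ => (1 : ℝ)) → x =O[l] fun a => h a ^ 0 := by
    intro x hx; simpa using hx
  have dO : ∀ {x y : α → X}, x =O[l] (fun _ => (1 : ℝ)) → y =O[l] (fun _ => (1 : ℝ)) →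
      (fun a => D a ![x a, y a]) =O[l] fun a => h a ^ 0 := fun {x y} hx hy =>
    isBigO_multilinear hD ![0, 0] (by rw [Fin.forall_fin_two]; exact ⟨z hx, z hy⟩)
  have hd : (fun a => D a ![u₁ a, u₁ a]) =O[l] fun _ => (1 : ℝ) := by simpa using dO hu₁ hu₁
  induction i using Nat.strong_induction_on with
  | _ i ih =>
  have hr : ∀ j ∈ Finset.Ico 2 i, (fun a => R a (M.stage (S a) (h a) (u₁ a) (R a) (v a) j)
      - R a (v a) - (h a ^ 2 * (M.α j 1 ^ 2 * M.P j 1 ^ 2 / 2)) • D a ![u₁ a, u₁ a])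
      =O[l] fun a => h a ^ 3 := by
    intro j hj
    have ihj := ih j (Finset.mem_Ico.1 hj).2
    have hx₁ := hu₁.const_smul_left (M.α j 1 * M.P j 1)
    have hx₂ := hu₂.const_smul_left (M.α j 1 * M.g j 1 * M.P j 2)
    have hx₃ : (fun a => (M.α j 1 * M.g j 1 ^ 2 * M.P j 3) • u₃ a
        + M.Psi (S a) (h a) j (D a ![u₁ a, u₁ a])) =O[l] fun _ => (1 : ℝ) := by
      refine (hu₃.const_smul_left _).add ?_
      simpa only [Method.symOp_PsiSym] using H.symOp_isBigO (M.PsiSym j) hd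
    set w : α → X := fun a => M.stage (S a) (h a) (u₁ a) (R a) (v a) j - v a with hw
    have hwO : w =O[l] fun a => h a ^ 1 := by
      refine isBigO_of_sub hh ihj (n := 1) (((?_ : _ =O[l] _).add ?_).add ?_) (by norm_num) le_rfl
      · simpa using isBigO_pow_smul 1 (z hx₁)
      · exact IsBigO.mono_pow hh (by norm_num) (isBigO_pow_smul 2 (z hx₂))
      · exact IsBigO.mono_pow hh (by norm_num) (isBigO_pow_smul 3 (z hx₃))
    have q := quadratic_expansion hh hD hx₁ hx₂ hx₃ ihj
    have q3 := isBigO_pow_smul 3 ((dO hx₁ hx₂).add (dO hx₂ hx₁))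
    have q4 := IsBigO.mono_pow hh (by norm_num : 3 ≤ 4)
      (isBigO_pow_smul 4 (((dO hx₁ hx₃).add (dO hx₃ hx₁)).add (dO hx₂ hx₂)))
    have q5 := (((IsBigO.mono_pow hh (by norm_num : 3 ≤ 5) q).add q3).add q4).const_smul_left
      (1 / 2 : ℝ)
    refine ((hR w hwO).add q5).congr_left fun a => ?_
    have e : v a + w a = M.stage (S a) (h a) (u₁ a) (R a) (v a) j := by simp [hw]
    rw [e]
    simp only [Pi.smul_apply, map_two_smul_left, map_two_smul_right]
    module
  have hsum : (fun a => ∑ j ∈ Finset.Ico 2 i, symOp (S a) (h a) (M.aSym i j)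
      (R a (M.stage (S a) (h a) (u₁ a) (R a) (v a) j) - R a (v a)
        - (h a ^ 2 * (M.α j 1 ^ 2 * M.P j 1 ^ 2 / 2)) • D a ![u₁ a, u₁ a]))
      =O[l] fun a => h a ^ 3 :=
    IsBigO.fun_sum fun j hj => H.symOp_isBigO _ (hr j hj)
  have h4 : (fun a => h a ^ 4 • symOp (S a) (h a) (M.psiRemSym i) (u₄ a))
      =O[l] fun a => h a ^ 4 := isBigO_pow_smul 4 (z (H.symOp_isBigO _ hu₄))
  -- The remainder is exactly `h ∑ a_{ij}` of the residual errors plus `α_{i1} h⁴` times the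
  -- `φ_{k+3}` term on `u₄`.
  refine ((isBigO_pow_smul 1 hsum).add (h4.const_smul_left (M.α i 1))).congr' ?_ EventuallyEq.rfl
  filter_upwards [H.pos, hA, h₁, h₂, h₃] with a h0 hAa g₁ g₂ g₃
  rw [Method.stage, M.psi_expansion hAa h0.le g₁ g₂ g₃,
    Finset.sum_attach (Finset.Ico 2 i) fun j => M.a (S a) (h a) i j
      (R a (M.stage (S a) (h a) (u₁ a) (R a) (v a) j) - R a (v a))]
  simp only [symOp_map_sub hAa.semigroup h0.le, symOp_map_smul hAa.semigroup h0.le,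
    Method.symOp_aSym, Finset.sum_sub_distrib, Method.Psi]
  have e : ∑ j ∈ Finset.Ico 2 i, (h a ^ 2 * (M.α j 1 ^ 2 * M.P j 1 ^ 2 / 2)) •
        M.a (S a) (h a) i j (D a ![u₁ a, u₁ a])
      = (h a ^ 2 * (1 / 2)) • ∑ j ∈ Finset.Ico 2 i, (M.α j 1 ^ 2 * M.P j 1 ^ 2) •
        M.a (S a) (h a) i j (D a ![u₁ a, u₁ a]) := by
    rw [Finset.smul_sum]
    refine Finset.sum_congr rfl fun j _ => ?_
    module
  have e' : ∀ j, M.a (S a) (h a) i j (R a (M.stage (S a) (h a) (u₁ a) (R a) (v a) j) - R a (v a))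
      = M.a (S a) (h a) i j (R a (M.stage (S a) (h a) (u₁ a) (R a) (v a) j))
        - M.a (S a) (h a) i j (R a (v a)) := fun j => by
    simp only [← Method.symOp_aSym, symOp_map_sub hAa.semigroup h0.le]
  simp only [e', Finset.sum_sub_distrib, e, Pi.smul_apply]
  module

/-- Expansion of the residual `R(v + w) - R(v)` for an increment `w = h x₁ + h² x₂ + h³ x₃ + …`. -/
theorem residual_expansion (hh : h =O[l] fun _ => (1 : ℝ)) {R : α → X → X}
    {D₂ : α → X [×2]→L[ℝ] X} {D₃ : α → X [×3]→L[ℝ] X} {D₄ : α → X [×4]→L[ℝ] X}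
    (hD₂ : D₂ =O[l] fun _ => (1 : ℝ)) (hD₃ : D₃ =O[l] fun _ => (1 : ℝ))
    (hD₄ : D₄ =O[l] fun _ => (1 : ℝ))
    (hs₂ : ∀ᶠ a in l, ∀ x y, D₂ a ![x, y] = D₂ a ![y, x])
    (hs₃ : ∀ᶠ a in l, ∀ x y z, D₃ a ![x, y, z] = D₃ a ![y, x, z])
    (hs₃' : ∀ᶠ a in l, ∀ x y z, D₃ a ![x, y, z] = D₃ a ![x, z, y])
    {v w x₁ x₂ x₃ : α → X} (h₁ : x₁ =O[l] fun _ => (1 : ℝ)) (h₂ : x₂ =O[l] fun _ => (1 : ℝ))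
    (h₃ : x₃ =O[l] fun _ => (1 : ℝ))
    (hR : ∀ w : α → X, w =O[l] (fun a => h a ^ 1) →
      (fun a => R a (v a + w a) - R a (v a) - ((1 / 2 : ℝ) • D₂ a ![w a, w a]
        + (1 / 6 : ℝ) • D₃ a ![w a, w a, w a] + (1 / 24 : ℝ) • D₄ a ![w a, w a, w a, w a]))
        =O[l] fun a => h a ^ 5)
    (hw : (fun a => w a - (h a • x₁ a + h a ^ 2 • x₂ a + h a ^ 3 • x₃ a))
      =O[l] fun a => h a ^ 4) :
    (fun a => R a (v a + w a) - R a (v a) - ((h a ^ 2 / 2) • D₂ a ![x₁ a, x₁ a]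
      + h a ^ 3 • D₂ a ![x₁ a, x₂ a] + (h a ^ 3 / 6) • D₃ a ![x₁ a, x₁ a, x₁ a]
      + h a ^ 4 • D₂ a ![x₁ a, x₃ a] + (h a ^ 4 / 2) • D₂ a ![x₂ a, x₂ a]
      + (h a ^ 4 / 2) • D₃ a ![x₁ a, x₁ a, x₂ a]
      + (h a ^ 4 / 24) • D₄ a ![x₁ a, x₁ a, x₁ a, x₁ a])) =O[l] fun a => h a ^ 5 := by
  have z : ∀ {x : α → X}, x =O[l] (fun _ => (1 : ℝ)) → x =O[l] fun a => h a ^ 0 := by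
    intro x hx; simpa using hx
  have hw₃ : (fun a => w a - (h a • x₁ a + h a ^ 2 • x₂ a)) =O[l] fun a => h a ^ 3 := by
    refine ((IsBigO.mono_pow hh (by norm_num : 3 ≤ 4) hw).add
      (isBigO_pow_smul 3 (z h₃))).congr_left fun a => ?_
    abel
  have hw₂ : (fun a => w a - h a • x₁ a) =O[l] fun a => h a ^ 2 := by
    refine ((IsBigO.mono_pow hh (by norm_num : 2 ≤ 3) hw₃).add
      (isBigO_pow_smul 2 (z h₂))).congr_left fun a => ?_
    abel
  have hwO : w =O[l] fun a => h a ^ 1 :=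
    isBigO_of_sub hh hw₂ (n := 1) (by simpa using isBigO_pow_smul 1 (z h₁)) (by norm_num) le_rfl
  have q₂ := (quadratic_expansion hh hD₂ h₁ h₂ h₃ hw).const_smul_left (1 / 2 : ℝ)
  have q₃ := (cubic_expansion hh hD₃ h₁ h₂ hw₃).const_smul_left (1 / 6 : ℝ)
  have q₄ := (quartic_expansion hh hD₄ h₁ hw₂).const_smul_left (1 / 24 : ℝ)
  refine ((((hR w hwO).add q₂).add q₃).add q₄).congr' ?_ EventuallyEq.rfl
  filter_upwards [hs₂, hs₃, hs₃'] with a s₂ s₃ s₃'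
  simp only [Pi.smul_apply]
  -- Symmetry merges the mixed terms: two copies against `1/2`, three against `1/6`.
  rw [s₂ (x₂ a) (x₁ a), s₂ (x₃ a) (x₁ a), s₃ (x₂ a) (x₁ a) (x₁ a), s₃' (x₁ a) (x₂ a) (x₁ a)]
  module

end Asymptotic

end StiffEPIRK

namespace StiffEPIRK

variable {X : Type*} [NormedAddCommGroup X] [NormedSpace ℝ X]

/-! ### Uniformity along the solution -/

open Asymptotics

/-- The filter of pairs `(h, t)` with `h ↓ 0`, uniformly in `t ∈ I`, subject to `(h, t) ∈ Q`. -/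
def stepFilter (I : Set ℝ) (Q : Set (ℝ × ℝ)) : Filter (ℝ × ℝ) := (𝓝[>] 0 ×ˢ 𝓟 I) ⊓ 𝓟 Q

theorem eventually_stepFilter {I : Set ℝ} {Q : Set (ℝ × ℝ)} {P : ℝ × ℝ → Prop} :
    (∀ᶠ a in stepFilter I Q, P a) ↔
      ∃ h₀, 0 < h₀ ∧ ∀ t ∈ I, ∀ h, 0 < h → h ≤ h₀ → (h, t) ∈ Q → P (h, t) := by
  rw [stepFilter, eventually_inf_principal, eventually_prod_principal_iff, Filter.Eventually,
    mem_nhdsGT_iff_exists_Ioc_subset]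
  constructor
  · rintro ⟨h₀, hpos, hsub⟩
    exact ⟨h₀, hpos, fun t ht h h0 h1 hQ => hsub ⟨h0, h1⟩ t ht hQ⟩
  · rintro ⟨h₀, hpos, H⟩
    exact ⟨h₀, hpos, fun h hh t ht hQ => H t ht h hh.1 hh.2 hQ⟩

/-- Along this filter, big-O means precisely that `C` and `h₀` do not depend on `t`. -/
theorem isBigO_stepFilter {I : Set ℝ} {Q : Set (ℝ × ℝ)} {Y : Type*} [NormedAddCommGroup Y]
    {f : ℝ × ℝ → Y} {m : ℕ} :
    f =O[stepFilter I Q] (fun a => a.1 ^ m) ↔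
      ∃ C h₀ : ℝ, 0 < h₀ ∧ ∀ t ∈ I, ∀ h, 0 < h → h ≤ h₀ → (h, t) ∈ Q →
        ‖f (h, t)‖ ≤ C * h ^ m := by
  rw [isBigO_iff]
  refine exists_congr fun C => ?_
  rw [eventually_stepFilter]
  refine exists_congr fun h₀ => and_congr_right fun _ => ?_
  refine forall₅_congr fun t _ h h0 _ => ?_
  simp [abs_of_pos h0]

variable {I : Set ℝ} {Q : Set (ℝ × ℝ)}

theorem tendsto_fst_stepFilter : Tendsto Prod.fst (stepFilter I Q) (𝓝 (0 : ℝ)) :=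
  (tendsto_fst.mono_left inf_le_left).mono_right nhdsWithin_le_nhds

theorem eventually_mem_stepFilter : ∀ᶠ a in stepFilter I Q, 0 < a.1 ∧ a.1 ≤ 1 ∧ a.2 ∈ I ∧ a ∈ Q :=
  eventually_stepFilter.2 ⟨1, one_pos, fun _ ht _ h0 h1 hQ => ⟨h0, h1, ht, hQ⟩⟩

theorem isBigO_one_of_continuousOn {Y : Type*} [NormedAddCommGroup Y] {f : ℝ → Y}
    (hI : IsCompact I) (hf : ContinuousOn f I) :
    (fun a : ℝ × ℝ => f a.2) =O[stepFilter I Q] fun _ => (1 : ℝ) := by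
  obtain ⟨C, hC⟩ := hI.exists_bound_of_continuousOn hf
  refine IsBigO.of_bound C ?_
  filter_upwards [eventually_mem_stepFilter] with a ha
  simpa using hC a.2 ha.2.2.1

theorem expSemigroup_isGenerator {A : X →ₗ.[ℝ] X} (hA : ∃ S, IsGenerator A S) :
    IsGenerator A (expSemigroup A) := by
  rw [expSemigroup, dif_pos hA]
  exact hA.choose_spec

theorem const_vec_two {Y : Type*} (w : Y) : (fun _ : Fin 2 => w) = ![w, w] := by
  ext i; fin_cases i <;> rfl

theorem const_vec_three {Y : Type*} (w : Y) : (fun _ : Fin 3 => w) = ![w, w, w] := by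
  ext i; fin_cases i <;> rfl

theorem const_vec_four {Y : Type*} (w : Y) : (fun _ : Fin 4 => w) = ![w, w, w, w] := by
  ext i; fin_cases i <;> rfl

section AlongSolution

variable [CompleteSpace X] {L : X →ₗ.[ℝ] X} {N : X → X} {t₀ T : ℝ} {u : ℝ → X} {δ : ℝ}

theorem continuousOn_iteratedFDeriv_comp (hδ : 0 < δ) (huc : ContinuousOn u (Icc t₀ T)) {n : ℕ}
    (hN : ContDiffOn ℝ n N (strip t₀ T u δ)) {k : ℕ} (hk : k ≤ n) :
    ContinuousOn (fun t => iteratedFDeriv ℝ k N (u t)) (Icc t₀ T) := by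
  intro t ht
  have h1 := (contDiffAt_of_strip hδ hN ht).iteratedFDeriv_right (i := k) (m := 0)
    (by rw [zero_add]; exact_mod_cast hk)
  exact h1.continuousAt.comp_continuousWithinAt (f := u) (huc t ht)

/-- The norm of `N'(u(t))` is bounded on the compact interval, so one perturbation estimate covers
every `t`. Uniqueness identifies the semigroup selected by choice with the one for which the bound
was proved. -/
theorem exists_expJ_bound (hL : ∃ S : ℝ → X →L[ℝ] X, IsGenerator L S) (hδ : 0 < δ)
    (huc : ContinuousOn u (Icc t₀ T)) (hN : ContDiffOn ℝ 1 N (strip t₀ T u δ)) :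
    ∃ C ω : ℝ, 0 ≤ ω ∧ ∀ t ∈ Icc t₀ T,
      IsGenerator (jacobian L N (u t)) (Method.expJ L N u t) ∧
      ∀ s, 0 ≤ s → ‖Method.expJ L N u t s‖ ≤ C * Real.exp (ω * s) := by
  obtain ⟨S, hS⟩ := hL
  have hc : ContinuousOn (fun t => fderiv ℝ N (u t)) (Icc t₀ T) := by
    intro t ht
    have h1 := (contDiffAt_of_strip hδ hN ht).fderiv_right (m := 0) (by norm_num)
    exact h1.continuousAt.comp_continuousWithinAt (f := u) (huc t ht)
  obtain ⟨R, hR⟩ := isCompact_Icc.exists_bound_of_continuousOn hc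
  obtain ⟨C, ω, hω, H⟩ := hS.exists_vadd R
  refine ⟨C, ω, hω, fun t ht => ?_⟩
  obtain ⟨W, hW, hb⟩ := H (fderiv ℝ N (u t)) (hR t ht)
  have hg : IsGenerator (jacobian L N (u t)) (Method.expJ L N u t) :=
    expSemigroup_isGenerator ⟨W, hW⟩
  refine ⟨hg, fun s hs => ?_⟩
  rw [hg.semigroup_unique hW hs]
  exact hb s hs

theorem uniformFamily_expJ {C ω : ℝ} (hω : 0 ≤ ω) (H : ∀ t ∈ I,
      IsGenerator (jacobian L N (u t)) (Method.expJ L N u t) ∧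
      ∀ s, 0 ≤ s → ‖Method.expJ L N u t s‖ ≤ C * Real.exp (ω * s)) :
    UniformFamily (stepFilter I Q) Prod.fst (fun a => Method.expJ L N u a.2) where
  pos := eventually_mem_stepFilter.mono fun _ ha => ha.1
  le_one := eventually_mem_stepFilter.mono fun _ ha => ha.2.1
  semigroup := eventually_mem_stepFilter.mono fun a ha => (H a.2 ha.2.2.1).1.semigroup
  bound := ⟨C, ω, hω, eventually_mem_stepFilter.mono fun a ha => (H a.2 ha.2.2.1).2⟩

/-- Increments of order `h` eventually lie in the radius where the uniform Taylor bound holds. -/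
theorem taylor_isBigO (hδ : 0 < δ) (huc : ContinuousOn u (Icc t₀ T)) {n : ℕ}
    (hN : ContDiffOn ℝ (n + 1) N (strip t₀ T u δ)) {w : ℝ × ℝ → X}
    (hw : w =O[stepFilter (Icc t₀ T) Q] fun a => a.1 ^ 1) :
    (fun a => N (u a.2 + w a) - ∑ k ∈ Finset.range (n + 1),
      (k.factorial : ℝ)⁻¹ • iteratedFDeriv ℝ k N (u a.2) (fun _ => w a))
      =O[stepFilter (Icc t₀ T) Q] fun a => a.1 ^ (n + 1) := by
  obtain ⟨ε, hε, C, hC⟩ := exists_taylor_bound (isCompact_Icc.image_of_continuousOn huc)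
    (isOpen_strip t₀ T δ u) (subset_strip hδ u) hN
  have h0 : Tendsto w (stepFilter (Icc t₀ T) Q) (𝓝 0) := by
    refine hw.trans_tendsto ?_
    simpa using tendsto_fst_stepFilter (I := Icc t₀ T) (Q := Q)
  have hsmall : ∀ᶠ a in stepFilter (Icc t₀ T) Q, ‖w a‖ ≤ ε := by
    have := h0.norm
    rw [norm_zero] at this
    exact (this.eventually_lt_const hε).mono fun a ha => le_of_lt ha
  have h1 : (fun a => ‖w a‖ ^ (n + 1)) =O[stepFilter (Icc t₀ T) Q] fun a => a.1 ^ (n + 1) := by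
    simpa using hw.norm_left.pow (n + 1)
  refine IsBigO.trans (IsBigO.of_bound C ?_) h1
  filter_upwards [hsmall, eventually_mem_stepFilter] with a ha hm
  rw [Real.norm_of_nonneg (by positivity)]
  exact hC (u a.2) (mem_image_of_mem u hm.2.2.1) (w a) ha

theorem Ntilde_taylor_three (hδ : 0 < δ) (huc : ContinuousOn u (Icc t₀ T))
    (hN : ContDiffOn ℝ 3 N (strip t₀ T u δ)) (w : ℝ × ℝ → X)
    (hw : w =O[stepFilter (Icc t₀ T) Q] fun a => a.1 ^ 1) :
    (fun a => Ntilde N (u a.2) (u a.2 + w a) - Ntilde N (u a.2) (u a.2)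
      - (1 / 2 : ℝ) • iteratedFDeriv ℝ 2 (Ntilde N (u a.2)) (u a.2) ![w a, w a])
      =O[stepFilter (Icc t₀ T) Q] fun a => a.1 ^ 3 := by
  refine (taylor_isBigO (n := 2) hδ huc (by norm_num; exact hN) hw).congr' ?_ EventuallyEq.rfl
  filter_upwards [eventually_mem_stepFilter] with a hm
  have hat := contDiffAt_of_strip hδ hN hm.2.2.1
  rw [iteratedFDeriv_Ntilde (k := 0) (hat.of_le (by norm_num)), Ntilde_sub_eq]
  simp only [Finset.sum_range_succ, Finset.sum_range_zero, iteratedFDeriv_zero_apply,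
    iteratedFDeriv_one_apply, const_vec_two, Nat.factorial, zero_add]
  norm_num
  module

theorem Ntilde_taylor_five (hδ : 0 < δ) (huc : ContinuousOn u (Icc t₀ T))
    (hN : ContDiffOn ℝ 5 N (strip t₀ T u δ)) (w : ℝ × ℝ → X)
    (hw : w =O[stepFilter (Icc t₀ T) Q] fun a => a.1 ^ 1) :
    (fun a => Ntilde N (u a.2) (u a.2 + w a) - Ntilde N (u a.2) (u a.2)
      - ((1 / 2 : ℝ) • iteratedFDeriv ℝ 2 (Ntilde N (u a.2)) (u a.2) ![w a, w a]
        + (1 / 6 : ℝ) • iteratedFDeriv ℝ 3 (Ntilde N (u a.2)) (u a.2) ![w a, w a, w a]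
        + (1 / 24 : ℝ) • iteratedFDeriv ℝ 4 (Ntilde N (u a.2)) (u a.2) ![w a, w a, w a, w a]))
      =O[stepFilter (Icc t₀ T) Q] fun a => a.1 ^ 5 := by
  refine (taylor_isBigO (n := 4) hδ huc (by norm_num; exact hN) hw).congr' ?_ EventuallyEq.rfl
  filter_upwards [eventually_mem_stepFilter] with a hm
  have hat := contDiffAt_of_strip hδ hN hm.2.2.1
  rw [iteratedFDeriv_Ntilde (k := 0) (hat.of_le (by norm_num)),
    iteratedFDeriv_Ntilde (k := 1) (hat.of_le (by norm_num)),
    iteratedFDeriv_Ntilde (k := 2) (hat.of_le (by norm_num)), Ntilde_sub_eq]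
  simp only [Finset.sum_range_succ, Finset.sum_range_zero, iteratedFDeriv_zero_apply,
    iteratedFDeriv_one_apply, const_vec_two, const_vec_three, const_vec_four, Nat.factorial,
    zero_add]
  norm_num
  module

theorem isBigO_iteratedFDeriv_Ntilde (hδ : 0 < δ) (huc : ContinuousOn u (Icc t₀ T)) {n : ℕ}
    (hN : ContDiffOn ℝ n N (strip t₀ T u δ)) {k : ℕ} (hk : k + 2 ≤ n) :
    (fun a : ℝ × ℝ => iteratedFDeriv ℝ (k + 2) (Ntilde N (u a.2)) (u a.2))
      =O[stepFilter (Icc t₀ T) Q] fun _ => (1 : ℝ) := by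
  refine (isBigO_one_of_continuousOn isCompact_Icc
    (continuousOn_iteratedFDeriv_comp hδ huc hN hk)).congr' ?_ EventuallyEq.rfl
  filter_upwards [eventually_mem_stepFilter] with a hm
  exact (iteratedFDeriv_Ntilde ((contDiffAt_of_strip hδ hN hm.2.2.1).of_le
    (by exact_mod_cast hk))).symm

theorem isBigO_iteratedDerivWithin (hT : t₀ < T) {n : ℕ} (hu : ContDiffOn ℝ n u (Icc t₀ T))
    {k : ℕ} (hk : k ≤ n) :
    (fun a : ℝ × ℝ => iteratedDerivWithin k u (Icc t₀ T) a.2)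
      =O[stepFilter (Icc t₀ T) Q] fun _ => (1 : ℝ) :=
  isBigO_one_of_continuousOn isCompact_Icc
    (hu.continuousOn_iteratedDerivWithin (by exact_mod_cast hk) (uniqueDiffOn_Icc hT))

end AlongSolution

end StiffEPIRK

namespace StiffEPIRK

variable {X : Type*} [NormedAddCommGroup X] [NormedSpace ℝ X]

open Asymptotics

/-! ### One step of the method and of the exact flow -/

section OneStep

variable [CompleteSpace X] {L : X →ₗ.[ℝ] X} {N : X → X} {t₀ T : ℝ} {u₀ : X} {u : ℝ → X} {δ : ℝ}
  {Q : Set (ℝ × ℝ)}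

theorem Method.Uhat_expansion (M : Method) (hL : ∃ S : ℝ → X →L[ℝ] X, IsGenerator L S)
    (hT : t₀ < T) (hu : IsSolution L N t₀ T u₀ u) (hus : ContDiffOn ℝ 4 u (Icc t₀ T))
    (hδ : 0 < δ) (hN : ContDiffOn ℝ 3 N (strip t₀ T u δ)) (i : ℕ) :
    (fun a : ℝ × ℝ => M.Uhat L N u a.2 a.1 i - u a.2
      - (a.1 • ((M.α i 1 * M.P i 1) • iteratedDerivWithin 1 u (Icc t₀ T) a.2)
        + a.1 ^ 2 • ((M.α i 1 * M.g i 1 * M.P i 2) • iteratedDerivWithin 2 u (Icc t₀ T) a.2)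
        + a.1 ^ 3 • ((M.α i 1 * M.g i 1 ^ 2 * M.P i 3) • iteratedDerivWithin 3 u (Icc t₀ T) a.2
          + M.Psi (Method.expJ L N u a.2) a.1 i
            (iteratedFDeriv ℝ 2 (Ntilde N (u a.2)) (u a.2)
              ![iteratedDerivWithin 1 u (Icc t₀ T) a.2,
                iteratedDerivWithin 1 u (Icc t₀ T) a.2]))))
      =O[stepFilter (Icc t₀ T) Q] fun a => a.1 ^ 4 := by
  obtain ⟨C, ω, hω, H⟩ := exists_expJ_bound hL hδ hus.continuousOn (hN.of_le (by norm_num))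
  obtain ⟨S, hS⟩ := hL
  obtain ⟨u₄, ⟨C₄, hC₄⟩, hg⟩ := hu.jacobian_graph hS hT hus hδ hN
  have hm := eventually_mem_stepFilter (I := Icc t₀ T) (Q := Q)
  have key := M.stage_expansion (uniformFamily_expJ (Q := Q) hω H)
    (A := fun a => jacobian L N (u a.2)) (hm.mono fun a ha => (H a.2 ha.2.2.1).1)
    (u₁ := fun a => iteratedDerivWithin 1 u (Icc t₀ T) a.2)
    (u₂ := fun a => iteratedDerivWithin 2 u (Icc t₀ T) a.2)
    (u₃ := fun a => iteratedDerivWithin 3 u (Icc t₀ T) a.2)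
    (u₄ := fun a => u₄ a.2) (v := fun a => u a.2) (R := fun a => Ntilde N (u a.2))
    (D := fun a => iteratedFDeriv ℝ 2 (Ntilde N (u a.2)) (u a.2))
    (isBigO_iteratedDerivWithin (n := 4) hT hus (by norm_num))
    (isBigO_iteratedDerivWithin (n := 4) hT hus (by norm_num))
    (isBigO_iteratedDerivWithin (n := 4) hT hus (by norm_num))
    (IsBigO.of_bound C₄ (hm.mono fun a ha => by simpa using hC₄ a.2 ha.2.2.1))
    (isBigO_iteratedFDeriv_Ntilde (n := 3) (k := 0) hδ hus.continuousOn hN (by norm_num))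
    (hm.mono fun a ha => (hg a.2 ha.2.2.1).1)
    (hm.mono fun a ha => by
      rw [iteratedFDeriv_Ntilde (k := 0)
        ((contDiffAt_of_strip hδ hN ha.2.2.1).of_le (by norm_num))]
      exact (hg a.2 ha.2.2.1).2.1)
    (hm.mono fun a ha => (hg a.2 ha.2.2.1).2.2)
    (Ntilde_taylor_three hδ hus.continuousOn hN) i
  refine key.congr' ?_ EventuallyEq.rfl
  filter_upwards [hm] with a ha
  rw [Method.Uhat, hu.rhs_eq hT ha.2.2.1]

/-- The exact solution in terms of the semigroup of the linearized problem. -/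
theorem IsSolution.step_eq (hu : IsSolution L N t₀ T u₀ u) (hδ : 0 < δ)
    (hN : ContDiffOn ℝ 1 N (strip t₀ T u δ)) {t : ℝ} (ht : t ∈ Icc t₀ T) {S : ℝ → X →L[ℝ] X}
    (hJ : IsGenerator (jacobian L N (u t)) S) {h : ℝ} (hh : 0 ≤ h) (hth : t + h ≤ T)
    (c₂ c₃ c₄ : X) :
    u (t + h) - u t - (h • phi S 1 h (rhs L N (u t)) + h ^ 3 • phi S 3 h c₂
        + h ^ 4 • phi S 4 h c₃ + h ^ 5 • phi S 5 h c₄)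
      = ∫ τ in (0 : ℝ)..h, S (h - τ) (Ntilde N (u t) (u (t + τ)) - Ntilde N (u t) (u t)
          - ((τ ^ 2 / 2) • c₂ + (τ ^ 3 / 6) • c₃ + (τ ^ 4 / 24) • c₄)) := by
  have hmem : ∀ τ ∈ Icc 0 h, t + τ ∈ Icc t₀ T := fun τ hτ =>
    ⟨by linarith [ht.1, hτ.1], by linarith [hτ.2]⟩
  have huc : ContinuousOn (fun τ => u (t + τ)) (Icc 0 h) := by
    intro τ hτ
    exact ((hu.hasDeriv _ (hmem τ hτ)).continuousWithinAt).comp (f := fun τ => t + τ)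
      (by fun_prop) hmem
  have hNc : ContinuousOn (fun τ => N (u (t + τ))) (Icc 0 h) := by
    intro τ hτ
    exact ((contDiffAt_of_strip hδ hN (hmem τ hτ)).continuousAt).comp_continuousWithinAt
      (f := fun τ => u (t + τ)) (huc τ hτ)
  have hRc : ContinuousOn (fun τ => Ntilde N (u t) (u (t + τ)) - Ntilde N (u t) (u t))
      (Icc 0 h) := by
    simp only [Ntilde]
    exact (hNc.sub ((fderiv ℝ N (u t)).continuous.comp_continuousOn huc)).sub continuousOn_const
  have voc := hJ.variation_of_constants hh (w := fun τ => u (t + τ) - u t)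
    (F := fun τ => rhs L N (u t) + (Ntilde N (u t) (u (t + τ)) - Ntilde N (u t) (u t)))
    (huc.sub continuousOn_const) (continuousOn_const.add hRc) (by
      intro τ hτ
      have hτm := hmem τ ⟨hτ.1.le, hτ.2.le⟩
      -- This is `J̃` applied to `u(t+τ) - u(t)`: the `L`-part is read off from the equation at the
      -- two times.
      refine ⟨rhs L N (u (t + τ)) - N (u (t + τ)) - (rhs L N (u t) - N (u t))
        + fderiv ℝ N (u t) (u (t + τ) - u t), mem_graph_vadd_iff.2 ?_, ?_⟩
      · rw [add_sub_cancel_right]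
        exact L.graph.sub_mem (hu.mem_graph hτm) (hu.mem_graph ht)
      · have h1 : HasDerivWithinAt u (rhs L N (u (t + τ))) (Ioi (t + τ)) (t + τ) := by
          refine (hu.hasDeriv _ hτm).mono_of_mem_nhdsWithin ?_
          filter_upwards [Ioc_mem_nhdsGT (show t + τ < T by linarith [hτ.2])] with r hr
          exact ⟨by linarith [hτm.1, hr.1], hr.2⟩
        have h2 : HasDerivWithinAt (fun s : ℝ => t + s) 1 (Ioi τ) τ :=
          ((hasDerivAt_id τ).const_add t).hasDerivWithinAt
        have h3 := h1.scomp τ h2 (fun r hr => by simpa using hr)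
        rw [one_smul] at h3
        refine (h3.sub_const (u t)).congr_deriv ?_
        simp only [Ntilde, map_sub]
        abel)
  have hS := hJ.semigroup
  have ii : ∀ {F : ℝ → X}, ContinuousOn F (Icc 0 h) → IntervalIntegrable
      (fun τ => S (h - τ) (F τ)) MeasureTheory.volume 0 h := by
    intro F hF
    refine ContinuousOn.intervalIntegrable ?_
    rw [uIcc_of_le hh]
    exact hS.continuousOn_apply (by fun_prop) hF fun τ hτ => by linarith [hτ.2]
  have p0 := integral_pow_eq_phi S 0 hh (rhs L N (u t))
  have p2 := integral_pow_eq_phi S 2 hh c₂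
  have p3 := integral_pow_eq_phi S 3 hh c₃
  have p4 := integral_pow_eq_phi S 4 hh c₄
  norm_num [Nat.factorial] at p0 p2 p3 p4
  simp only [add_zero, sub_self, map_zero, zero_add, map_add] at voc
  rw [intervalIntegral.integral_add (ii continuousOn_const) (ii hRc), p0] at voc
  simp only [map_sub, map_add, map_smul] at voc ⊢
  have i2 := ii (F := fun τ => (τ ^ 2 / 2) • c₂) (by fun_prop)
  have i3 := ii (F := fun τ => (τ ^ 3 / 6) • c₃) (by fun_prop)
  have i4 := ii (F := fun τ => (τ ^ 4 / 24) • c₄) (by fun_prop)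
  have iR := ii hRc
  simp only [map_smul, map_sub] at i2 i3 i4 iR
  rw [intervalIntegral.integral_sub iR ((i2.add i3).add i4),
    intervalIntegral.integral_add (i2.add i3) i4, intervalIntegral.integral_add i2 i3, p2, p3, p4,
    voc]
  abel

theorem residual_expansion_along (hδ : 0 < δ) (huc : ContinuousOn u (Icc t₀ T))
    (hN : ContDiffOn ℝ 5 N (strip t₀ T u δ)) {w x₁ x₂ x₃ : ℝ × ℝ → X}
    (h₁ : x₁ =O[stepFilter (Icc t₀ T) Q] fun _ => (1 : ℝ))
    (h₂ : x₂ =O[stepFilter (Icc t₀ T) Q] fun _ => (1 : ℝ))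
    (h₃ : x₃ =O[stepFilter (Icc t₀ T) Q] fun _ => (1 : ℝ))
    (hw : (fun a => w a - (a.1 • x₁ a + a.1 ^ 2 • x₂ a + a.1 ^ 3 • x₃ a))
      =O[stepFilter (Icc t₀ T) Q] fun a => a.1 ^ 4) :
    (fun a => Ntilde N (u a.2) (u a.2 + w a) - Ntilde N (u a.2) (u a.2)
      - ((a.1 ^ 2 / 2) • iteratedFDeriv ℝ 2 (Ntilde N (u a.2)) (u a.2) ![x₁ a, x₁ a]
      + a.1 ^ 3 • iteratedFDeriv ℝ 2 (Ntilde N (u a.2)) (u a.2) ![x₁ a, x₂ a]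
      + (a.1 ^ 3 / 6) • iteratedFDeriv ℝ 3 (Ntilde N (u a.2)) (u a.2) ![x₁ a, x₁ a, x₁ a]
      + a.1 ^ 4 • iteratedFDeriv ℝ 2 (Ntilde N (u a.2)) (u a.2) ![x₁ a, x₃ a]
      + (a.1 ^ 4 / 2) • iteratedFDeriv ℝ 2 (Ntilde N (u a.2)) (u a.2) ![x₂ a, x₂ a]
      + (a.1 ^ 4 / 2) • iteratedFDeriv ℝ 3 (Ntilde N (u a.2)) (u a.2) ![x₁ a, x₁ a, x₂ a]
      + (a.1 ^ 4 / 24) • iteratedFDeriv ℝ 4 (Ntilde N (u a.2)) (u a.2)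
          ![x₁ a, x₁ a, x₁ a, x₁ a])) =O[stepFilter (Icc t₀ T) Q] fun a => a.1 ^ 5 := by
  have hm := eventually_mem_stepFilter (I := Icc t₀ T) (Q := Q)
  have hh : (fun a : ℝ × ℝ => a.1) =O[stepFilter (Icc t₀ T) Q] fun _ => (1 : ℝ) :=
    IsBigO.of_bound 1 (hm.mono fun a ha => by
      rw [Real.norm_of_nonneg ha.1.le]; simpa using ha.2.1)
  have hat : ∀ᶠ a in stepFilter (Icc t₀ T) Q, ContDiffAt ℝ 3 (Ntilde N (u a.2)) (u a.2) :=
    hm.mono fun a ha => ((contDiffAt_of_strip hδ hN ha.2.2.1).of_le (by norm_num)).sub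
      (fderiv ℝ N (u a.2)).contDiff.contDiffAt
  exact residual_expansion (l := stepFilter (Icc t₀ T) Q) (h := fun a => a.1)
    (v := fun a => u a.2) (R := fun a => Ntilde N (u a.2))
    (D₂ := fun a => iteratedFDeriv ℝ 2 (Ntilde N (u a.2)) (u a.2))
    (D₃ := fun a => iteratedFDeriv ℝ 3 (Ntilde N (u a.2)) (u a.2))
    (D₄ := fun a => iteratedFDeriv ℝ 4 (Ntilde N (u a.2)) (u a.2)) hh
    (isBigO_iteratedFDeriv_Ntilde (n := 5) (k := 0) hδ huc hN (by norm_num))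
    (isBigO_iteratedFDeriv_Ntilde (n := 5) (k := 1) hδ huc hN (by norm_num))
    (isBigO_iteratedFDeriv_Ntilde (n := 5) (k := 2) hδ huc hN (by norm_num))
    (hat.mono fun a ha x y => iteratedFDeriv_two_swap (ha.of_le (by norm_num)) x y)
    (hat.mono fun a ha x y z => iteratedFDeriv_three_swap_left ha x y z)
    (hat.mono fun a ha x y z => iteratedFDeriv_three_swap_right ha x y z)
    h₁ h₂ h₃ (Ntilde_taylor_five hδ huc hN) hw

/-- The pairs `(h, t)` for which the step from `t` to `t + h` ends before time `T`. -/
def admissibleSteps (T : ℝ) : Set (ℝ × ℝ) := {a | a.2 + a.1 ≤ T}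

/-- The vectors `c_k` are the `k`-th derivatives of `τ ↦ Ñ(u(t+τ))` at `0`, without the terms killed
by `∂Ñ(ũ) = 0`; this explains the weights 3, 4, 3, 6. The residual error `O(τ⁵)` integrates to
`O(h⁶)`. -/
theorem IsSolution.step_expansion (hL : ∃ S : ℝ → X →L[ℝ] X, IsGenerator L S) (hT : t₀ < T)
    (hu : IsSolution L N t₀ T u₀ u) (hus : ContDiffOn ℝ 4 u (Icc t₀ T)) (hδ : 0 < δ)
    (hN : ContDiffOn ℝ 5 N (strip t₀ T u δ)) {c₂ c₃ c₄ : ℝ → X}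
    (hc₂ : ∀ t, c₂ t = iteratedFDeriv ℝ 2 (Ntilde N (u t)) (u t)
      ![iteratedDerivWithin 1 u (Icc t₀ T) t, iteratedDerivWithin 1 u (Icc t₀ T) t])
    (hc₃ : ∀ t, c₃ t = (3 : ℝ) • iteratedFDeriv ℝ 2 (Ntilde N (u t)) (u t)
        ![iteratedDerivWithin 1 u (Icc t₀ T) t, iteratedDerivWithin 2 u (Icc t₀ T) t]
      + iteratedFDeriv ℝ 3 (Ntilde N (u t)) (u t) ![iteratedDerivWithin 1 u (Icc t₀ T) t,
        iteratedDerivWithin 1 u (Icc t₀ T) t, iteratedDerivWithin 1 u (Icc t₀ T) t])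
    (hc₄ : ∀ t, c₄ t = (4 : ℝ) • iteratedFDeriv ℝ 2 (Ntilde N (u t)) (u t)
        ![iteratedDerivWithin 1 u (Icc t₀ T) t, iteratedDerivWithin 3 u (Icc t₀ T) t]
      + (3 : ℝ) • iteratedFDeriv ℝ 2 (Ntilde N (u t)) (u t)
        ![iteratedDerivWithin 2 u (Icc t₀ T) t, iteratedDerivWithin 2 u (Icc t₀ T) t]
      + (6 : ℝ) • iteratedFDeriv ℝ 3 (Ntilde N (u t)) (u t)
        ![iteratedDerivWithin 1 u (Icc t₀ T) t, iteratedDerivWithin 1 u (Icc t₀ T) t,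
          iteratedDerivWithin 2 u (Icc t₀ T) t]
      + iteratedFDeriv ℝ 4 (Ntilde N (u t)) (u t)
        ![iteratedDerivWithin 1 u (Icc t₀ T) t, iteratedDerivWithin 1 u (Icc t₀ T) t,
          iteratedDerivWithin 1 u (Icc t₀ T) t, iteratedDerivWithin 1 u (Icc t₀ T) t]) :
    (fun a : ℝ × ℝ => u (a.2 + a.1) - u a.2
      - (a.1 • phi (Method.expJ L N u a.2) 1 a.1 (rhs L N (u a.2))
        + a.1 ^ 3 • phi (Method.expJ L N u a.2) 3 a.1 (c₂ a.2)
        + a.1 ^ 4 • phi (Method.expJ L N u a.2) 4 a.1 (c₃ a.2)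
        + a.1 ^ 5 • phi (Method.expJ L N u a.2) 5 a.1 (c₄ a.2)))
      =O[stepFilter (Icc t₀ T) (admissibleSteps T)] fun a => a.1 ^ 6 := by
  obtain ⟨C, ω, hω, H⟩ := exists_expJ_bound hL hδ hus.continuousOn (hN.of_le (by norm_num))
  have hx : ∀ k ≤ 4, (fun a : ℝ × ℝ => iteratedDerivWithin k u (Icc t₀ T) a.2)
      =O[stepFilter (Icc t₀ T) (admissibleSteps T)] fun _ => (1 : ℝ) := fun k hk =>
    isBigO_iteratedDerivWithin (n := 4) hT hus hk
  obtain ⟨CT, hCT⟩ := exists_taylor_three_bound hT hus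
  have hres := residual_expansion_along (Q := admissibleSteps T) hδ hus.continuousOn hN
    (w := fun a => u (a.2 + a.1) - u a.2) (hx 1 (by norm_num))
    ((hx 2 (by norm_num)).const_smul_left (1 / 2 : ℝ))
    ((hx 3 (by norm_num)).const_smul_left (1 / 6 : ℝ))
    (isBigO_stepFilter.2 ⟨CT, 1, one_pos, fun t ht τ h0 _ hQ => by
      convert hCT t ht τ h0.le hQ using 3
      simp only [Pi.smul_apply]
      module⟩)
  -- Explicit constants are needed because the estimate is used at every intermediate time `τ ≤ h`
  -- under the integral.
  obtain ⟨C', h₀, hpos, hb⟩ := isBigO_stepFilter.1 hres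
  rw [isBigO_stepFilter]
  refine ⟨|C| * Real.exp ω * |C'|, min h₀ 1, by positivity, fun t ht h h0 h1 hQ => ?_⟩
  have hQ : t + h ≤ T := hQ
  have hle : h ≤ h₀ := h1.trans (min_le_left _ _)
  have hle1 : h ≤ 1 := h1.trans (min_le_right _ _)
  simp only
  rw [hu.step_eq hδ (hN.of_le (by norm_num)) ht (H t ht).1 h0.le hQ]
  have := intervalIntegral.norm_integral_le_of_norm_le_const (a := 0) (b := h)
    (C := |C| * Real.exp ω * |C'| * h ^ 5)
    (f := fun τ => Method.expJ L N u t (h - τ) (Ntilde N (u t) (u (t + τ)) - Ntilde N (u t) (u t)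
          - ((τ ^ 2 / 2) • c₂ t + (τ ^ 3 / 6) • c₃ t + (τ ^ 4 / 24) • c₄ t))) ?_
  · rw [sub_zero, abs_of_pos h0] at this
    refine this.trans (le_of_eq (by ring))
  · intro τ hτ
    rw [uIoc_of_le h0.le] at hτ
    have hτT : t + τ ≤ T := by linarith [hτ.2]
    have b1 := hb t ht τ hτ.1 (hτ.2.trans hle) hτT
    have e : u t + (u (t + τ) - u t) = u (t + τ) := by abel
    simp only [e] at b1
    have b2 : ‖Ntilde N (u t) (u (t + τ)) - Ntilde N (u t) (u t)
          - ((τ ^ 2 / 2) • c₂ t + (τ ^ 3 / 6) • c₃ t + (τ ^ 4 / 24) • c₄ t)‖ ≤ C' * τ ^ 5 := by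
      convert b1 using 3
      rw [hc₂, hc₃, hc₄]
      simp only [Pi.smul_apply, map_two_smul_left, map_two_smul_right, map_three_smul_trd]
      module
    have b3 : ‖Method.expJ L N u t (h - τ)‖ ≤ |C| * Real.exp ω := by
      refine ((H t ht).2 (h - τ) (by linarith [hτ.2])).trans ?_
      gcongr
      · exact le_abs_self C
      · nlinarith [hτ.1]
    calc _ ≤ (|C| * Real.exp ω) * (C' * τ ^ 5) :=
          (ContinuousLinearMap.le_opNorm_of_le _ b2).trans (by
            have : 0 ≤ C' * τ ^ 5 := (norm_nonneg _).trans b2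
            gcongr)
      _ ≤ (|C| * Real.exp ω) * (|C'| * h ^ 5) := by
          have := hτ.1.le
          have := hτ.2
          gcongr
          exact le_abs_self C'
      _ = _ := by ring

end OneStep

end StiffEPIRK

namespace StiffEPIRK

variable {X : Type*} [NormedAddCommGroup X] [NormedSpace ℝ X]

open Asymptotics

/-! ### The local error -/

section LocalError

variable [CompleteSpace X] {L : X →ₗ.[ℝ] X} {N : X → X} {t₀ T : ℝ} {u₀ : X} {u : ℝ → X} {δ : ℝ}

theorem phi_map_add {S : ℝ → X →L[ℝ] X} (hS : IsC0Semigroup S) {τ : ℝ}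
    (hτ : 0 ≤ τ) (k : ℕ) (x y : X) :
    phi S (k + 1) τ (x + y) = phi S (k + 1) τ x + phi S (k + 1) τ y := by
  simpa only [symOp_phiSym] using symOp_map_add hS hτ (phiSym k) x y

theorem phi_map_smul {S : ℝ → X →L[ℝ] X} (hS : IsC0Semigroup S) {τ : ℝ}
    (hτ : 0 ≤ τ) (k : ℕ) (c : ℝ) (x : X) :
    phi S (k + 1) τ (c • x) = c • phi S (k + 1) τ x := by
  simpa only [symOp_phiSym] using symOp_map_smul hS hτ (phiSym k) c x

/-- The stage increments are put into the residual expansion, `h b_i` is applied, and the exact step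
is subtracted. The cubic stage coefficient contains `Ψ_i`, so `D₂(x₁, x₃)` splits and produces the
last term of the principal part. -/
theorem Method.localError_expansion (M : Method) (hL : ∃ S : ℝ → X →L[ℝ] X, IsGenerator L S)
    (hT : t₀ < T) (hu : IsSolution L N t₀ T u₀ u) (hus : ContDiffOn ℝ 4 u (Icc t₀ T))
    (hδ : 0 < δ) (hN : ContDiffOn ℝ 5 N (strip t₀ T u δ)) :
    (fun a : ℝ × ℝ => M.localError L N u a.2 a.1
      - M.localErrorPrincipal (Method.expJ L N u a.2) a.1 (rhs L N (u a.2))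
        (iteratedDerivWithin 1 u (Icc t₀ T) a.2) (iteratedDerivWithin 2 u (Icc t₀ T) a.2)
        (iteratedDerivWithin 3 u (Icc t₀ T) a.2) (iteratedFDeriv ℝ 2 (Ntilde N (u a.2)) (u a.2))
        (iteratedFDeriv ℝ 3 (Ntilde N (u a.2)) (u a.2))
        (iteratedFDeriv ℝ 4 (Ntilde N (u a.2)) (u a.2)))
      =O[stepFilter (Icc t₀ T) (admissibleSteps T)] fun a => a.1 ^ 6 := by
  obtain ⟨C, ω, hω, H⟩ := exists_expJ_bound hL hδ hus.continuousOn (hN.of_le (by norm_num))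
  have UF := uniformFamily_expJ (Q := admissibleSteps T) hω H
  have hm := eventually_mem_stepFilter (I := Icc t₀ T) (Q := admissibleSteps T)
  have hx : ∀ k ≤ 4, (fun a : ℝ × ℝ => iteratedDerivWithin k u (Icc t₀ T) a.2)
      =O[stepFilter (Icc t₀ T) (admissibleSteps T)] fun _ => (1 : ℝ) := fun k hk =>
    isBigO_iteratedDerivWithin (n := 4) hT hus hk
  have hexact := hu.step_expansion hL hT hus hδ hN (fun _ => rfl) (fun _ => rfl) (fun _ => rfl)
  have hd : (fun a : ℝ × ℝ => iteratedFDeriv ℝ 2 (Ntilde N (u a.2)) (u a.2)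
      ![iteratedDerivWithin 1 u (Icc t₀ T) a.2, iteratedDerivWithin 1 u (Icc t₀ T) a.2])
      =O[stepFilter (Icc t₀ T) (admissibleSteps T)] fun _ => (1 : ℝ) := by
    have := isBigO_multilinear (h := fun a : ℝ × ℝ => a.1)
      (isBigO_iteratedFDeriv_Ntilde (Q := admissibleSteps T) (n := 5) (k := 0) hδ
        hus.continuousOn hN (by norm_num))
      (v := fun a => ![iteratedDerivWithin 1 u (Icc t₀ T) a.2,
        iteratedDerivWithin 1 u (Icc t₀ T) a.2]) ![0, 0] (by
      rw [Fin.forall_fin_two]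
      exact ⟨by simpa using hx 1 (by norm_num), by simpa using hx 1 (by norm_num)⟩)
    simpa using this
  have hres := fun i => residual_expansion_along (Q := admissibleSteps T) hδ hus.continuousOn hN
    ((hx 1 (by norm_num)).const_smul_left (M.α i 1 * M.P i 1))
    ((hx 2 (by norm_num)).const_smul_left (M.α i 1 * M.g i 1 * M.P i 2))
    (((hx 3 (by norm_num)).const_smul_left (M.α i 1 * M.g i 1 ^ 2 * M.P i 3)).add
      (UF.symOp_isBigO (M.PsiSym i) hd))
    (w := fun a => M.Uhat L N u a.2 a.1 i - u a.2) (by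
      simpa only [Pi.smul_apply, Method.symOp_PsiSym] using
        M.Uhat_expansion hL hT hu hus hδ (hN.of_le (by norm_num)) i)
  have hsum := isBigO_pow_smul 1 (IsBigO.fun_sum (s := Finset.Icc 2 M.s)
    fun i _ => UF.symOp_isBigO (M.bSym i) (hres i))
  refine (hsum.sub hexact).congr' ?_ EventuallyEq.rfl
  filter_upwards [hm] with a ha
  have hS := (H a.2 ha.2.2.1).1.semigroup
  have hh := ha.1.le
  simp only [Pi.smul_apply, add_sub_cancel, map_two_smul_left, map_two_smul_right,
    map_two_add_right, map_three_smul_fst, map_three_smul_snd, map_three_smul_trd,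
    map_four_smul_diag, symOp_map_add hS hh, symOp_map_sub hS hh, symOp_map_smul hS hh,
    Method.symOp_bSym, Method.symOp_PsiSym, phi_map_add hS hh, phi_map_smul hS hh,
    Method.localError, Method.uhatNext, Method.rhat, Method.localErrorPrincipal]
  have hbsub : ∀ i x y, M.b (Method.expJ L N u a.2) a.1 i (x - y)
      = M.b (Method.expJ L N u a.2) a.1 i x - M.b (Method.expJ L N u a.2) a.1 i y := fun i x y => by
    simp only [← Method.symOp_bSym, symOp_map_sub hS hh]
  simp only [hbsub, Nat.reduceAdd]
  set B := M.b (Method.expJ L N u a.2) a.1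
  set u₁ := iteratedDerivWithin 1 u (Icc t₀ T) a.2
  set u₂ := iteratedDerivWithin 2 u (Icc t₀ T) a.2
  set u₃ := iteratedDerivWithin 3 u (Icc t₀ T) a.2
  set D₂ := iteratedFDeriv ℝ 2 (Ntilde N (u a.2)) (u a.2)
  set D₃ := iteratedFDeriv ℝ 3 (Ntilde N (u a.2)) (u a.2)
  set D₄ := iteratedFDeriv ℝ 4 (Ntilde N (u a.2)) (u a.2)
  -- Each summand is first brought to a normal form with powers of `h` outside, so that the sum
  -- distributes and scalars can be collected.
  refine Eq.trans (congrArg₂ HSub.hSub (congrArg (HSMul.hSMul (a.1 ^ 1))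
    (Finset.sum_congr rfl fun i _ => (?_ : _ =
      B i (Ntilde N (u a.2) (M.Uhat L N u a.2 a.1 i)) - B i (Ntilde N (u a.2) (u a.2))
      - (a.1 ^ 2 • (M.α i 1 ^ 2 * M.P i 1 ^ 2 / 2) • B i (D₂ ![u₁, u₁])
        + a.1 ^ 3 • (M.α i 1 ^ 2 * M.g i 1 * M.P i 1 * M.P i 2) • B i (D₂ ![u₁, u₂])
        + a.1 ^ 3 • (M.α i 1 ^ 3 * M.P i 1 ^ 3 / 6) • B i (D₃ ![u₁, u₁, u₁])
        + a.1 ^ 4 • (M.α i 1 ^ 2 * M.g i 1 ^ 2 * M.P i 1 * M.P i 3) • B i (D₂ ![u₁, u₃])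
        + a.1 ^ 4 • (M.α i 1 ^ 2 * M.g i 1 ^ 2 * M.P i 2 ^ 2 / 2) • B i (D₂ ![u₂, u₂])
        + a.1 ^ 4 • (M.α i 1 ^ 3 * M.g i 1 * M.P i 1 ^ 2 * M.P i 2 / 2) •
          B i (D₃ ![u₁, u₁, u₂])
        + a.1 ^ 4 • (M.α i 1 ^ 4 * M.P i 1 ^ 4 / 24) • B i (D₄ ![u₁, u₁, u₁, u₁])
        + a.1 ^ 4 • (M.α i 1 * M.P i 1) •
          B i (D₂ ![u₁, M.Psi (Method.expJ L N u a.2) a.1 i (D₂ ![u₁, u₁])]))))) rfl) ?_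
  · module
  · simp only [Finset.sum_sub_distrib, Finset.sum_add_distrib, ← Finset.smul_sum]
    module

end LocalError

end StiffEPIRK

namespace StiffEPIRK

variable {X : Type*} [NormedAddCommGroup X] [NormedSpace ℝ X]

open Asymptotics

/-! ### The stiff order conditions -/

section OrderConditions

variable {α : Type*} {l : Filter α} {h : α → ℝ} {S : α → ℝ → X →L[ℝ] X}

/-- A term `h^m f` either has sufficient order already or is removed by an order condition; this
treats all orders `q` at once. -/
theorem isBigO_pow_smul_of_lt_imp (hh : h =O[l] fun _ => (1 : ℝ)) {f : α → X}
    (hf : f =O[l] fun _ => (1 : ℝ)) {m n : ℕ} (h0 : m < n → ∀ᶠ a in l, f a = 0) :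
    (fun a => h a ^ m • f a) =O[l] fun a => h a ^ n := by
  rcases lt_or_ge m n with hlt | hle
  · refine (isBigO_zero (fun a => h a ^ n) l).congr' ?_ EventuallyEq.rfl
    filter_upwards [h0 hlt] with a ha
    rw [ha, smul_zero]
  · exact IsBigO.mono_pow hh hle (isBigO_pow_smul m (n := 0) (by simpa using hf))

variable [CompleteSpace X]

/-- The factor `r` converts the order condition, stated with denominators cleared, to the
normalization of the error formula. -/
theorem UniformFamily.quadrature_isBigO (H : UniformFamily l h S) (M : Method) {x : α → X}
    (hx : x =O[l] fun _ => (1 : ℝ)) {c c' : ℕ → ℝ} {d d' : ℝ} {k m n : ℕ} (r : ℝ)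
    (hc : ∀ i, c' i = r * c i) (hd : d' = r * d)
    (hq : m < n → M.QuadratureCondition c d (k + 1)) :
    (fun a => h a ^ m • (∑ i ∈ Finset.Icc 2 M.s, c' i • M.b (S a) (h a) i (x a)
      - d' • phi (S a) (k + 1) (h a) (x a))) =O[l] fun a => h a ^ n := by
  refine isBigO_pow_smul_of_lt_imp H.step_isBigO ?_ fun hlt => ?_
  · refine (IsBigO.fun_sum fun i _ => ?_).sub ?_
    · simpa only [Method.symOp_bSym, Pi.smul_def] using
        (H.symOp_isBigO (M.bSym i) hx).const_smul_left (c' i)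
    · simpa only [symOp_phiSym, Pi.smul_def] using (H.symOp_isBigO (phiSym k) hx).const_smul_left d'
  · filter_upwards [H.pos, H.semigroup] with a h0 hS
    simp only [hc, hd, mul_smul, ← Finset.smul_sum, (hq hlt).apply hS h0.le, sub_self]

theorem UniformFamily.C0_isBigO (H : UniformFamily l h S) (M : Method) (hC : M.C0) {x : α → X}
    (n : ℕ) :
    (fun a => h a • (M.β 1 • M.psi (S a) (h a) (M.s + 1) 1 (x a) - phi (S a) 1 (h a) (x a)))
      =O[l] fun a => h a ^ n := by
  refine (isBigO_zero (fun a => h a ^ n) l).congr' ?_ EventuallyEq.rfl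
  filter_upwards [H.pos, H.semigroup] with a h0 hS
  rw [hC.apply hS h0.le, sub_self, smul_zero]

theorem UniformFamily.C8_isBigO (H : UniformFamily l h S) (M : Method)
    {D : α → X [×2]→L[ℝ] X} (hD : D =O[l] fun _ => (1 : ℝ)) {x y : α → X}
    (hx : x =O[l] fun _ => (1 : ℝ)) (hy : y =O[l] fun _ => (1 : ℝ)) {m n : ℕ}
    (hC : m < n → M.C8) :
    (fun a => h a ^ m • ∑ i ∈ Finset.Icc 2 M.s,
      (M.α i 1 * M.P i 1) • M.b (S a) (h a) i (D a ![x a, M.Psi (S a) (h a) i (y a)]))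
      =O[l] fun a => h a ^ n := by
  refine isBigO_pow_smul_of_lt_imp H.step_isBigO ?_ fun hlt => ?_
  · refine IsBigO.fun_sum fun i _ => ?_
    have h1 : (fun a => D a ![x a, M.Psi (S a) (h a) i (y a)]) =O[l] fun _ => (1 : ℝ) := by
      have := isBigO_multilinear (h := h) hD (v := fun a => ![x a, M.Psi (S a) (h a) i (y a)])
        ![0, 0] (by
          rw [Fin.forall_fin_two]
          exact ⟨by simpa using hx, by
            simpa [← Method.symOp_PsiSym] using H.symOp_isBigO (M.PsiSym i) hy⟩)
      simpa using this
    simpa only [Method.symOp_bSym, Pi.smul_def] using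
      (H.symOp_isBigO (M.bSym i) h1).const_smul_left (M.α i 1 * M.P i 1)
  · filter_upwards [H.pos, H.semigroup] with a h0 hS
    have e : ∀ z, (D a).toContinuousLinearMap ![x a, 0] 1 z = D a ![x a, z] := fun z => by
      simp only [ContinuousMultilinearMap.toContinuousLinearMap_apply]
      congr 1
      ext j
      fin_cases j <;> simp [Function.update]
    simpa only [e] using (hC hlt).apply hS h0.le ((D a).toContinuousLinearMap ![x a, 0] 1) (y a)

/-- For order `q` the terms with `m ≤ q` must cancel: `h³` needs (C1), `h⁴` also (C2) and (C3), `h⁵`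
all eight. The `h`-term always vanishes. -/
theorem Method.StiffOrder.principal_isBigO {M : Method} {q : ℕ} (hq : M.StiffOrder q) (hq2 : 2 ≤ q)
    (hq5 : q ≤ 5) (H : UniformFamily l h S) {F u₁ u₂ u₃ : α → X} {D₂ : α → X [×2]→L[ℝ] X}
    {D₃ : α → X [×3]→L[ℝ] X} {D₄ : α → X [×4]→L[ℝ] X}
    (hu₁ : u₁ =O[l] fun _ => (1 : ℝ)) (hu₂ : u₂ =O[l] fun _ => (1 : ℝ))
    (hu₃ : u₃ =O[l] fun _ => (1 : ℝ)) (hD₂ : D₂ =O[l] fun _ => (1 : ℝ))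
    (hD₃ : D₃ =O[l] fun _ => (1 : ℝ)) (hD₄ : D₄ =O[l] fun _ => (1 : ℝ)) :
    (fun a => M.localErrorPrincipal (S a) (h a) (F a) (u₁ a) (u₂ a) (u₃ a) (D₂ a) (D₃ a) (D₄ a))
      =O[l] fun a => h a ^ (q + 1) := by
  obtain ⟨c0, c1, c2, c4⟩ := hq
  have O : ∀ {k : ℕ} {D : α → X [×k]→L[ℝ] X} (_ : D =O[l] fun _ => (1 : ℝ)) (v : α → Fin k → X),
      (∀ j, (fun a => v a j) =O[l] fun _ => (1 : ℝ)) →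
      (fun a => D a (v a)) =O[l] fun _ => (1 : ℝ) := fun hD v hv => by
    simpa using isBigO_multilinear (h := h) hD (v := v) (fun _ => 0) (by simpa using hv)
  have d11 := O hD₂ (fun a => ![u₁ a, u₁ a])
    (fun j => by fin_cases j; exacts [hu₁, hu₁])
  have d12 := O hD₂ (fun a => ![u₁ a, u₂ a])
    (fun j => by fin_cases j; exacts [hu₁, hu₂])
  have d13 := O hD₂ (fun a => ![u₁ a, u₃ a])
    (fun j => by fin_cases j; exacts [hu₁, hu₃])
  have d22 := O hD₂ (fun a => ![u₂ a, u₂ a])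
    (fun j => by fin_cases j; exacts [hu₂, hu₂])
  have d111 := O hD₃ (fun a => ![u₁ a, u₁ a, u₁ a])
    (fun j => by fin_cases j; exacts [hu₁, hu₁, hu₁])
  have d112 := O hD₃ (fun a => ![u₁ a, u₁ a, u₂ a])
    (fun j => by fin_cases j; exacts [hu₁, hu₁, hu₂])
  have d1111 := O hD₄ (fun a => ![u₁ a, u₁ a, u₁ a, u₁ a])
    (fun j => by fin_cases j; exacts [hu₁, hu₁, hu₁, hu₁])
  have e1 := H.quadrature_isBigO M d11 (m := 3) (n := q + 1) (1 / 2)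
    (c' := fun i => M.α i 1 ^ 2 * M.P i 1 ^ 2 / 2) (d' := 1)
    (fun i => by ring) (by norm_num) fun hlt => c1 (by omega)
  have e2 := H.quadrature_isBigO M d12 (m := 4) (n := q + 1) 1
    (c' := fun i => M.α i 1 ^ 2 * M.g i 1 * M.P i 1 * M.P i 2) (d' := 3)
    (fun i => by ring) (by norm_num) fun hlt => (c2 (by omega)).1
  have e3 := H.quadrature_isBigO M d111 (m := 4) (n := q + 1) (1 / 6)
    (c' := fun i => M.α i 1 ^ 3 * M.P i 1 ^ 3 / 6) (d' := 1)
    (fun i => by ring) (by norm_num) fun hlt => (c2 (by omega)).2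
  have e4 := H.quadrature_isBigO M d13 (m := 5) (n := q + 1) 1
    (c' := fun i => M.α i 1 ^ 2 * M.g i 1 ^ 2 * M.P i 1 * M.P i 3) (d' := 4)
    (fun i => by ring) (by norm_num) fun hlt => (c4 (by omega)).1
  have e5 := H.quadrature_isBigO M d22 (m := 5) (n := q + 1) (1 / 2)
    (c' := fun i => M.α i 1 ^ 2 * M.g i 1 ^ 2 * M.P i 2 ^ 2 / 2) (d' := 3)
    (fun i => by ring) (by norm_num) fun hlt => (c4 (by omega)).2.1
  have e6 := H.quadrature_isBigO M d112 (m := 5) (n := q + 1) (1 / 2)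
    (c' := fun i => M.α i 1 ^ 3 * M.g i 1 * M.P i 1 ^ 2 * M.P i 2 / 2) (d' := 6)
    (fun i => by ring) (by norm_num) fun hlt => (c4 (by omega)).2.2.1
  have e7 := H.quadrature_isBigO M d1111 (m := 5) (n := q + 1) (1 / 24)
    (c' := fun i => M.α i 1 ^ 4 * M.P i 1 ^ 4 / 24) (d' := 1)
    (fun i => by ring) (by norm_num) fun hlt => (c4 (by omega)).2.2.2.1
  have e8 := H.C8_isBigO M hD₂ hu₁ d11 (m := 5) (n := q + 1)
    fun hlt => (c4 (by omega)).2.2.2.2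
  simpa only [Method.localErrorPrincipal, one_smul] using
    ((((((((H.C0_isBigO M c0 (x := F) (q + 1)).add e1).add e2).add e3).add e4).add e5).add e6).add
      e7).add e8

end OrderConditions

/-! ### Normalized stage increments. -/

section Stages

variable [CompleteSpace X] {L : X →ₗ.[ℝ] X} {N : X → X} {t₀ T : ℝ} {u₀ : X} {u : ℝ → X} {δ : ℝ}

theorem Method.V_expansion (M : Method) (hL : ∃ S : ℝ → X →L[ℝ] X, IsGenerator L S)
    (hT : t₀ < T) (hu : IsSolution L N t₀ T u₀ u) (hus : ContDiffOn ℝ 4 u (Icc t₀ T))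
    (hδ : 0 < δ) (hN : ContDiffOn ℝ 3 N (strip t₀ T u δ)) (i : ℕ) :
    ∃ C h₀ : ℝ, 0 < h₀ ∧ ∀ t ∈ Icc t₀ T, ∀ h : ℝ, 0 < h → h ≤ h₀ →
      ‖M.V L N u t h i -
        ((M.α i 1 * M.P i 1) • iteratedDerivWithin 1 u (Icc t₀ T) t
          + (h * (M.α i 1 * M.g i 1 * M.P i 2)) • iteratedDerivWithin 2 u (Icc t₀ T) t
          + (h ^ 2 * (M.α i 1 * M.g i 1 ^ 2 * M.P i 3)) • iteratedDerivWithin 3 u (Icc t₀ T) t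
          + h ^ 2 • M.Psi (Method.expJ L N u t) h i
              (iteratedFDeriv ℝ 2 (Ntilde N (u t)) (u t)
                ![iteratedDerivWithin 1 u (Icc t₀ T) t,
                  iteratedDerivWithin 1 u (Icc t₀ T) t]))‖ ≤ C * h ^ 3 := by
  obtain ⟨C, h₀, hpos, hb⟩ := isBigO_stepFilter.1
    (M.Uhat_expansion (Q := univ) hL hT hu hus hδ hN i)
  refine ⟨C, h₀, hpos, fun t ht h h0 h1 => ?_⟩
  have hne := h0.ne'
  -- Multiplying by `h` turns the claim into the `O(h⁴)` expansion of `Û_i - ũ`.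
  refine le_of_mul_le_mul_left ?_ h0
  calc _ = _ := by
        rw [← abs_of_pos h0, ← Real.norm_eq_abs, ← norm_smul, Real.norm_eq_abs, abs_of_pos h0]
    _ ≤ C * h ^ 4 := by
        convert hb t ht h h0 h1 (mem_univ _) using 2
        rw [Method.V, smul_sub, smul_inv_smul₀ hne]
        module
    _ = _ := by ring

end Stages

end StiffEPIRK

end

/-! ### The main theorem. -/

open StiffEPIRK in
theorem mainTheorem5 {X : Type*} [NormedAddCommGroup X] [NormedSpace ℝ X] [CompleteSpace X]
    (M : Method) (L : X →ₗ.[ℝ] X) (hL : ∃ S : ℝ → X →L[ℝ] X, IsGenerator L S)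
    (N : X → X) (t₀ T : ℝ) (hT : t₀ < T) (u₀ : X) (u : ℝ → X)
    (hu : IsSolution L N t₀ T u₀ u) (hu_smooth : ContDiffOn ℝ 4 u (Set.Icc t₀ T))
    (δ : ℝ) (hδ : 0 < δ) (hN_smooth : ContDiffOn ℝ 3 N (strip t₀ T u δ)) :
    -- every Jacobian along the solution generates a strongly continuous semigroup
    (∀ t ∈ Set.Icc t₀ T,
      IsGenerator (jacobian L N (u t)) (Method.expJ L N u t)) ∧
    -- the expansion of the normalized stage increments
    (∃ C h₀ : ℝ, 0 < h₀ ∧ ∀ t ∈ Set.Icc t₀ T, ∀ h : ℝ, 0 < h → h ≤ h₀ →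
      ∀ i ∈ Finset.Icc 2 M.s,
        ‖M.V L N u t h i -
          ((M.α i 1 * M.P i 1) • iteratedDerivWithin 1 u (Set.Icc t₀ T) t
            + (h * (M.α i 1 * M.g i 1 * M.P i 2)) • iteratedDerivWithin 2 u (Set.Icc t₀ T) t
            + (h ^ 2 * (M.α i 1 * M.g i 1 ^ 2 * M.P i 3)) •
                iteratedDerivWithin 3 u (Set.Icc t₀ T) t
            + h ^ 2 • M.Psi (Method.expJ L N u t) h i
                (iteratedFDeriv ℝ 2 (Ntilde N (u t)) (u t)
                  ![iteratedDerivWithin 1 u (Set.Icc t₀ T) t,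
                    iteratedDerivWithin 1 u (Set.Icc t₀ T) t]))‖ ≤ C * h ^ 3) ∧
    -- the local error formula and the stiff order conditions
    (ContDiffOn ℝ 5 u (Set.Icc t₀ T) → ContDiffOn ℝ 5 N (strip t₀ T u δ) →
      (∃ C h₀ : ℝ, 0 < h₀ ∧ ∀ t ∈ Set.Icc t₀ T, ∀ h : ℝ, 0 < h → h ≤ h₀ → t + h ≤ T →
        ‖M.localError L N u t h -
          M.localErrorPrincipal (Method.expJ L N u t) h (rhs L N (u t))
            (iteratedDerivWithin 1 u (Set.Icc t₀ T) t)
            (iteratedDerivWithin 2 u (Set.Icc t₀ T) t)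
            (iteratedDerivWithin 3 u (Set.Icc t₀ T) t)
            (iteratedFDeriv ℝ 2 (Ntilde N (u t)) (u t))
            (iteratedFDeriv ℝ 3 (Ntilde N (u t)) (u t))
            (iteratedFDeriv ℝ 4 (Ntilde N (u t)) (u t))‖ ≤ C * h ^ 6) ∧
      (∀ q ∈ Finset.Icc 2 5, M.StiffOrder q →
        ∃ C h₀ : ℝ, 0 < h₀ ∧ ∀ t ∈ Set.Icc t₀ T, ∀ h : ℝ, 0 < h → h ≤ h₀ → t + h ≤ T →
          ‖M.localError L N u t h‖ ≤ C * h ^ (q + 1))) := by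
  obtain ⟨B, ω, hω, H⟩ := exists_expJ_bound hL hδ hu_smooth.continuousOn
    (hN_smooth.of_le (by norm_num))
  refine ⟨fun t ht => (H t ht).1, ?_, fun _ hN => ?_⟩
  · choose C h₀ hpos hb using fun i => M.V_expansion hL hT hu hu_smooth hδ hN_smooth i
    obtain ⟨C', hC'⟩ := ((Finset.Icc 2 M.s).image C).bddAbove
    -- There are finitely many stages, so one threshold `r` and one constant `C'` serve all of them.
    have hev : ∀ᶠ r in 𝓝[>] (0 : ℝ), ∀ i ∈ Finset.Icc 2 M.s, r ≤ h₀ i :=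
      (Finset.eventually_all _).2 fun i _ =>
        (eventually_nhdsWithin_of_eventually_nhds (eventually_le_nhds (hpos i)))
    obtain ⟨r, hr, hr0⟩ := (hev.and self_mem_nhdsWithin).exists
    refine ⟨C', r, hr0, fun t ht h h0 h1 i hi => (hb i t ht h h0 (h1.trans (hr i hi))).trans ?_⟩
    have : C i ≤ C' := hC' (by simpa using ⟨i, by simpa using hi, rfl⟩)
    gcongr
  · have herr := M.localError_expansion hL hT hu hu_smooth hδ hN
    refine ⟨isBigO_stepFilter.1 herr, fun q hq hM => (isBigO_stepFilter (Q := admissibleSteps T)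
      (f := fun a => M.localError L N u a.2 a.1)).1 ?_⟩
    obtain ⟨hq2, hq5⟩ := Finset.mem_Icc.1 hq
    have UF := uniformFamily_expJ (Q := admissibleSteps T) hω H
    have hD : ∀ k ≤ 2, _ := fun k (hk : k ≤ 2) =>
      isBigO_iteratedFDeriv_Ntilde (Q := admissibleSteps T) (n := 5) (k := k) hδ
        hu_smooth.continuousOn hN (by omega)
    have hx : ∀ k ≤ 4, _ := fun k (hk : k ≤ 4) =>
      isBigO_iteratedDerivWithin (Q := admissibleSteps T) (n := 4) hT hu_smooth hk
    -- The local error is its deviation from the principal part, of order `h⁶` and hence `h^{q+1}`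
    -- since `q ≤ 5`, plus the principal part.
    refine ((IsBigO.mono_pow UF.step_isBigO (by omega) herr).add
      (hM.principal_isBigO hq2 hq5 UF (F := fun a => rhs L N (u a.2)) (hx 1 (by norm_num))
        (hx 2 (by norm_num)) (hx 3 (by norm_num)) (hD 0 (by norm_num)) (hD 1 (by norm_num))
        (hD 2 (by norm_num)))).congr_left fun a => ?_
    exact sub_add_cancel _ _
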